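/- Let $(M,g)$ be an oriented smooth four-dimensional space-time of signature $(-,+,+,+)$ with metric volume element $\eta$, Levi-Civita connection $\nabla$, Hodge dual $*$ and codifferential $(\delta F)_\beta=-\nabla^\alpha F_{\alpha\beta}$ on 2-forms. A 2+2 structure consists of a time-like plane field $V$ and its orthogonal complement $H$, with projectors $v$ and $h=g-v$; it is given by its smooth canonical 2-form $U$, the volume element of $V$. Let $Q_v(x,y)=h(\nabla_{v(x)}v(y))$ and $Q_h(x,y)=v(\nabla_{h(x)}h(y))$. The structure is integrable if the antisymmetric parts of $Q_v$ and $Q_h$ vanish, and umbilical if the traceless symmetric parts $S_v-\frac12 v\otimes\mathrm{tr}\,S_v$ and $S_h-\frac12 h\otimes\mathrm{tr}\,S_h$ vanish, where $S_v,S_h$ are the symmetric parts of $Q_v,Q_h$. With $A(x)_\mu=A_{\mu\nu}x^\nu$ put $$\Phi=*U(\delta *U)-U(\delta U),\qquad \Psi=*U(\delta U)+U(\delta *U).$$ The structure is Maxwellian if near every point there are functions $\phi,\psi$ such that $F=e^{\phi}(\cos\psi\,U+\sin\psi\,*U)$ satisfies $\delta F=0$ and $\delta *F=0$. Let $\mathcal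 W=\frac12(W-i*W)$ be the self-dual Weyl tensor, acting on the three-dimensional complex space of 2-forms $F$ with $*F=iF$. The space-time is of Petrov-Bel type D if at every point $\mathcal W$ is diagonalizable with a double eigenvalue $\rho\neq0$ and a simple eigenvalue $-2\rho$; the structure is then the principal one if everywhere $\mathcal U=\frac1{\sqrt2}(U-i*U)$ is an eigenvector of $\mathcal W$ for the simple eigenvalue. Proposition. If a Petrov-Bel type D space-time admits an umbilical and integrable 2+2 structure $U$, then the eigenvalues of $\mathcal W$ are real, and the structure is the principal one and Maxwellian; moreover $d\Phi=0$ and $d\Psi=0$. Near every point there is a smooth function $\phi$ with $d\phi=\Phi$. Moreover, whenever $\phi$ is a smooth function on an open set $O$ with $d\phi=\Phi$ on $O$, every point of $O$ has a neighbourhood in $O$ with coordinates $(x^0,x^1,x^2,x^3)$, in which $H$ is spanned by $\partial_2,\partial_3$ and $$g=e^{-\phi}\Big(\sum_{i,j\in\{0,1\}}v_{ij}(x^0,x^1)\,dx^i dx^j+\sum_{A,B\in\{2,3\}}h_{AB}(x^2,x^3)\,dx^A dx^B\Big),$$ that is, $g$ is conformal to a product metric with conformal factor $e^{-\phi}$ (equivalently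 $e^{-2\varphi}$ with $\varphi=\phi/2$, $d\varphi=\frac12\Phi$). -/

import Mathlib

open scoped Manifold ContDiff

noncomputable section

/-- The coordinate space `ℝ⁴`. -/
abbrev E4 : Type := EuclideanSpace ℝ (Fin 4)

/-! ### Tensor algebra at a point, in components

Tensors are given by their covariant components; `g` is the matrix `g_{ab}`, and `g⁻¹` is `g^{ab}`. -/

/-- Components of a 4-form. -/
abbrev FourForm : Type := Fin 4 → Fin 4 → Fin 4 → Fin 4 → ℝ

/-- Components of a complex double 2-form. -/
abbrev DoubleForm : Type := Fin 4 → Fin 4 → Fin 4 → Fin 4 → ℂ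

/-- Hodge dual of a real or complex 2-form, `(*F)_{ab} = ½ η_{abcd} F^{cd}`. -/
def hodge {K : Type} [AddCommGroup K] [Module ℝ K] (g : Matrix (Fin 4) (Fin 4) ℝ) (η : FourForm)
    (F : Matrix (Fin 4) (Fin 4) K) : Matrix (Fin 4) (Fin 4) K :=
  fun a b => ∑ c, ∑ d, ∑ p, ∑ q, ((1 / 2 : ℝ) * η a b c d * g⁻¹ c p * g⁻¹ d q) • F p q

/-- The action `P(F)_{ab} = ½ P_{ab}{}^{mn} F_{mn}` of a double 2-form on complex 2-forms. -/
def act (g : Matrix (Fin 4) (Fin 4) ℝ) (P : DoubleForm) :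
    Module.End ℂ (Matrix (Fin 4) (Fin 4) ℂ) where
  toFun F := Matrix.of fun a b => ∑ m, ∑ n, ∑ p, ∑ q,
    ((1 / 2 : ℂ) * P a b m n * (g⁻¹ m p : ℝ) * (g⁻¹ n q : ℝ)) * F p q
  map_add' F H := by
    ext a b
    simp only [Matrix.of_apply, Matrix.add_apply, mul_add, Finset.sum_add_distrib]
  map_smul' c F := by
    ext a b
    simp only [Matrix.of_apply, Matrix.smul_apply, smul_eq_mul, RingHom.id_apply, Finset.mul_sum,
      mul_left_comm _ c]

/-- `(P ∘ Q)_{abrs} = ½ P_{ab}{}^{mn} Q_{mnrs}`. -/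
def dcomp (g : Matrix (Fin 4) (Fin 4) ℝ) (P Q : DoubleForm) : DoubleForm :=
  fun a b r s => act g P (fun m n => Q m n r s) a b

/-- The metric `𝒢 = ½ (G - i η)` on self-dual 2-forms, where
`G_{abcd} = g_{ac} g_{bd} - g_{ad} g_{bc}`. -/
def sdMetric (g : Matrix (Fin 4) (Fin 4) ℝ) (η : FourForm) : DoubleForm :=
  fun a b c d => (1 / 2 : ℂ) *
    (((g a c * g b d - g a d * g b c : ℝ) : ℂ) - Complex.I * (η a b c d : ℂ))

/-- The self-dual part `𝒲 = 𝒢 ∘ W ∘ 𝒢` of a real double 2-form `W`. -/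
def sdPart (g : Matrix (Fin 4) (Fin 4) ℝ) (η : FourForm)
    (W : Fin 4 → Fin 4 → Fin 4 → Fin 4 → ℝ) : DoubleForm :=
  dcomp g (sdMetric g η) (dcomp g (fun a b c d => (W a b c d : ℂ)) (sdMetric g η))

/-- The complex vector space of self-dual 2-forms: antisymmetric `F` with `*F = i F`. -/
def sdBivectors (g : Matrix (Fin 4) (Fin 4) ℝ) (η : FourForm) :
    Submodule ℂ (Matrix (Fin 4) (Fin 4) ℂ) where
  carrier := {F | F.transpose = -F ∧ hodge g η F = Complex.I • F}
  zero_mem' := by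
    refine ⟨by simp, ?_⟩
    ext a b
    simp [hodge]
  add_mem' := by
    rintro F H ⟨hF, hF'⟩ ⟨hH, hH'⟩
    refine ⟨by rw [Matrix.transpose_add, hF, hH, neg_add], ?_⟩
    rw [smul_add, ← hF', ← hH']
    ext a b
    simp only [hodge, Matrix.add_apply, smul_add, Finset.sum_add_distrib]
  smul_mem' := by
    rintro c F ⟨hF, hF'⟩
    refine ⟨by rw [Matrix.transpose_smul, hF, smul_neg], ?_⟩
    rw [smul_comm, ← hF']
    ext a b
    simp only [hodge, Matrix.smul_apply, smul_comm _ c, Finset.smul_sum]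

/-- The eigenspace for `ρ` of a double 2-form acting on the self-dual 2-forms. -/
def sdEigenspace (g : Matrix (Fin 4) (Fin 4) ℝ) (η : FourForm) (P : DoubleForm) (ρ : ℂ) :
    Submodule ℂ (Matrix (Fin 4) (Fin 4) ℂ) :=
  sdBivectors g η ⊓ (act g P).eigenspace ρ

/-- The canonical self-dual bivector `𝒰 = (U - i *U) / √2` of a real 2-form `U`. -/
def sdBivector (g : Matrix (Fin 4) (Fin 4) ℝ) (η : FourForm) (U : Matrix (Fin 4) (Fin 4) ℝ) :
    Matrix (Fin 4) (Fin 4) ℂ :=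
  fun a b => ((1 / √2 : ℝ) : ℂ) * ((U a b : ℂ) - Complex.I * ((hodge (K := ℝ) g η U a b : ℝ) : ℂ))

/-! ### Tensor calculus in coordinates

`G : E4 → Matrix` are the components `g_{ab}` of the metric as functions of the coordinates. -/

/-- The partial derivative `∂_k f`. -/
def pd (k : Fin 4) (f : E4 → ℝ) (y : E4) : ℝ := fderiv ℝ f y (EuclideanSpace.single k 1)

/-- The Christoffel symbol `Γ^a_{bc}`. -/
def christoffel (G : E4 → Matrix (Fin 4) (Fin 4) ℝ) (a b c : Fin 4) (y : E4) : ℝ :=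
  (1 / 2) * ∑ d, (G y)⁻¹ a d *
    (pd b (fun z => G z d c) y + pd c (fun z => G z d b) y - pd d (fun z => G z b c) y)

/-- The curvature tensor `R^a_{bcd} = ∂_c Γ^a_{db} - ∂_d Γ^a_{cb} + Γ^a_{ce} Γ^e_{db}
- Γ^a_{de} Γ^e_{cb}`. -/
def riemannUp (G : E4 → Matrix (Fin 4) (Fin 4) ℝ) (a b c d : Fin 4) (y : E4) : ℝ :=
  pd c (christoffel G a d b) y - pd d (christoffel G a c b) y
    + ∑ e, (christoffel G a c e y * christoffel G e d b y
      - christoffel G a d e y * christoffel G e c b y)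

/-- The curvature tensor with all indices down, `R_{abcd}`. -/
def riemann (G : E4 → Matrix (Fin 4) (Fin 4) ℝ) (a b c d : Fin 4) (y : E4) : ℝ :=
  ∑ e, G y a e * riemannUp G e b c d y

/-- The Ricci tensor `R_{bd} = R^a_{bad}`. -/
def ricci (G : E4 → Matrix (Fin 4) (Fin 4) ℝ) (b d : Fin 4) (y : E4) : ℝ :=
  ∑ a, riemannUp G a b a d y

/-- The scalar curvature. -/
def scalarCurv (G : E4 → Matrix (Fin 4) (Fin 4) ℝ) (y : E4) : ℝ :=
  ∑ b, ∑ d, (G y)⁻¹ b d * ricci G b d y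

/-- The Weyl tensor `W_{abcd}` in dimension four. -/
def weyl (G : E4 → Matrix (Fin 4) (Fin 4) ℝ) (y : E4) (a b c d : Fin 4) : ℝ :=
  riemann G a b c d y
    - (1 / 2) * (G y a c * ricci G b d y + G y b d * ricci G a c y
        - G y a d * ricci G b c y - G y b c * ricci G a d y)
    + (scalarCurv G y / 6) * (G y a c * G y b d - G y a d * G y b c)

/-- The exterior codifferential of a 2-form, `(δF)_b = -∇^a F_{ab}`; for signature `(-,+,+,+)` in
dimension four this is `* d *`. -/
def codiff (G F : E4 → Matrix (Fin 4) (Fin 4) ℝ) (b : Fin 4) (y : E4) : ℝ :=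
  -∑ a, ∑ c, (G y)⁻¹ a c *
    (pd c (fun z => F z a b) y
      - ∑ n, (christoffel G n c a y * F y n b + christoffel G n c b y * F y a n))

/-- The 1-form `A(x)_m = A_{mn} x^n`, where `x` is the vector metrically equivalent to the
1-form `ξ`. -/
def applyForm (g A : Matrix (Fin 4) (Fin 4) ℝ) (ξ : Fin 4 → ℝ) (m : Fin 4) : ℝ :=
  ∑ n, ∑ r, A m n * g⁻¹ n r * ξ r

/-- The expansion 1-form `Φ[U] = *U(δ*U) - U(δU)`. -/
def expansionForm (G : E4 → Matrix (Fin 4) (Fin 4) ℝ) (η : E4 → FourForm)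
    (U : E4 → Matrix (Fin 4) (Fin 4) ℝ) (m : Fin 4) (y : E4) : ℝ :=
  applyForm (G y) (hodge (G y) (η y) (U y))
      (fun b => codiff G (fun z => hodge (G z) (η z) (U z)) b y) m
    - applyForm (G y) (U y) (fun b => codiff G U b y) m

/-- The rotation 1-form `Ψ[U] = *U(δU) + U(δ*U)`. -/
def rotationForm (G : E4 → Matrix (Fin 4) (Fin 4) ℝ) (η : E4 → FourForm)
    (U : E4 → Matrix (Fin 4) (Fin 4) ℝ) (m : Fin 4) (y : E4) : ℝ :=
  applyForm (G y) (hodge (G y) (η y) (U y)) (fun b => codiff G U b y) m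
    + applyForm (G y) (U y) (fun b => codiff G (fun z => hodge (G z) (η z) (U z)) b y) m

/-- The components `Q^a_{bc}` of the generalized second fundamental form
`Q(x, y) = q(∇_{p(x)} p(y))` of the plane field with projector `p = (p^a_b)`, where
`q = 1 - p` is the complementary projector; `Q` is tensorial, so it is evaluated on the
coordinate vector fields `x = ∂_b`, `y = ∂_c`. -/
def secondForm (G p : E4 → Matrix (Fin 4) (Fin 4) ℝ) (a b c : Fin 4) (y : E4) : ℝ :=
  ∑ m, ∑ k, (1 - p y) a m * p y k b *
    (pd k (fun z => p z m c) y + ∑ n, christoffel G m k n y * p y n c)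

/-- The antisymmetric part `A` of the second fundamental form. -/
def antisymSecondForm (G p : E4 → Matrix (Fin 4) (Fin 4) ℝ) (a b c : Fin 4) (y : E4) : ℝ :=
  (1 / 2) * (secondForm G p a b c y - secondForm G p a c b y)

/-- The symmetric part `S` of the second fundamental form. -/
def symSecondForm (G p : E4 → Matrix (Fin 4) (Fin 4) ℝ) (a b c : Fin 4) (y : E4) : ℝ :=
  (1 / 2) * (secondForm G p a b c y + secondForm G p a c b y)

/-- The traceless symmetric part `Sᵀ = S - ½ p ⊗ tr S` for a field of 2-planes. -/
def tracelessSecondForm (G p : E4 → Matrix (Fin 4) (Fin 4) ℝ) (a b c : Fin 4) (y : E4) : ℝ :=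
  symSecondForm G p a b c y
    - (1 / 2) * (G y * p y) b c * ∑ r, ∑ s, (G y)⁻¹ r s * symSecondForm G p a r s y

/-- The projector `v^a_b` of the time-like plane with volume element `U`: `v = U²`. -/
def timelikeProj (G U : E4 → Matrix (Fin 4) (Fin 4) ℝ) (y : E4) : Matrix (Fin 4) (Fin 4) ℝ :=
  ((G y)⁻¹ * U y) * ((G y)⁻¹ * U y)

/-- The projector `h = 1 - v` on the orthogonal space-like plane. -/
def spacelikeProj (G U : E4 → Matrix (Fin 4) (Fin 4) ℝ) (y : E4) : Matrix (Fin 4) (Fin 4) ℝ :=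
  1 - timelikeProj G U y

/-- The metric of a product of two surfaces: block-diagonal with blocks `v` and `h`. -/
def blockMetric (v h : Matrix (Fin 2) (Fin 2) ℝ) : Matrix (Fin 4) (Fin 4) ℝ :=
  Matrix.reindex finSumFinEquiv finSumFinEquiv (Matrix.fromBlocks v 0 0 h)

/-! ### Space-times and 2+2 structures -/

section Manifold

variable {M : Type*} [TopologicalSpace M] [ChartedSpace E4 M]

/-- The coordinate vector `∂_i` of the chart `e` at the point with coordinates `y`. -/
def coordVec (e : OpenPartialHomeomorph M E4) (y : E4) (i : Fin 4) :
    TangentSpace (𝓡 4) (e.symm y) :=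
  mfderiv (𝓡 4) (𝓡 4) e.symm y (EuclideanSpace.single i 1 : E4)

/-- The components in the chart `e` of a field of bilinear forms on the tangent spaces. -/
def comp2 (B : (x : M) → TangentSpace (𝓡 4) x →ₗ[ℝ] TangentSpace (𝓡 4) x →ₗ[ℝ] ℝ)
    (e : OpenPartialHomeomorph M E4) (y : E4) : Matrix (Fin 4) (Fin 4) ℝ :=
  fun i j => B (e.symm y) (coordVec e y i) (coordVec e y j)

/-- The components in the chart `e` of a field of 4-forms on the tangent spaces. -/
def comp4 (η : (x : M) → TangentSpace (𝓡 4) x [⋀^Fin 4]→ₗ[ℝ] ℝ)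
    (e : OpenPartialHomeomorph M E4) (y : E4) : FourForm :=
  fun a b c d => η (e.symm y) ![coordVec e y a, coordVec e y b, coordVec e y c, coordVec e y d]

/-- The Minkowski matrix `diag(-1, 1, 1, 1)`. -/
def minkowski : Matrix (Fin 4) (Fin 4) ℝ := Matrix.diagonal ![-1, 1, 1, 1]

variable (M) in
/-- An oriented space-time: a smooth Lorentzian metric `g` of signature `(-,+,+,+)` on the
4-manifold `M`, with the orientation given by the metric volume element `η`. -/
structure SpaceTime where
  g : (x : M) → TangentSpace (𝓡 4) x →ₗ[ℝ] TangentSpace (𝓡 4) x →ₗ[ℝ] ℝ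
  η : (x : M) → TangentSpace (𝓡 4) x [⋀^Fin 4]→ₗ[ℝ] ℝ
  symm : ∀ (x : M) (u w : TangentSpace (𝓡 4) x), g x u w = g x w u
  lorentzian : ∀ x : M, ∃ b : Fin 4 → TangentSpace (𝓡 4) x,
    ∀ i j, g x (b i) (b j) = minkowski i j
  volume : ∀ (x : M) (b : Fin 4 → TangentSpace (𝓡 4) x),
    (∀ i j, g x (b i) (b j) = minkowski i j) → η x b = 1 ∨ η x b = -1
  smooth_g : ∀ e ∈ IsManifold.maximalAtlas (𝓡 4) ∞ M, ∀ i j,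
    ContDiffOn ℝ ∞ (fun y => comp2 g e y i j) e.target
  smooth_η : ∀ e ∈ IsManifold.maximalAtlas (𝓡 4) ∞ M, ∀ a b c d,
    ContDiffOn ℝ ∞ (fun y => comp4 η e y a b c d) e.target

namespace SpaceTime

variable (S : SpaceTime M)

/-- The components of the metric in a chart. -/
def gc (e : OpenPartialHomeomorph M E4) : E4 → Matrix (Fin 4) (Fin 4) ℝ := comp2 S.g e

/-- The components of the volume element in a chart. -/
def ηc (e : OpenPartialHomeomorph M E4) : E4 → FourForm := comp4 S.η e

/-- The self-dual Weyl tensor `𝒲` at the point with coordinates `y`. -/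
def sdWeyl (e : OpenPartialHomeomorph M E4) (y : E4) : DoubleForm :=
  sdPart (S.gc e y) (S.ηc e y) (weyl (S.gc e) y)

/-- The eigenspace for `ρ` of `𝒲` on the self-dual 2-forms at the point with coordinates `y`. -/
def weylEigenspace (e : OpenPartialHomeomorph M E4) (y : E4) (ρ : ℂ) :
    Submodule ℂ (Matrix (Fin 4) (Fin 4) ℂ) :=
  sdEigenspace (S.gc e y) (S.ηc e y) (S.sdWeyl e y) ρ

/-- Petrov-Bel type D: at every point the traceless map `𝒲` on the 3-dimensional space of
self-dual 2-forms has a double eigenvalue `ρ ≠ 0` and a simple eigenvalue `-2ρ`, and it is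
diagonalizable (its minimal polynomial has degree two). -/
def IsTypeD : Prop :=
  ∀ e ∈ IsManifold.maximalAtlas (𝓡 4) ∞ M, ∀ y ∈ e.target, ∃ ρ : ℂ, ρ ≠ 0 ∧
    Module.finrank ℂ (S.weylEigenspace e y ρ) = 2 ∧
    Module.finrank ℂ (S.weylEigenspace e y (-2 * ρ)) = 1

/-- All the eigenvalues of the Weyl tensor are real. -/
def HasRealWeylEigenvalues : Prop :=
  ∀ e ∈ IsManifold.maximalAtlas (𝓡 4) ∞ M, ∀ y ∈ e.target, ∀ ρ : ℂ,
    S.weylEigenspace e y ρ ≠ ⊥ → ρ.im = 0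

end SpaceTime

/-- A 2+2 structure, given by its canonical 2-form `U`: a smooth 2-form that at every point is the
volume element of a time-like plane, that is, `U = b⁰ ∧ b¹` in some orthonormal frame `b`. The
time-like plane is spanned by `b 0`, `b 1`, its orthogonal complement by `b 2`, `b 3`. -/
structure TwoPlusTwo (S : SpaceTime M) where
  U : (x : M) → TangentSpace (𝓡 4) x →ₗ[ℝ] TangentSpace (𝓡 4) x →ₗ[ℝ] ℝ
  unitary : ∀ x : M, ∃ b : Fin 4 → TangentSpace (𝓡 4) x,
    (∀ i j, S.g x (b i) (b j) = minkowski i j) ∧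
    (∀ i j, U x (b i) (b j) =
      if i = 0 ∧ j = 1 then 1 else if i = 1 ∧ j = 0 then -1 else 0)
  smooth_U : ∀ e ∈ IsManifold.maximalAtlas (𝓡 4) ∞ M, ∀ i j,
    ContDiffOn ℝ ∞ (fun y => comp2 U e y i j) e.target

namespace TwoPlusTwo

variable {S : SpaceTime M} (T : TwoPlusTwo S)

/-- The components of the canonical 2-form in a chart. -/
def Uc (e : OpenPartialHomeomorph M E4) : E4 → Matrix (Fin 4) (Fin 4) ℝ := comp2 T.U e

/-- The expansion 1-form `Φ[U]` in a chart. -/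
def Φ (e : OpenPartialHomeomorph M E4) : Fin 4 → E4 → ℝ :=
  expansionForm (S.gc e) (S.ηc e) (T.Uc e)

/-- The rotation 1-form `Ψ[U]` in a chart. -/
def Ψ (e : OpenPartialHomeomorph M E4) : Fin 4 → E4 → ℝ :=
  rotationForm (S.gc e) (S.ηc e) (T.Uc e)

/-- The structure is umbilical: `Sᵀ` vanishes for both planes. -/
def IsUmbilical : Prop :=
  ∀ e ∈ IsManifold.maximalAtlas (𝓡 4) ∞ M, ∀ y ∈ e.target, ∀ a b c,
    tracelessSecondForm (S.gc e) (timelikeProj (S.gc e) (T.Uc e)) a b c y = 0 ∧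
    tracelessSecondForm (S.gc e) (spacelikeProj (S.gc e) (T.Uc e)) a b c y = 0

/-- The structure is integrable: `A` vanishes for both planes. -/
def IsIntegrable : Prop :=
  ∀ e ∈ IsManifold.maximalAtlas (𝓡 4) ∞ M, ∀ y ∈ e.target, ∀ a b c,
    antisymSecondForm (S.gc e) (timelikeProj (S.gc e) (T.Uc e)) a b c y = 0 ∧
    antisymSecondForm (S.gc e) (spacelikeProj (S.gc e) (T.Uc e)) a b c y = 0

/-- The structure is the principal structure of a type D Weyl tensor: at every point its canonical
self-dual bivector is an eigenbivector for the simple eigenvalue. -/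
def IsPrincipal : Prop :=
  ∀ e ∈ IsManifold.maximalAtlas (𝓡 4) ∞ M, ∀ y ∈ e.target, ∃ ρ : ℂ, ρ ≠ 0 ∧
    Module.finrank ℂ (S.weylEigenspace e y ρ) = 2 ∧
    Module.finrank ℂ (S.weylEigenspace e y (-2 * ρ)) = 1 ∧
    sdBivector (S.gc e y) (S.ηc e y) (T.Uc e y) ∈ S.weylEigenspace e y (-2 * ρ)

/-- The 2-form `e^φ (cos ψ U + sin ψ *U)` in a chart. -/
def rotated (e : OpenPartialHomeomorph M E4) (φ ψ : M → ℝ) (y : E4) :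
    Matrix (Fin 4) (Fin 4) ℝ :=
  Real.exp (φ (e.symm y)) • (Real.cos (ψ (e.symm y)) • T.Uc e y
    + Real.sin (ψ (e.symm y)) • hodge (S.gc e y) (S.ηc e y) (T.Uc e y))

/-- The structure is Maxwellian: near every point some 2-form
`F = e^φ (cos ψ U + sin ψ *U)` solves the source-free Maxwell equations `δF = 0`, `δ*F = 0`. -/
def IsMaxwellian : Prop :=
  ∀ e ∈ IsManifold.maximalAtlas (𝓡 4) ∞ M, ∀ p ∈ e.source,
    ∃ (O : Set M) (φ ψ : M → ℝ), IsOpen O ∧ p ∈ O ∧ O ⊆ e.source ∧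
      ContMDiffOn (𝓡 4) 𝓘(ℝ) ∞ φ O ∧ ContMDiffOn (𝓡 4) 𝓘(ℝ) ∞ ψ O ∧
      ∀ y ∈ e.target, e.symm y ∈ O → ∀ b,
        codiff (S.gc e) (T.rotated e φ ψ) b y = 0 ∧
        codiff (S.gc e) (fun z => hodge (S.gc e z) (S.ηc e z) (T.rotated e φ ψ z)) b y = 0

/-- The expansion and rotation 1-forms are closed: `dΦ = 0` and `dΨ = 0`. -/
def HasClosedForms : Prop :=
  ∀ e ∈ IsManifold.maximalAtlas (𝓡 4) ∞ M, ∀ y ∈ e.target, ∀ a b,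
    pd a (T.Φ e b) y = pd b (T.Φ e a) y ∧ pd a (T.Ψ e b) y = pd b (T.Ψ e a) y

/-- `φ` is a smooth function on the open subset `O` of the domain of the chart `e`, and
`dφ = Φ[U]` on `O`. -/
def IsPotential (e : OpenPartialHomeomorph M E4) (O : Set M) (φ : M → ℝ) : Prop :=
  IsOpen O ∧ O ⊆ e.source ∧ ContMDiffOn (𝓡 4) 𝓘(ℝ) ∞ φ O ∧
    ∀ y ∈ e.target, e.symm y ∈ O → ∀ k, pd k (fun z => φ (e.symm z)) y = T.Φ e k y

/-- Near `p`, inside `O`, there are coordinates `(x⁰, x¹, x², x³)` in which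
`g = e^{-φ} (v_{ij}(x⁰, x¹) dxⁱ dxʲ + h_{AB}(x², x³) dx^A dx^B)`, adapted to the structure: the
space-like plane, which is the kernel of `U`, is spanned by `∂_2`, `∂_3`. -/
def IsConformallyProductAt (O : Set M) (φ : M → ℝ) (p : M) : Prop :=
  ∃ e ∈ IsManifold.maximalAtlas (𝓡 4) ∞ M, p ∈ e.source ∧ e.source ⊆ O ∧
    (∀ y ∈ e.target, ∀ j, T.Uc e y 2 j = 0 ∧ T.Uc e y 3 j = 0) ∧
    ∃ v h : ℝ → ℝ → Matrix (Fin 2) (Fin 2) ℝ, ∀ y ∈ e.target,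
      S.gc e y = Real.exp (-φ (e.symm y)) • blockMetric (v (y 0) (y 1)) (h (y 2) (y 3))

end TwoPlusTwo

end Manifold

end

noncomputable section

/-! ### Partial derivatives -/

section PartialDerivatives

variable {Ω : Set E4} {f f' : E4 → ℝ} {y : E4}

/-! Write V and H for the time-like and space-like planes, v and h for their projectors, ξ and ζ for
the mean curvature forms of V and H (`meanForm` of v and of h). The form ξ annihilates V and ζ
annihilates H. Vanishing of the antisymmetric and of the traceless symmetric second fundamental
forms leaves only these two 1-forms, and the covariant derivative of v becomes algebraic in them
(`IsUmbilicalSplitting.covd_proj`): ∇_k v_ab = v_ka ξ_b + v_kb ξ_a - h_ka ζ_b - h_kb ζ_a.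

The Ricci identity for v then determines every curvature component R_lkij with i in V and j in H, in
terms of ∇ξ - ξ⊗ξ and ∇ζ - ζ⊗ζ (`fr4_riemann_eq`). Removing the Ricci and scalar parts preserves the
algebraic shape, so the Weyl tensor has it too, for shifted tensors X and Z (`fr4_weyl`). On
self-dual 2-forms, in the coordinates F_01, F_02, F_03 of an adapted frame, the self-dual Weyl
tensor is a symmetric matrix with rows (m, a, b), (a, q, 0), (b, 0, q), where q is real
(`HasMixedForm.sdBlock_values`). A two-dimensional eigenspace contains vectors with any one
coordinate zero. This forces the double eigenvalue to be q and then a = b = 0, and the simple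
eigenvalue forces m = -2q (`IsOrientedFrame.typeD`). So the eigenvalues are real and the canonical
bivector, whose coordinates F_02 and F_03 vanish, is principal. The equations a = b = 0 say that
X_ij = Z_ji for i in V and j in H.

That last relation is what closes ξ + ζ (`closed_meanForm_add`). For i in V and j in H it gives ∇_i
ξ_j = ∇_j ζ_i. Differentiating the normality of ξ and ζ gives ∇_j ξ_i = ξ_j ζ_i = ∇_i ζ_j, so the
mixed components of d(ξ + ζ) cancel. The components inside V or inside H vanish by the normality
relations and by the pair symmetry of the curvature. Since Φ = 2(ξ + ζ) and Ψ = 0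
(`expansionForm_eq`, `rotationForm_eq`), both forms are closed. The Poincaré lemma on a ball gives a
local potential φ of Φ, and e^φ U solves Maxwell's equations with ψ = 0 (`maxwell`).

For the product form, Frobenius' theorem for V and for H gives coordinates whose first two vectors
span V and whose last two span H (`exists_adapted_chart`). Umbilicity says that the metric of a
V-leaf changes along ∂_k in H by the factor -2 ξ(∂_k) (`pd_induced`), while dφ(∂_k) = 2 ξ(∂_k)
because ζ annihilates H. Hence e^φ g restricted to V does not depend on the coordinates of H, and
symmetrically with the planes exchanged.

Frobenius' theorem itself is proved by the inverse function theorem in the Banach space of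
continuous paths: the plane field is spanned by commuting vector fields, and their joint flow solves
a completely integrable total differential equation (`exists_solution_total_differential`). -/

theorem ContDiffOn.differentiableAt_of_isOpen (hΩ : IsOpen Ω) (hf : ContDiffOn ℝ ∞ f Ω)
    (hy : y ∈ Ω) : DifferentiableAt ℝ f y :=
  (hf.contDiffAt (hΩ.mem_nhds hy)).differentiableAt (by simp)

theorem pd_congr (hΩ : IsOpen Ω) (h : ∀ z ∈ Ω, f z = f' z) (hy : y ∈ Ω) (k : Fin 4) :
    pd k f y = pd k f' y := by
  have : f =ᶠ[nhds y] f' := Filter.eventuallyEq_of_mem (hΩ.mem_nhds hy) h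
  simp only [pd, this.fderiv_eq]

theorem contDiffOn_pd (hΩ : IsOpen Ω) (hf : ContDiffOn ℝ ∞ f Ω) (k : Fin 4) :
    ContDiffOn ℝ ∞ (pd k f) Ω :=
  (hf.fderiv_of_isOpen hΩ (m := ∞) (by simp)).clm_apply contDiffOn_const

theorem pd_comm (hΩ : IsOpen Ω) (hf : ContDiffOn ℝ ∞ f Ω) (hy : y ∈ Ω) (k l : Fin 4) :
    pd k (pd l f) y = pd l (pd k f) y := by
  have hf' := hf.contDiffAt (hΩ.mem_nhds hy)
  have hd : DifferentiableAt ℝ (fderiv ℝ f) y :=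
    (hf'.fderiv_right (m := 1) (by norm_cast)).differentiableAt (by simp)
  have hsymm : IsSymmSndFDerivAt ℝ f y := hf'.isSymmSndFDerivAt (by simp; exact WithTop.coe_le_coe.2 (le_top : (2 : ℕ∞) ≤ ⊤))
  unfold pd
  rw [fderiv_clm_apply hd (by fun_prop), fderiv_clm_apply hd (by fun_prop)]
  simpa using hsymm _ _

theorem pd_add (hΩ : IsOpen Ω) (hf : ContDiffOn ℝ ∞ f Ω) (hf' : ContDiffOn ℝ ∞ f' Ω)
    (hy : y ∈ Ω) (k : Fin 4) : pd k (fun z => f z + f' z) y = pd k f y + pd k f' y := by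
  simp only [pd]
  rw [fderiv_fun_add (hf.differentiableAt_of_isOpen hΩ hy)
    (hf'.differentiableAt_of_isOpen hΩ hy)]
  rfl

theorem pd_sub (hΩ : IsOpen Ω) (hf : ContDiffOn ℝ ∞ f Ω) (hf' : ContDiffOn ℝ ∞ f' Ω)
    (hy : y ∈ Ω) (k : Fin 4) : pd k (fun z => f z - f' z) y = pd k f y - pd k f' y := by
  simp only [pd]
  rw [fderiv_fun_sub (hf.differentiableAt_of_isOpen hΩ hy)
    (hf'.differentiableAt_of_isOpen hΩ hy)]
  rfl

theorem pd_mul (hΩ : IsOpen Ω) (hf : ContDiffOn ℝ ∞ f Ω) (hf' : ContDiffOn ℝ ∞ f' Ω)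
    (hy : y ∈ Ω) (k : Fin 4) :
    pd k (fun z => f z * f' z) y = pd k f y * f' y + f y * pd k f' y := by
  simp only [pd]
  rw [fderiv_fun_mul (hf.differentiableAt_of_isOpen hΩ hy)
    (hf'.differentiableAt_of_isOpen hΩ hy)]
  simp [mul_comm, add_comm]

theorem pd_sum {ι : Type*} (s : Finset ι) {F : ι → E4 → ℝ} (hΩ : IsOpen Ω)
    (hF : ∀ i ∈ s, ContDiffOn ℝ ∞ (F i) Ω) (hy : y ∈ Ω) (k : Fin 4) :
    pd k (fun z => ∑ i ∈ s, F i z) y = ∑ i ∈ s, pd k (F i) y := by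
  simp only [pd]
  rw [fderiv_fun_sum fun i hi => (hF i hi).differentiableAt_of_isOpen hΩ hy]
  simp

theorem pd_const (c : ℝ) (k : Fin 4) : pd k (fun _ => c) y = 0 := by simp [pd]

theorem fderiv_apply_eq_sum_pd (f : E4 → ℝ) (y w : E4) :
    fderiv ℝ f y w = ∑ k, w k * pd k f y := by
  have : w = ∑ k, w k • (EuclideanSpace.single k (1 : ℝ) : E4) := by
    ext i
    simp [Finset.sum_apply, Pi.single_apply]
  conv_lhs => rw [this]
  simp [pd]

end PartialDerivatives

/-! ### Matrices of smooth functions -/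

/-- A matrix-valued function with smooth entries on `Ω`. -/
def SmoothMat (Ω : Set E4) (A : E4 → Matrix (Fin 4) (Fin 4) ℝ) : Prop :=
  ∀ a b, ContDiffOn ℝ ∞ (fun z => A z a b) Ω

/-- The matrix of partial derivatives of the entries. -/
def pdm (k : Fin 4) (A : E4 → Matrix (Fin 4) (Fin 4) ℝ) (y : E4) : Matrix (Fin 4) (Fin 4) ℝ :=
  Matrix.of fun a b => pd k (fun z => A z a b) y

theorem pdm_apply (k : Fin 4) (A : E4 → Matrix (Fin 4) (Fin 4) ℝ) (y : E4) (a b : Fin 4) :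
    pdm k A y a b = pd k (fun z => A z a b) y := rfl

section SmoothMatrices

variable {Ω : Set E4} {A A' : E4 → Matrix (Fin 4) (Fin 4) ℝ} {y : E4}

theorem SmoothMat.sub (hA : SmoothMat Ω A) (hA' : SmoothMat Ω A') :
    SmoothMat Ω (fun z => A z - A' z) := fun a b => (hA a b).sub (hA' a b)

theorem SmoothMat.transpose (hA : SmoothMat Ω A) : SmoothMat Ω (fun z => (A z).transpose) :=
  fun a b => hA b a

theorem SmoothMat.mul (hA : SmoothMat Ω A) (hA' : SmoothMat Ω A') :
    SmoothMat Ω (fun z => A z * A' z) := fun a b => by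
  simp only [Matrix.mul_apply]
  exact ContDiffOn.sum fun c _ => (hA a c).mul (hA' c b)

theorem smoothMat_const (C : Matrix (Fin 4) (Fin 4) ℝ) : SmoothMat Ω (fun _ => C) :=
  fun _ _ => contDiffOn_const

theorem SmoothMat.pdm (hΩ : IsOpen Ω) (hA : SmoothMat Ω A) (k : Fin 4) : SmoothMat Ω (pdm k A) :=
  fun a b => contDiffOn_pd hΩ (hA a b) k

theorem SmoothMat.contDiffOn_det (hA : SmoothMat Ω A) :
    ContDiffOn ℝ ∞ (fun z => (A z).det) Ω := by
  simp only [Matrix.det_apply]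
  exact ContDiffOn.sum fun σ _ => (contDiffOn_prod fun i _ => hA _ _).const_smul _

/-- Cramer's rule: the entries of the inverse are polynomials in the entries divided by the
determinant. -/
theorem SmoothMat.inv (hA : SmoothMat Ω A) (h : ∀ z ∈ Ω, (A z).det ≠ 0) :
    SmoothMat Ω (fun z => (A z)⁻¹) := fun a b => by
  have hadj : ContDiffOn ℝ ∞ (fun z => (A z).adjugate a b) Ω := by
    simp only [Matrix.adjugate_apply]
    refine SmoothMat.contDiffOn_det (A := fun z => (A z).updateRow b (Pi.single a 1)) fun i j => ?_
    by_cases hi : i = b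
    · subst hi
      simpa using contDiffOn_const
    · simpa [Matrix.updateRow_ne hi] using hA i j
  have : ∀ z, (A z)⁻¹ a b = ((A z).det)⁻¹ * (A z).adjugate a b := fun z => by
    simp [Matrix.inv_def]
  simp only [this]
  exact (hA.contDiffOn_det.inv h).mul hadj

theorem pdm_congr (hΩ : IsOpen Ω) (h : ∀ z ∈ Ω, A z = A' z) (hy : y ∈ Ω) (k : Fin 4) :
    pdm k A y = pdm k A' y := by
  ext a b
  exact pd_congr hΩ (fun z hz => by rw [h z hz]) hy k

theorem pdm_comm (hΩ : IsOpen Ω) (hA : SmoothMat Ω A) (hy : y ∈ Ω) (k l : Fin 4) :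
    pdm k (pdm l A) y = pdm l (pdm k A) y := by
  ext a b
  exact pd_comm hΩ (hA a b) hy k l

theorem pdm_sub (hΩ : IsOpen Ω) (hA : SmoothMat Ω A) (hA' : SmoothMat Ω A') (hy : y ∈ Ω)
    (k : Fin 4) : pdm k (fun z => A z - A' z) y = pdm k A y - pdm k A' y := by
  ext a b
  exact pd_sub hΩ (hA a b) (hA' a b) hy k

theorem pdm_transpose (k : Fin 4) :
    pdm k (fun z => (A z).transpose) y = (pdm k A y).transpose := rfl

theorem pdm_const (C : Matrix (Fin 4) (Fin 4) ℝ) (k : Fin 4) : pdm k (fun _ => C) y = 0 := by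
  ext a b
  exact pd_const _ k

theorem pdm_mul (hΩ : IsOpen Ω) (hA : SmoothMat Ω A) (hA' : SmoothMat Ω A') (hy : y ∈ Ω)
    (k : Fin 4) : pdm k (fun z => A z * A' z) y = pdm k A y * A' y + A y * pdm k A' y := by
  ext a b
  simp only [pdm_apply, Matrix.mul_apply, Matrix.add_apply]
  rw [pd_sum _ hΩ (fun c _ => (hA a c).mul (hA' c b)) hy, ← Finset.sum_add_distrib]
  exact Finset.sum_congr rfl fun c _ => pd_mul hΩ (hA a c) (hA' c b) hy k

end SmoothMatrices

/-! ### The Levi-Civita connection -/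

/-- The components of a metric on an open set of coordinates. -/
structure IsMetricOn (Ω : Set E4) (G : E4 → Matrix (Fin 4) (Fin 4) ℝ) : Prop where
  isOpen : IsOpen Ω
  smooth : SmoothMat Ω G
  symm : ∀ z ∈ Ω, (G z).transpose = G z
  det_ne : ∀ z ∈ Ω, (G z).det ≠ 0

/-- The connection matrix `(Γ_k)^a_b = Γ^a_{kb}`. -/
def conn (G : E4 → Matrix (Fin 4) (Fin 4) ℝ) (k : Fin 4) (y : E4) : Matrix (Fin 4) (Fin 4) ℝ :=
  Matrix.of fun a b => christoffel G a k b y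

/-- The curvature matrix `(R_{lk})^a_b = R^a_{blk}`. -/
def curv (G : E4 → Matrix (Fin 4) (Fin 4) ℝ) (l k : Fin 4) (y : E4) : Matrix (Fin 4) (Fin 4) ℝ :=
  pdm l (conn G k) y - pdm k (conn G l) y + conn G l y * conn G k y - conn G k y * conn G l y

/-- The covariant derivative of a covariant 2-tensor. -/
def covd (G T : E4 → Matrix (Fin 4) (Fin 4) ℝ) (k : Fin 4) (y : E4) : Matrix (Fin 4) (Fin 4) ℝ :=
  pdm k T y - (conn G k y).transpose * T y - T y * conn G k y

/-- The covariant derivative of a field of endomorphisms. -/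
def covdEnd (G P : E4 → Matrix (Fin 4) (Fin 4) ℝ) (k : Fin 4) (y : E4) :
    Matrix (Fin 4) (Fin 4) ℝ :=
  pdm k P y + conn G k y * P y - P y * conn G k y

namespace IsMetricOn

variable {Ω : Set E4} {G : E4 → Matrix (Fin 4) (Fin 4) ℝ} (hG : IsMetricOn Ω G) {y : E4}
include hG

theorem isUnit_det {z : E4} (hz : z ∈ Ω) : IsUnit (G z).det := (hG.det_ne z hz).isUnit

theorem smooth_inv : SmoothMat Ω (fun z => (G z)⁻¹) := hG.smooth.inv hG.det_ne

theorem apply_symm {z : E4} (hz : z ∈ Ω) (a b : Fin 4) : G z a b = G z b a := by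
  conv_lhs => rw [← hG.symm z hz]
  rfl

theorem pd_symm (hy : y ∈ Ω) (k a b : Fin 4) :
    pd k (fun z => G z a b) y = pd k (fun z => G z b a) y :=
  pd_congr hG.isOpen (fun _ hz => hG.apply_symm hz a b) hy k

theorem christoffel_symm (hy : y ∈ Ω) (a b c : Fin 4) :
    christoffel G a b c y = christoffel G a c b y := by
  simp only [christoffel]
  congr 1
  refine Finset.sum_congr rfl fun d _ => ?_
  rw [hG.pd_symm hy d b c]
  ring

theorem smooth_christoffel (a b c : Fin 4) : ContDiffOn ℝ ∞ (christoffel G a b c) Ω := by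
  have h : ∀ k a b, ContDiffOn ℝ ∞ (pd k fun z => G z a b) Ω :=
    fun k a b => contDiffOn_pd hG.isOpen (hG.smooth a b) k
  exact contDiffOn_const.mul
    (ContDiffOn.sum fun d _ => (hG.smooth_inv a d).mul (((h _ _ _).add (h _ _ _)).sub (h _ _ _)))

theorem smooth_conn (k : Fin 4) : SmoothMat Ω (conn G k) :=
  fun a b => hG.smooth_christoffel a k b

theorem mul_christoffel (hy : y ∈ Ω) (a b c : Fin 4) :
    ∑ n, G y a n * christoffel G n b c y = (1 / 2) * (pd b (fun z => G z a c) y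
      + pd c (fun z => G z a b) y - pd a (fun z => G z b c) y) := by
  have h : ∀ w : Fin 4 → ℝ, ∑ n, G y a n * ∑ d, (G y)⁻¹ n d * w d = w a := fun w => by
    have := congrFun (Matrix.mulVec_mulVec w (G y) (G y)⁻¹) a
    rw [Matrix.mul_nonsing_inv _ (hG.isUnit_det hy), Matrix.one_mulVec] at this
    simpa [Matrix.mulVec, dotProduct] using this
  simp only [christoffel, mul_left_comm _ (1 / 2 : ℝ), ← Finset.mul_sum]
  rw [h]

theorem pdm_metric (hy : y ∈ Ω) (k : Fin 4) :
    pdm k G y = G y * conn G k y + (conn G k y).transpose * G y := by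
  ext a b
  simp only [pdm_apply, Matrix.add_apply, Matrix.mul_apply, conn, Matrix.transpose_apply,
    Matrix.of_apply]
  have h2 : ∑ n, christoffel G n k a y * G y n b = ∑ n, G y b n * christoffel G n k a y :=
    Finset.sum_congr rfl fun n _ => by rw [hG.apply_symm hy n b, mul_comm]
  rw [h2, hG.mul_christoffel hy, hG.mul_christoffel hy, hG.pd_symm hy k b a, hG.pd_symm hy b k a,
    hG.pd_symm hy a b k, hG.pd_symm hy b a k]
  ring

theorem covd_metric (hy : y ∈ Ω) (k : Fin 4) : covd G G k y = 0 := by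
  rw [covd, hG.pdm_metric hy]
  abel

omit hG in
theorem pdm_eq_covd {T : E4 → Matrix (Fin 4) (Fin 4) ℝ} (k : Fin 4) :
    pdm k T y = covd G T k y + (conn G k y).transpose * T y + T y * conn G k y := by
  rw [covd]
  abel

/-- Lowering an index commutes with the covariant derivative. -/
theorem covd_mul {P : E4 → Matrix (Fin 4) (Fin 4) ℝ} (hP : SmoothMat Ω P) (hy : y ∈ Ω)
    (k : Fin 4) : covd G (fun z => G z * P z) k y = G y * covdEnd G P k y := by
  rw [covd, covdEnd, pdm_mul hG.isOpen hG.smooth hP hy, hG.pdm_metric hy]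
  noncomm_ring

theorem covdEnd_mul {P Q : E4 → Matrix (Fin 4) (Fin 4) ℝ} (hP : SmoothMat Ω P)
    (hQ : SmoothMat Ω Q) (hy : y ∈ Ω) (k : Fin 4) :
    covdEnd G (fun z => P z * Q z) k y = covdEnd G P k y * Q y + P y * covdEnd G Q k y := by
  rw [covdEnd, covdEnd, covdEnd, pdm_mul hG.isOpen hP hQ hy]
  noncomm_ring

/-- The Ricci identity for covariant 2-tensors. -/
theorem ricci_identity {T : E4 → Matrix (Fin 4) (Fin 4) ℝ} (hT : SmoothMat Ω T) (hy : y ∈ Ω)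
    (l k : Fin 4) :
    (pdm l (covd G T k) y - (conn G l y).transpose * covd G T k y - covd G T k y * conn G l y)
      - (pdm k (covd G T l) y - (conn G k y).transpose * covd G T l y
        - covd G T l y * conn G k y)
      = -((curv G l k y).transpose * T y + T y * curv G l k y) := by
  have h : ∀ l k, pdm l (covd G T k) y = pdm l (pdm k T) y
      - ((pdm l (conn G k) y).transpose * T y + (conn G k y).transpose * pdm l T y)
      - (pdm l T y * conn G k y + T y * pdm l (conn G k) y) := fun l k => by
    have hΓ := hG.smooth_conn k
    have h1 := hT.pdm hG.isOpen k
    have h2 := hΓ.transpose.mul hT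
    have h3 := hT.mul hΓ
    have e : covd G T k = fun z => pdm k T z - (conn G k z).transpose * T z - T z * conn G k z :=
      rfl
    rw [e, pdm_sub hG.isOpen (h1.sub h2) h3 hy, pdm_sub hG.isOpen h1 h2 hy,
      pdm_mul hG.isOpen hT hΓ hy, pdm_mul hG.isOpen hΓ.transpose hT hy, pdm_transpose]
  rw [h l k, h k l, pdm_comm hG.isOpen hT hy k l, pdm_eq_covd (G := G) (T := T) k,
    pdm_eq_covd (G := G) (T := T) l, curv]
  simp only [Matrix.transpose_sub, Matrix.transpose_add, Matrix.transpose_mul]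
  noncomm_ring

omit hG in
theorem curv_apply (l k a b : Fin 4) : curv G l k y a b = riemannUp G a b l k y := by
  simp only [curv, riemannUp, Matrix.sub_apply, Matrix.add_apply, Matrix.mul_apply, pdm_apply,
    conn, Matrix.of_apply, Finset.sum_sub_distrib]
  ring

omit hG in
theorem riemann_eq (a b c d : Fin 4) : riemann G a b c d y = (G y * curv G c d y) a b := by
  simp only [riemann, Matrix.mul_apply, curv_apply]

omit hG in
theorem riemann_antisymm_right (a b c d : Fin 4) :
    riemann G a b c d y = -riemann G a b d c y := by
  have h : curv G c d y = -curv G d c y := by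
    rw [curv, curv]
    abel
  rw [riemann_eq, riemann_eq, h, Matrix.mul_neg, Matrix.neg_apply]

/-- The Ricci identity applied to the metric itself: its left side vanishes because the metric is
parallel. -/
theorem riemann_antisymm_left (hy : y ∈ Ω) (a b c d : Fin 4) :
    riemann G a b c d y = -riemann G b a c d y := by
  have h := hG.ricci_identity hG.smooth hy c d
  have h0 : ∀ k l, pdm l (covd G G k) y = 0 := fun k l => by
    rw [pdm_congr hG.isOpen (fun z hz => hG.covd_metric hz k) hy, pdm_const]
  simp only [h0, hG.covd_metric hy, mul_zero, zero_mul, sub_zero] at h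
  have h' : (G y * curv G c d y).transpose + G y * curv G c d y = 0 := by
    rw [Matrix.transpose_mul, hG.symm y hy]
    exact (neg_eq_zero.mp h.symm)
  have := congrFun (congrFun h' a) b
  rw [riemann_eq, riemann_eq]
  simp only [Matrix.add_apply, Matrix.transpose_apply, Matrix.zero_apply] at this
  linarith

/-- Only the symmetry of the Christoffel symbols in their lower indices is used: in the cyclic sum
the derivative terms and the quadratic terms cancel in pairs. -/
theorem bianchi_up (hy : y ∈ Ω) (a b c d : Fin 4) :
    riemannUp G a b c d y + riemannUp G a c d b y + riemannUp G a d b c y = 0 := by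
  have hs : ∀ k a b c, pd k (christoffel G a b c) y = pd k (christoffel G a c b) y :=
    fun k a b c => pd_congr hG.isOpen (fun z hz => hG.christoffel_symm hz a b c) hy k
  simp only [riemannUp, Finset.sum_sub_distrib]
  rw [hs c a d b, hs d a c b, hs b a d c]
  simp only [hG.christoffel_symm hy _ d b, hG.christoffel_symm hy _ c b,
    hG.christoffel_symm hy _ d c]
  ring

theorem bianchi (hy : y ∈ Ω) (a b c d : Fin 4) :
    riemann G a b c d y + riemann G a c d b y + riemann G a d b c y = 0 := by
  simp only [riemann, ← Finset.sum_add_distrib, ← mul_add, hG.bianchi_up hy, mul_zero,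
    Finset.sum_const_zero]

/-- The classical octahedron argument: a linear combination of four cyclic identities in which the
two antisymmetries cancel everything except the two terms compared. -/
theorem riemann_pair (hy : y ∈ Ω) (a b c d : Fin 4) :
    riemann G a b c d y = riemann G c d a b y := by
  have h1 := hG.bianchi hy a b c d
  have h2 := hG.bianchi hy b c d a
  have h3 := hG.bianchi hy c d a b
  have h4 := hG.bianchi hy d a b c
  have l := fun a b c d => hG.riemann_antisymm_left hy a b c d
  have r := fun a b c d => riemann_antisymm_right (G := G) (y := y) a b c d
  have e1 := l b a c d
  have e2 := l c a d b
  have e3 := l d a b c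
  have e4 := l c b d a
  have e5 := l d b a c
  have e6 := l d c a b
  have f1 := r a b c d
  have f2 := r a c b d
  have f3 := r a d b c
  have f4 := r b c a d
  have f5 := r b d a c
  have f6 := r c d a b
  have f7 := r b a c d
  have f8 := r c a b d
  have f9 := r d a b c
  have f10 := r c b a d
  have f11 := r d b a c
  have f12 := r d c a b
  linarith

end IsMetricOn

/-! ### Smooth local diffeomorphisms and composition operators -/

section CompositionOperator

/-- A smooth function with invertible derivative at a point restricts to a smooth local
diffeomorphism. -/
theorem ContDiffOn.exists_smooth_localInverse {E F : Type*} [NormedAddCommGroup E]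
    [NormedSpace ℝ E] [CompleteSpace E] [NormedAddCommGroup F] [NormedSpace ℝ F]
    {f : E → F} {Ω : Set E} (hΩ : IsOpen Ω) (hf : ContDiffOn ℝ ∞ f Ω) {a : E} (ha : a ∈ Ω)
    {f' : E ≃L[ℝ] F} (hf' : HasFDerivAt f (f' : E →L[ℝ] F) a) :
    ∃ Φ : OpenPartialHomeomorph E F, (Φ : E → F) = f ∧ a ∈ Φ.source ∧ Φ.source ⊆ Ω ∧
      ContDiffOn ℝ ∞ Φ.symm Φ.target ∧
      ∀ z ∈ Φ.source, ∃ e : E ≃L[ℝ] F, HasFDerivAt f (e : E →L[ℝ] F) z := by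
  have hfa := hf.contDiffAt (hΩ.mem_nhds ha)
  have hn : (∞ : WithTop ℕ∞) ≠ 0 := by simp
  let Ψ := hfa.toOpenPartialHomeomorph f hf' hn
  have hΨ : (Ψ : E → F) = f := rfl
  -- Invertible operators form an open set, so the source can be shrunk until the derivative is
  -- invertible at each of its points. Then the inverse is smooth on the whole target and not only
  -- near one point.
  let S : Set E := Ω ∩ fderiv ℝ f ⁻¹' Set.range ((↑) : (E ≃L[ℝ] F) → E →L[ℝ] F)
  have hS : IsOpen S :=
    (hf.continuousOn_fderiv_of_isOpen hΩ (by simp)).isOpen_inter_preimage hΩ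
      ContinuousLinearEquiv.isOpen
  have haS : a ∈ S := ⟨ha, f', hf'.fderiv.symm⟩
  have hder : ∀ z ∈ S, ∃ e : E ≃L[ℝ] F, HasFDerivAt f (e : E →L[ℝ] F) z := by
    rintro z ⟨hz, e, he⟩
    refine ⟨e, ?_⟩
    rw [he]
    exact ((hf.contDiffAt (hΩ.mem_nhds hz)).differentiableAt (by simp)).hasFDerivAt
  refine ⟨Ψ.restrOpen S hS, ?_, ?_, ?_, ?_, ?_⟩
  · simp [hΨ]
  · rw [OpenPartialHomeomorph.restrOpen_source]
    exact ⟨hfa.mem_toOpenPartialHomeomorph_source hf' hn, haS⟩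
  · rw [OpenPartialHomeomorph.restrOpen_source]
    exact fun z hz => hz.2.1
  · intro w hw
    have hz := (Ψ.restrOpen S hS).map_target hw
    rw [OpenPartialHomeomorph.restrOpen_source] at hz
    obtain ⟨e, he⟩ := hder _ hz.2
    exact ((Ψ.restrOpen S hS).contDiffAt_symm hw he
      (hf.contDiffAt (hΩ.mem_nhds hz.2.1))).contDiffWithinAt
  · intro z hz
    rw [OpenPartialHomeomorph.restrOpen_source] at hz
    exact hder z hz.2

variable {K : Type} [TopologicalSpace K] [CompactSpace K]
  {E F : Type} [NormedAddCommGroup E] [NormedSpace ℝ E] [NormedAddCommGroup F] [NormedSpace ℝ F]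

/-- Pointwise application of a family of operators to a family of vectors. -/
def pointwiseApply (K E F : Type) [TopologicalSpace K] [CompactSpace K] [NormedAddCommGroup E]
    [NormedSpace ℝ E] [NormedAddCommGroup F] [NormedSpace ℝ F] :
    C(K, E →L[ℝ] F) →L[ℝ] C(K, E) →L[ℝ] C(K, F) :=
  LinearMap.mkContinuous₂
    (LinearMap.mk₂ ℝ (fun (A : C(K, E →L[ℝ] F)) (h : C(K, E)) => (⟨fun t => A t (h t), by fun_prop⟩ : C(K, F)))
      (fun _ _ _ => by ext; simp) (fun _ _ _ => by ext; simp)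
      (fun _ _ _ => by ext; simp) (fun _ _ _ => by ext; simp)) 1 (fun A h => by
        rw [one_mul]
        refine (ContinuousMap.norm_le _ (by positivity)).2 fun t => ?_
        exact (A t).le_of_opNorm_le_of_le (A.norm_coe_le_norm t) (h.norm_coe_le_norm t))

@[simp]
theorem pointwiseApply_apply (A : C(K, E →L[ℝ] F)) (h : C(K, E)) (t : K) :
    pointwiseApply K E F A h t = A t (h t) := rfl

theorem ContDiff.pointwiseApply {V : Type*} [NormedAddCommGroup V] [NormedSpace ℝ V]
    {a : V → C(K, E →L[ℝ] F)} {h : V → C(K, E)} {n : WithTop ℕ∞} (ha : ContDiff ℝ n a)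
    (hh : ContDiff ℝ n h) : ContDiff ℝ n fun v => pointwiseApply K E F (a v) (h v) :=
  (ha.continuousLinearMap_comp (_root_.pointwiseApply K E F)).clm_apply hh

variable (K E) in
/-- The constant paths. -/
def constPath : E →L[ℝ] C(K, E) :=
  LinearMap.mkContinuous
    { toFun := fun e => ContinuousMap.const K e
      map_add' := fun _ _ => rfl
      map_smul' := fun _ _ => rfl } 1 (fun e => by
        rw [one_mul]
        exact (ContinuousMap.norm_le _ (by positivity)).2 fun t => le_rfl)

@[simp]
theorem constPath_apply (e : E) (t : K) : constPath K E e t = e := rfl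

/-- The mean value inequality on each segment from `γ t` to `γ' t` bounds the error by the
oscillation of the derivative there. This oscillation is small uniformly in `t`, because
postcomposition with the derivative is continuous in the sup norm. -/
theorem hasFDerivAt_comp_left {f : E → F} (hf : ContDiff ℝ 1 f) (γ : C(K, E)) :
    HasFDerivAt (fun γ : C(K, E) => (⟨f, hf.continuous⟩ : C(E, F)).comp γ)
      (pointwiseApply K E F ((⟨fderiv ℝ f, hf.continuous_fderiv (by simp)⟩ : C(E, _)).comp γ)) γ := by
  let f' : C(E, E →L[ℝ] F) := ⟨fderiv ℝ f, hf.continuous_fderiv (by simp)⟩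
  refine .of_isLittleO (Asymptotics.isLittleO_iff.2 fun c hc => ?_)
  have hcont : Continuous fun γ : C(K, E) => f'.comp γ := ContinuousMap.continuous_postcomp f'
  obtain ⟨δ, hδ, hball⟩ := (Metric.continuous_iff (f := fun γ : C(K, E) => f'.comp γ)).1 hcont γ c hc
  filter_upwards [Metric.ball_mem_nhds γ hδ] with γ' hγ'
  refine (ContinuousMap.norm_le _ (by positivity)).2 fun t => ?_
  have key : ‖f (γ' t) - f (γ t) - fderiv ℝ f (γ t) (γ' t - γ t)‖ ≤ c * ‖γ' t - γ t‖ := by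
    refine (convex_segment (γ t) (γ' t)).norm_image_sub_le_of_norm_fderiv_le'
      (fun x _ => hf.contDiffAt.differentiableAt (by simp)) ?_ (left_mem_segment ..)
      (right_mem_segment ..)
    intro x hx
    rw [segment_eq_image'] at hx
    obtain ⟨θ, hθ, rfl⟩ := hx
    have hmem : dist (γ + θ • (γ' - γ)) γ < δ := by
      rw [dist_eq_norm, add_sub_cancel_left, norm_smul, Real.norm_of_nonneg hθ.1]
      rw [Metric.mem_ball, dist_eq_norm] at hγ'
      exact (mul_le_of_le_one_left (norm_nonneg _) hθ.2).trans_lt hγ'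
    have h1 := ContinuousMap.dist_apply_le_dist (f := f'.comp (γ + θ • (γ' - γ)))
      (g := f'.comp γ) t
    rw [dist_eq_norm] at h1
    exact h1.trans (hball _ hmem).le
  refine key.trans ?_
  gcongr
  exact (γ' - γ).norm_coe_le_norm t

/-- Induction on the order of differentiability: the derivative of a composition operator is the
composition operator of `fderiv ℝ f`, followed by a bounded linear map. The codomain changes at each
step, so the induction generalizes it. -/
theorem contDiff_comp_left {f : E → F} (hf : ContDiff ℝ ∞ f) :
    ContDiff ℝ ∞ (fun γ : C(K, E) => (⟨f, hf.continuous⟩ : C(E, F)).comp γ) := by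
  rw [contDiff_infty]
  intro n
  induction n generalizing F with
  | zero => exact contDiff_zero.2 (ContinuousMap.continuous_postcomp _)
  | succ n ih =>
    push_cast
    rw [contDiff_succ_iff_hasFDerivAt]
    have hf' : ContDiff ℝ ∞ (fderiv ℝ f) := hf.fderiv_right (by simp)
    exact ⟨fun γ => pointwiseApply K E F ((⟨fderiv ℝ f, hf'.continuous⟩ : C(E, _)).comp γ),
      (ih hf').continuousLinearMap_comp (pointwiseApply K E F),
      fun γ => hasFDerivAt_comp_left (hf.of_le (by simp)) γ⟩

end CompositionOperator

/-! ### Completely integrable total differential equations -/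

section TotalDifferential

variable {E X : Type} [NormedAddCommGroup E] [NormedSpace ℝ E]
  [NormedAddCommGroup X] [NormedSpace ℝ X]

omit [NormedSpace ℝ E] in
theorem continuous_comp_projIcc (γ : C(unitInterval, E)) :
    Continuous fun s : ℝ => γ (Set.projIcc 0 1 zero_le_one s) :=
  γ.continuous.comp continuous_projIcc

variable (E) in
/-- The operator `γ ↦ ∫₀ᵗ γ` on continuous paths. -/
def pathPrimitive : C(unitInterval, E) →L[ℝ] C(unitInterval, E) :=
  LinearMap.mkContinuous
    { toFun := fun γ => ⟨fun t => ∫ s in (0 : ℝ)..t, γ (Set.projIcc 0 1 zero_le_one s),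
        (intervalIntegral.continuous_primitive
          (fun a b => (continuous_comp_projIcc γ).intervalIntegrable a b) 0).comp
          continuous_subtype_val⟩
      map_add' := fun γ γ' => by
        ext t
        exact intervalIntegral.integral_add ((continuous_comp_projIcc γ).intervalIntegrable _ _)
          ((continuous_comp_projIcc γ').intervalIntegrable _ _)
      map_smul' := fun c γ => by
        ext t
        exact intervalIntegral.integral_smul c _ } 1 (fun γ => by
      rw [one_mul]
      refine (ContinuousMap.norm_le _ (by positivity)).2 fun t => ?_
      have h := intervalIntegral.norm_integral_le_of_norm_le_const (a := (0 : ℝ)) (b := t)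
        (f := fun s => γ (Set.projIcc 0 1 zero_le_one s)) (C := ‖γ‖)
        fun s _ => γ.norm_coe_le_norm _
      refine h.trans (mul_le_of_le_one_right (norm_nonneg _) ?_)
      rw [sub_zero, abs_of_nonneg t.2.1]
      exact t.2.2)

theorem pathPrimitive_apply (γ : C(unitInterval, E)) (t : unitInterval) :
    pathPrimitive E γ t = ∫ s in (0 : ℝ)..t, γ (Set.projIcc 0 1 zero_le_one s) := rfl

/-- The integral equation `γ = c + ∫ A(γ) x` as the zero set of a map. -/
def integralDefect (A : C(E, X →L[ℝ] E)) (v : X × E × C(unitInterval, E)) : C(unitInterval, E) :=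
  v.2.2 - constPath unitInterval E v.2.1
    - pathPrimitive E (pointwiseApply unitInterval X E (A.comp v.2.2)
        (constPath unitInterval X v.1))

/-- The derivative of `integralDefect`. -/
def integralDefectDeriv (A : C(E, X →L[ℝ] E)) (A' : C(E, E →L[ℝ] X →L[ℝ] E))
    (v d : X × E × C(unitInterval, E)) : C(unitInterval, E) :=
  d.2.2 - constPath unitInterval E d.2.1
    - pathPrimitive E (pointwiseApply unitInterval X E (A.comp v.2.2)
          (constPath unitInterval X d.1)
        + pointwiseApply unitInterval X E
          (pointwiseApply unitInterval E (X →L[ℝ] E) (A'.comp v.2.2) d.2.2)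
          (constPath unitInterval X v.1))

variable {A : E → X →L[ℝ] E} (hA : ContDiff ℝ ∞ A)
include hA

theorem contDiff_integralDefect : ContDiff ℝ ∞ (integralDefect ⟨A, hA.continuous⟩) := by
  have h1 : ContDiff ℝ ∞ fun v : X × E × C(unitInterval, E) =>
      (⟨A, hA.continuous⟩ : C(E, X →L[ℝ] E)).comp v.2.2 :=
    (contDiff_comp_left hA).comp (contDiff_snd.comp contDiff_snd)
  have h3 : ContDiff ℝ ∞ fun v : X × E × C(unitInterval, E) => constPath unitInterval X v.1 :=
    contDiff_fst.continuousLinearMap_comp (constPath unitInterval X)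
  have h4 : ContDiff ℝ ∞ fun v : X × E × C(unitInterval, E) => constPath unitInterval E v.2.1 :=
    (contDiff_fst.comp contDiff_snd).continuousLinearMap_comp (constPath unitInterval E)
  exact ((contDiff_snd.comp contDiff_snd).sub h4).sub
    ((h1.pointwiseApply h3).continuousLinearMap_comp (pathPrimitive E))

theorem fderiv_integralDefect (v d : X × E × C(unitInterval, E)) :
    fderiv ℝ (integralDefect ⟨A, hA.continuous⟩) v d
      = integralDefectDeriv ⟨A, hA.continuous⟩ ⟨fderiv ℝ A, hA.continuous_fderiv (by simp)⟩ v d := by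
  have h0 : HasFDerivAt (fun v : X × E × C(unitInterval, E) => v.2.2)
      ((ContinuousLinearMap.snd ℝ E C(unitInterval, E)).comp
        (ContinuousLinearMap.snd ℝ X (E × C(unitInterval, E)))) v :=
    hasFDerivAt_snd.comp v hasFDerivAt_snd
  have h1 := (hasFDerivAt_comp_left (K := unitInterval) (hA.of_le (by simp)) v.2.2).comp v h0
  have h3 : HasFDerivAt (fun v : X × E × C(unitInterval, E) => constPath unitInterval X v.1)
      ((constPath unitInterval X).comp (ContinuousLinearMap.fst ℝ X _)) v :=
    (constPath unitInterval X).hasFDerivAt.comp v hasFDerivAt_fst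
  have h4 : HasFDerivAt (fun v : X × E × C(unitInterval, E) => constPath unitInterval E v.2.1)
      ((constPath unitInterval E).comp
        ((ContinuousLinearMap.fst ℝ E C(unitInterval, E)).comp (ContinuousLinearMap.snd ℝ X _))) v :=
    (constPath unitInterval E).hasFDerivAt.comp v (hasFDerivAt_fst.comp v hasFDerivAt_snd)
  have h5 := (pathPrimitive E).hasFDerivAt.comp v
    ((pointwiseApply unitInterval X E).hasFDerivAt_of_bilinear h1 h3)
  have h6 := (h0.sub h4).sub h5
  have h7 : HasFDerivAt (integralDefect ⟨A, hA.continuous⟩) _ v := h6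
  rw [h7.fderiv]
  rfl

/-- Along a solution of the integral equation, `τ ↦ τ A(γ(τ)) u` solves the linearized equation. -/
theorem linearized_solution {x u : X} {c : E} {γ : C(unitInterval, E)}
    [CompleteSpace E] (hγ : integralDefect ⟨A, hA.continuous⟩ (x, c, γ) = 0)
    (hsymm : ∀ t, fderiv ℝ A (γ t) (A (γ t) x) u = fderiv ℝ A (γ t) (A (γ t) u) x)
    {σ : C(unitInterval, E)} (hσ : ∀ t : unitInterval, σ t = (t : ℝ) • A (γ t) u) :
    integralDefectDeriv ⟨A, hA.continuous⟩ ⟨fderiv ℝ A, hA.continuous_fderiv (by simp)⟩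
      (x, c, γ) (u, 0, σ) = 0 := by
  have hp : Continuous fun s : ℝ => A (γ (Set.projIcc 0 1 zero_le_one s)) :=
    hA.continuous.comp (continuous_comp_projIcc γ)
  have hpx : Continuous fun s : ℝ => A (γ (Set.projIcc 0 1 zero_le_one s)) x :=
    hp.clm_apply continuous_const
  -- The path `γ` extended to a differentiable function on the whole line by the integral equation,
  -- so that the fundamental theorem of calculus can be applied without endpoints.
  let γ' : ℝ → E := fun s => c + ∫ r in (0 : ℝ)..s, A (γ (Set.projIcc 0 1 zero_le_one r)) x
  have hγ' : ∀ s, HasDerivAt γ' (A (γ (Set.projIcc 0 1 zero_le_one s)) x) s := fun s =>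
    (intervalIntegral.integral_hasDerivAt_right (hpx.intervalIntegrable _ _)
      (hpx.stronglyMeasurableAtFilter _ _) hpx.continuousAt).const_add c
  have hγt : ∀ t : unitInterval, γ t = γ' t := fun t => by
    have := DFunLike.congr_fun hγ t
    simp only [integralDefect, ContinuousMap.sub_apply, ContinuousMap.zero_apply, sub_sub, sub_eq_zero] at this
    exact this
  -- The product rule gives a term `A u` and a term in which the derivative of `A` is taken along `A
  -- x` and evaluated on `u`. The symmetry hypothesis exchanges `x` and `u` there, which turns it
  -- into the term of the linearized equation.
  have hg : ∀ s, HasDerivAt (fun s => s • A (γ' s) u)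
      (s • fderiv ℝ A (γ' s) (A (γ (Set.projIcc 0 1 zero_le_one s)) x) u
        + (1 : ℝ) • A (γ' s) u) s := fun s => by
    have h1 : HasDerivAt (fun s => A (γ' s))
        (fderiv ℝ A (γ' s) (A (γ (Set.projIcc 0 1 zero_le_one s)) x)) s :=
      ((hA.differentiable (by simp)).differentiableAt.hasFDerivAt).comp_hasDerivAt s (hγ' s)
    have h2 := h1.clm_apply (hasDerivAt_const s u)
    simp only [map_zero, add_zero] at h2
    exact (hasDerivAt_id s).smul h2
  have hγ'c : Continuous γ' := continuous_iff_continuousAt.2 fun s => (hγ' s).continuousAt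
  have hA' : Continuous (fderiv ℝ A) := hA.continuous_fderiv (by simp)
  ext t
  have hint := intervalIntegral.integral_eq_sub_of_hasDerivAt (a := 0) (b := (t : ℝ))
    (fun s _ => hg s) (by
      apply Continuous.intervalIntegrable
      exact (continuous_id.smul (((hA'.comp hγ'c).clm_apply hpx).clm_apply continuous_const)).add
        (((hA.continuous.comp hγ'c).clm_apply continuous_const).const_smul _))
  simp only [integralDefectDeriv, ContinuousMap.sub_apply, pathPrimitive_apply,
    ContinuousMap.zero_apply, map_zero, sub_zero, ContinuousMap.add_apply, pointwiseApply_apply]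
  rw [hσ t, hγt t, sub_eq_zero, ← sub_zero ((t : ℝ) • A (γ' t) u)]
  simp only [zero_smul] at hint
  rw [← hint]
  refine intervalIntegral.integral_congr fun s hs => ?_
  rw [Set.uIcc_of_le t.2.1] at hs
  have hs' : s ∈ Set.Icc (0 : ℝ) 1 := ⟨hs.1, hs.2.trans t.2.2⟩
  have e : γ' s = γ ⟨s, hs'⟩ := (hγt ⟨s, hs'⟩).symm
  simp only [Set.projIcc_of_mem zero_le_one hs', ContinuousMap.comp_apply, ContinuousMap.coe_mk,
    hσ, e, hsymm, map_smul, one_smul, smul_apply]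
  rw [add_comm]
  rfl

end TotalDifferential

/-! ### The total differential equation solved by the inverse function theorem in path space. -/

section Frobenius

variable {E X : Type} [NormedAddCommGroup E] [NormedSpace ℝ E] [CompleteSpace E]
  [NormedAddCommGroup X] [NormedSpace ℝ X] [CompleteSpace X]

/-- A total differential equation `D_x Z = A(Z)` satisfying the integrability condition has a
smooth general solution. -/
theorem exists_solution_total_differential {A : E → X →L[ℝ] E} (hA : ContDiff ℝ ∞ A) {z₀ : E}
    (hsymm : ∀ᶠ z in nhds z₀, ∀ u w, fderiv ℝ A z (A z u) w = fderiv ℝ A z (A z w) u) :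
    ∃ (D : Set (X × E)) (Z : X × E → E), IsOpen D ∧ (0, z₀) ∈ D ∧ ContDiffOn ℝ ∞ Z D ∧
      (∀ c, (0, c) ∈ D → Z (0, c) = c) ∧ ∀ q ∈ D, ∀ u, fderiv ℝ Z q (u, 0) = A (Z q) u := by
  let V := X × E × C(unitInterval, E)
  let Ac : C(E, X →L[ℝ] E) := ⟨A, hA.continuous⟩
  let f : V → V := fun v => (v.1, v.2.1, integralDefect Ac v)
  have hdef : ContDiff ℝ ∞ (integralDefect Ac) := contDiff_integralDefect hA
  have hf : ContDiff ℝ ∞ f := contDiff_fst.prodMk ((contDiff_fst.comp contDiff_snd).prodMk hdef)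
  have hfd : ∀ v d : V, fderiv ℝ f v d = (d.1, d.2.1, fderiv ℝ (integralDefect Ac) v d) := by
    intro v d
    have h1 : HasFDerivAt (fun v : V => v.1) (ContinuousLinearMap.fst ℝ X _) v := hasFDerivAt_fst
    have h2 : HasFDerivAt (fun v : V => v.2.1) ((ContinuousLinearMap.fst ℝ E _).comp
      (ContinuousLinearMap.snd ℝ X _)) v := hasFDerivAt_fst.comp v hasFDerivAt_snd
    have h3 : HasFDerivAt (integralDefect Ac) _ v :=
      (hdef.differentiable (by simp)).differentiableAt.hasFDerivAt
    have h4 : HasFDerivAt f _ v := h1.prodMk (h2.prodMk h3)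
    rw [h4.fderiv]
    rfl
  let a : V := (0, z₀, constPath unitInterval E z₀)
  -- At `a` the parameter `x` is zero, so the term with the derivative of `A` drops out. The
  -- derivative of `f` is then triangular, and `g` below is its explicit inverse.
  let Q : X →L[ℝ] C(unitInterval, E) := (pathPrimitive E).comp
    ((pointwiseApply unitInterval X E (Ac.comp (constPath unitInterval E z₀))).comp
      (constPath unitInterval X))
  have hfa : ∀ d : V, fderiv ℝ f a d
      = (d.1, d.2.1, d.2.2 - constPath unitInterval E d.2.1 - Q d.1) := by
    intro d
    rw [hfd, fderiv_integralDefect hA]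
    simp [integralDefectDeriv, a, Q, Ac]
  let g : V →L[ℝ] V := (ContinuousLinearMap.fst ℝ X _).prod
    (((ContinuousLinearMap.fst ℝ E _).comp (ContinuousLinearMap.snd ℝ X _)).prod
      ((ContinuousLinearMap.snd ℝ E _).comp (ContinuousLinearMap.snd ℝ X _)
        + ((constPath unitInterval E).comp
            ((ContinuousLinearMap.fst ℝ E _).comp (ContinuousLinearMap.snd ℝ X _))
          + Q.comp (ContinuousLinearMap.fst ℝ X _))))
  have hg : ∀ d : V, g d = (d.1, d.2.1, d.2.2 + (constPath unitInterval E d.2.1 + Q d.1)) :=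
    fun d => rfl
  let e : V ≃L[ℝ] V := ContinuousLinearEquiv.equivOfInverse (fderiv ℝ f a) g
    (fun d => by
      rw [hg, hfa]
      refine Prod.ext rfl (Prod.ext rfl ?_)
      dsimp only
      abel)
    (fun d => by
      rw [hg, hfa]
      refine Prod.ext rfl (Prod.ext rfl ?_)
      dsimp only
      abel)
  have he : HasFDerivAt f (e : V →L[ℝ] V) a :=
    ((hf.differentiable (by simp)).differentiableAt).hasFDerivAt
  obtain ⟨r, hr, hball⟩ := Metric.eventually_nhds_iff.1 hsymm
  -- Paths close to the constant path remain, at every time, in the ball where the integrability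
  -- condition is known.
  let Ω : Set V := {v | dist v.2.2 (constPath unitInterval E z₀) < r}
  have hΩ : IsOpen Ω := isOpen_lt (by fun_prop) continuous_const
  have haΩ : a ∈ Ω := by simpa [Ω, a] using hr
  obtain ⟨Φ, hΦ, haΦ, hΦΩ, hsm, hder⟩ :=
    hf.contDiffOn.exists_smooth_localInverse hΩ haΩ he
  let ι : X × E → V := fun q => (q.1, q.2, 0)
  have hι : ContDiff ℝ ∞ ι := contDiff_fst.prodMk (contDiff_snd.prodMk contDiff_const)
  let γ : X × E → C(unitInterval, E) := fun q => (Φ.symm (ι q)).2.2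
  let D : Set (X × E) := ι ⁻¹' Φ.target
  have hD : IsOpen D := Φ.open_target.preimage hι.continuous
  have hγs : ContDiffOn ℝ ∞ γ D :=
    (contDiff_snd.comp contDiff_snd).comp_contDiffOn
      (hsm.comp hι.contDiffOn (Set.mapsTo_preimage _ _))
  have hΦγ : ∀ q ∈ D, Φ.symm (ι q) = (q.1, q.2, γ q) ∧ integralDefect Ac (q.1, q.2, γ q) = 0 := by
    intro q hq
    have h1 : f (Φ.symm (ι q)) = ι q := by rw [← hΦ]; exact Φ.right_inv hq
    have h2 : Φ.symm (ι q) = (q.1, q.2, γ q) :=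
      Prod.ext (congrArg (fun v : V => v.1) h1 :)
        (Prod.ext (congrArg (fun v : V => v.2.1) h1 :) rfl)
    refine ⟨h2, ?_⟩
    rw [h2] at h1
    exact congrArg (fun v => v.2.2) h1
  let ev : C(unitInterval, E) →L[ℝ] E := ContinuousMap.evalCLM ℝ (1 : unitInterval)
  have hev : ∀ δ, ev δ = δ 1 := fun δ => rfl
  refine ⟨D, fun q => γ q 1, hD, ?_, ?_, ?_, ?_⟩
  · have h1 := Φ.map_source haΦ
    have h2 : Φ a = ι (0, z₀) := by
      rw [hΦ]
      simp [f, a, ι, integralDefect]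
    rwa [h2] at h1
  · exact hγs.continuousLinearMap_comp ev
  · intro c hc
    have h1 := (hΦγ _ hc).2
    simp only [integralDefect, map_zero, sub_zero, sub_eq_zero] at h1
    simp [h1]
  · intro q hq u
    have hq' := hD.mem_nhds hq
    have hγd : HasFDerivAt γ (fderiv ℝ γ q) q :=
      ((hγs.contDiffAt hq').differentiableAt (by simp)).hasFDerivAt
    let δ := fderiv ℝ γ q (u, 0)
    have hZ : fderiv ℝ (fun q => γ q 1) q (u, 0) = δ 1 := by
      have h1 : HasFDerivAt (fun q => γ q 1) (ev.comp (fderiv ℝ γ q)) q :=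
        ev.hasFDerivAt.comp q hγd
      rw [h1.fderiv]
      rfl
    obtain ⟨hsrc, hzero⟩ := hΦγ q hq
    have hmem : (q.1, q.2, γ q) ∈ Φ.source := hsrc ▸ Φ.map_target hq
    let v : V := (q.1, q.2, γ q)
    have hδ : fderiv ℝ (integralDefect Ac) v (u, 0, δ) = 0 := by
      have h1 : HasFDerivAt (fun q : X × E => ((q.1, q.2, γ q) : V))
          ((ContinuousLinearMap.fst ℝ X E).prod
            ((ContinuousLinearMap.snd ℝ X E).prod (fderiv ℝ γ q))) q :=
        hasFDerivAt_fst.prodMk (hasFDerivAt_snd.prodMk hγd)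
      have h2 : HasFDerivAt (integralDefect Ac) (fderiv ℝ (integralDefect Ac) v) v :=
        (hdef.differentiable (by simp)).differentiableAt.hasFDerivAt
      have h3 := h2.comp q h1
      have h4 : (integralDefect Ac ∘ fun q : X × E => ((q.1, q.2, γ q) : V)) =ᶠ[nhds q]
          fun _ => 0 := Filter.eventuallyEq_of_mem hq' fun q hq => (hΦγ q hq).2
      have h5 := (h3.congr_of_eventuallyEq h4.symm).unique (hasFDerivAt_const _ _)
      exact DFunLike.congr_fun h5 (u, 0)
    let σ : C(unitInterval, E) := ⟨fun t => (t : ℝ) • A (γ q t) u, by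
      have := hA.continuous
      fun_prop⟩
    have hσ : fderiv ℝ (integralDefect Ac) v (u, 0, σ) = 0 := by
      rw [fderiv_integralDefect hA]
      refine linearized_solution hA hzero (fun t => ?_) fun t => rfl
      refine hball ?_ _ _
      exact (ContinuousMap.dist_apply_le_dist (f := γ q) (g := constPath unitInterval E z₀) t).trans_lt
        (hΦΩ (Φ.map_target hq))
    obtain ⟨e', he'⟩ := hder _ hmem
    -- Both the true derivative `δ` of the solution path and the candidate `σ` solve the linearized
    -- equation with the same data, and the derivative of `f` is injective there. Evaluating at time
    -- 1 gives the differential equation.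
    have hinj : ((u, 0, δ) : V) = (u, 0, σ) := by
      apply e'.injective
      have : ∀ d, e' d = fderiv ℝ f v d := fun d => by rw [he'.fderiv]; rfl
      rw [this, this, hfd, hfd, hδ, hσ]
    have hδσ : δ = σ := congrArg (fun v : V => v.2.2) hinj
    rw [hZ, hδσ]
    simp [σ]

end Frobenius

/-! ### From commuting vector fields to first integrals. -/

section FirstIntegrals

variable {E : Type} [NormedAddCommGroup E] [NormedSpace ℝ E] [FiniteDimensional ℝ E]

/-- Multiplication by a bump function. The composition operator on path space is smooth only for
maps defined and smooth on all of `E`, so the local frame has to be extended. -/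
theorem ContDiffOn.exists_contDiff_eq_near {F : Type*} [NormedAddCommGroup F] [NormedSpace ℝ F]
    {Ω : Set E} (hΩ : IsOpen Ω) {f : E → F} (hf : ContDiffOn ℝ ∞ f Ω) {z₀ : E} (hz₀ : z₀ ∈ Ω) :
    ∃ (f' : E → F) (N : Set E), ContDiff ℝ ∞ f' ∧ IsOpen N ∧ z₀ ∈ N ∧ N ⊆ Ω ∧
      ∀ z ∈ N, f' z = f z := by
  obtain ⟨r, hr, hball⟩ := Metric.isOpen_iff.1 hΩ z₀ hz₀
  let χ : ContDiffBump z₀ := ⟨r / 3, r / 2, by positivity, by linarith⟩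
  refine ⟨fun z => χ z • f z, Metric.ball z₀ (r / 3), ?_, Metric.isOpen_ball,
    Metric.mem_ball_self (by positivity), ?_, ?_⟩
  · refine contDiff_iff_contDiffAt.2 fun z => ?_
    by_cases hz : z ∈ Metric.ball z₀ r
    · exact χ.contDiffAt.smul (hf.contDiffAt (hΩ.mem_nhds (hball hz)))
    · have h1 : (fun z => χ z • f z) =ᶠ[nhds z] fun _ => 0 := by
        have : (Metric.closedBall z₀ (r / 2))ᶜ ∈ nhds z :=
          Metric.isClosed_closedBall.isOpen_compl.mem_nhds fun h =>
            hz (Metric.closedBall_subset_ball (by linarith) h)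
        filter_upwards [this] with z' hz'
        rw [χ.zero_of_le_dist, zero_smul]
        rw [Set.mem_compl_iff, Metric.mem_closedBall, not_le] at hz'
        exact hz'.le
      exact contDiffAt_const.congr_of_eventuallyEq h1
  · exact (Metric.ball_subset_ball (by linarith)).trans hball
  · intro z hz
    simp only
    rw [χ.one_of_mem_closedBall (Metric.ball_subset_closedBall hz), one_smul]

/-- **Frobenius' theorem**: an integrable field of projectors `p` has a complete set of first
integrals near every point. -/
theorem exists_first_integrals {Ω : Set E} (hΩ : IsOpen Ω) {p : E → E →L[ℝ] E}
    (hp : ContDiffOn ℝ ∞ p Ω) (hpp : ∀ z ∈ Ω, ∀ x, p z (p z x) = p z x)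
    (hint : ∀ z ∈ Ω, ∀ x y, fderiv ℝ p z (p z x) y - p z (fderiv ℝ p z (p z x) y)
      = fderiv ℝ p z (p z y) x - p z (fderiv ℝ p z (p z y) x)) {z₀ : E} (hz₀ : z₀ ∈ Ω) :
    ∃ (O : Set E) (w : E → E), IsOpen O ∧ z₀ ∈ O ∧ O ⊆ Ω ∧ ContDiffOn ℝ ∞ w O ∧
      (∀ u, fderiv ℝ w z₀ u = u - p z₀ u) ∧ (∀ z ∈ O, ∀ u, fderiv ℝ w z (p z u) = 0) ∧
      ∀ z, p z₀ (w z) = 0 := by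
  have : CompleteSpace E := FiniteDimensional.complete ℝ E
  let p₀ := p z₀
  have hp₀ : ∀ x, p₀ (p₀ x) = p₀ x := hpp z₀ hz₀
  let q₀ : E →L[ℝ] E := ContinuousLinearMap.id ℝ E - p₀
  have hq₀ : ∀ x, q₀ x = x - p₀ x := fun x => rfl
  -- `T z` is the identity at `z₀` and intertwines `p z` with `p₀`, hence near `z₀` it is an
  -- isomorphism that carries the plane at `z` onto the plane at `z₀`.
  let T : E → E →L[ℝ] E := fun z => p₀.comp (p z) + q₀.comp (ContinuousLinearMap.id ℝ E - p z)
  have hT : ∀ z x, T z x = p₀ (p z x) + ((x - p z x) - p₀ (x - p z x)) := fun z x => rfl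
  have hTs : ContDiffOn ℝ ∞ T Ω :=
    (contDiffOn_const.clm_comp hp).add (contDiffOn_const.clm_comp (contDiffOn_const.sub hp))
  let Ω₁ : Set E := Ω ∩ T ⁻¹' Set.range ((↑) : (E ≃L[ℝ] E) → E →L[ℝ] E)
  have hΩ₁ : IsOpen Ω₁ :=
    hTs.continuousOn.isOpen_inter_preimage hΩ ContinuousLinearEquiv.isOpen
  have hT₀ : T z₀ = ContinuousLinearMap.id ℝ E := by
    ext x
    rw [hT]
    simp only [ContinuousLinearMap.id_apply, map_sub]
    change p₀ (p₀ x) + (x - p₀ x - (p₀ x - p₀ (p₀ x))) = x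
    rw [hp₀]
    abel
  have hz₁ : z₀ ∈ Ω₁ := ⟨hz₀, ContinuousLinearEquiv.refl ℝ E, hT₀.symm⟩
  -- Lift of the plane at `z₀` into the plane at `z` with unchanged `p₀`-component. The constancy of
  -- that component is what makes the lifted vector fields commute.
  let A₀ : E → E →L[ℝ] E := fun z => (T z).inverse.comp p₀
  have hA₀ : ContDiffOn ℝ ∞ A₀ Ω₁ := by
    rintro z ⟨hz, e, he⟩
    have h1 : ContDiffAt ℝ ∞ (fun z => (T z).inverse) z := by
      have h2 : ContDiffAt ℝ ∞ ContinuousLinearMap.inverse (T z) := he ▸ contDiffAt_map_inverse e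
      exact h2.comp z (hTs.contDiffAt (hΩ.mem_nhds hz))
    exact (h1.clm_comp contDiffAt_const).contDiffWithinAt
  obtain ⟨A, N, hA, hN, hzN, hNΩ, hAN⟩ := hA₀.exists_contDiff_eq_near hΩ₁ hz₁
  -- algebraic properties of the parallel frame `A`
  have hTA : ∀ z ∈ N, ∀ u, T z (A z u) = p₀ u := by
    intro z hz u
    obtain ⟨e, he⟩ := (hNΩ hz).2
    rw [hAN z hz]
    simp only [A₀, ← he, ContinuousLinearMap.inverse_equiv]
    exact e.apply_symm_apply _
  have hTinj : ∀ z ∈ N, ∀ u w, T z u = T z w → u = w := by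
    intro z hz u w h
    obtain ⟨e, he⟩ := (hNΩ hz).2
    rw [← he] at h
    exact e.injective h
  have hTp : ∀ z ∈ N, ∀ u, T z (p z u) = p₀ (T z u) := by
    intro z hz u
    rw [hT, hT, hpp z (hNΩ hz).1]
    simp only [map_add, map_sub, hp₀, sub_self, map_zero, add_zero]
  have hpA : ∀ z ∈ N, ∀ u, p z (A z u) = A z u := fun z hz u =>
    hTinj z hz _ _ (by rw [hTp z hz, hTA z hz, hp₀])
  have hp₀A : ∀ z ∈ N, ∀ u, p₀ (A z u) = p₀ u := by
    intro z hz u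
    have h := hTA z hz u
    rw [hT, hpA z hz, sub_self, map_zero, sub_zero, add_zero] at h
    exact h
  have hAp : ∀ z ∈ N, ∀ u, A z (p z u) = p z u := fun z hz u =>
    hTinj z hz _ _ (by
      rw [hTA z hz, hT, hpp z (hNΩ hz).1, sub_self, map_zero, sub_zero, add_zero])
  have hAp₀ : ∀ z ∈ N, ∀ u, A z (p₀ u) = A z u := fun z hz u =>
    hTinj z hz _ _ (by rw [hTA z hz, hTA z hz, hp₀])
  have hA₀' : ∀ u, A z₀ u = p₀ u := fun u => by
    have := hTA z₀ hzN u
    rwa [hT₀] at this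
  -- The bracket of two lifted fields lies in the plane by involutivity and has zero `p₀`-component,
  -- since each field has a constant one. As `p₀` is injective on nearby planes, the bracket
  -- vanishes; in the proof this is read off through the injectivity of `T z`.
  have hsymm : ∀ᶠ z in nhds z₀, ∀ u w, fderiv ℝ A z (A z u) w = fderiv ℝ A z (A z w) u := by
    filter_upwards [hN.mem_nhds hzN] with z hz u w
    have hAd : HasFDerivAt A (fderiv ℝ A z) z :=
      ((hA.differentiable (by simp)).differentiableAt).hasFDerivAt
    have hpd : HasFDerivAt p (fderiv ℝ p z) z :=
      ((hp.contDiffAt (hΩ.mem_nhds (hNΩ hz).1)).differentiableAt (by simp)).hasFDerivAt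
    have hN' := hN.mem_nhds hz
    have hAu : ∀ u, HasFDerivAt (fun z => A z u) ((fderiv ℝ A z).flip u) z := fun u => by
      simpa using hAd.clm_apply (hasFDerivAt_const u z)
    have h1 : ∀ u d, fderiv ℝ p z d (A z u) + p z (fderiv ℝ A z d u) = fderiv ℝ A z d u := by
      intro u d
      have h2 := hpd.clm_apply (hAu u)
      have h3 := h2.unique ((hAu u).congr_of_eventuallyEq
        (Filter.eventuallyEq_of_mem hN' fun z hz => hpA z hz u))
      have h4 := DFunLike.congr_fun h3 d
      simp only [add_apply, ContinuousLinearMap.comp_apply, ContinuousLinearMap.flip_apply] at h4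
      rw [add_comm] at h4
      exact h4
    have h2 : ∀ u d, p₀ (fderiv ℝ A z d u) = 0 := by
      intro u d
      have h3 := (p₀.hasFDerivAt.comp z (hAu u)).unique
        ((hasFDerivAt_const (p₀ u) z).congr_of_eventuallyEq
          (Filter.eventuallyEq_of_mem hN' fun z hz => hp₀A z hz u))
      exact DFunLike.congr_fun h3 d
    have h3 := hint z (hNΩ hz).1 (A z u) (A z w)
    rw [hpA z hz, hpA z hz] at h3
    have h4 : fderiv ℝ p z (A z u) (A z w)
        = fderiv ℝ A z (A z u) w - p z (fderiv ℝ A z (A z u) w) := by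
      rw [eq_sub_iff_add_eq]; exact h1 w _
    have h5 : fderiv ℝ p z (A z w) (A z u)
        = fderiv ℝ A z (A z w) u - p z (fderiv ℝ A z (A z w) u) := by
      rw [eq_sub_iff_add_eq]; exact h1 u _
    rw [h4, h5] at h3
    simp only [map_sub, hpp z (hNΩ hz).1, sub_self, sub_zero] at h3
    refine hTinj z hz _ _ ?_
    rw [hT, hT, h3]
    have h6 : ∀ u d, p₀ (p z (fderiv ℝ A z d u))
        = - p₀ (fderiv ℝ A z d u - p z (fderiv ℝ A z d u)) := fun u d => by
      rw [map_sub, h2, zero_sub, neg_neg]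
    rw [h6, h6 u, h3]
  obtain ⟨D, Z, hD, hD₀, hZ, hZ₀, hZA⟩ := exists_solution_total_differential hA hsymm
  -- The component of `ξ` along the plane is the parameter of the joint flow, and the transverse
  -- component moves the initial value. In the resulting coordinates the leaves are the sets of
  -- constant `q₀ ξ`, so `q₀` of the inverse map gives the first integrals.
  let ι : E → E × E := fun ξ => (p₀ ξ, z₀ + q₀ ξ)
  have hι : ContDiff ℝ ∞ ι := p₀.contDiff.prodMk (contDiff_const.add q₀.contDiff)
  have hι₀ : ι 0 = (0, z₀) := by simp [ι]
  have hιd : ∀ ξ, HasFDerivAt ι (p₀.prod q₀) ξ := fun ξ =>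
    p₀.hasFDerivAt.prodMk (q₀.hasFDerivAt.const_add z₀)
  let Θ : E → E := fun ξ => Z (ι ξ)
  have hΘ₀ : Θ 0 = z₀ := by simp only [Θ, hι₀]; exact hZ₀ _ hD₀
  have hΩ₂ : IsOpen (ι ⁻¹' D) := hD.preimage hι.continuous
  have hΘs : ContDiffOn ℝ ∞ Θ (ι ⁻¹' D) :=
    hZ.comp hι.contDiffOn (Set.mapsTo_preimage _ _)
  let Ω₃ : Set E := ι ⁻¹' D ∩ Θ ⁻¹' N
  have hΩ₃ : IsOpen Ω₃ := hΘs.continuousOn.isOpen_inter_preimage hΩ₂ hN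
  have h0Ω₃ : (0 : E) ∈ Ω₃ := ⟨by simpa [hι₀] using hD₀, by simpa [hΘ₀] using hzN⟩
  have hΘd : ∀ ξ, ι ξ ∈ D → HasFDerivAt Θ ((fderiv ℝ Z (ι ξ)).comp (p₀.prod q₀)) ξ := by
    intro ξ hξ
    exact (((hZ.contDiffAt (hD.mem_nhds hξ)).differentiableAt (by simp)).hasFDerivAt).comp ξ
      (hιd ξ)
  have hΘd₀ : HasFDerivAt Θ ((ContinuousLinearEquiv.refl ℝ E : E ≃L[ℝ] E) : E →L[ℝ] E) 0 := by
    have h1 := hΘd 0 (by rw [hι₀]; exact hD₀)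
    rw [hι₀] at h1
    convert h1 using 1
    ext ξ
    have h2 : fderiv ℝ Z (0, z₀) (0, q₀ ξ) = q₀ ξ := by
      have h3 := ((hZ.contDiffAt (hD.mem_nhds hD₀)).differentiableAt (by simp)).hasFDerivAt
      have h4 := h3.comp z₀ ((hasFDerivAt_const (0 : E) z₀).prodMk (hasFDerivAt_id z₀))
      have h5 : Set.preimage (fun c : E => ((0 : E), c)) D ∈ nhds z₀ :=
        (hD.preimage (by fun_prop)).mem_nhds hD₀
      have h6 := h4.unique ((hasFDerivAt_id z₀).congr_of_eventuallyEq
        (Filter.eventuallyEq_of_mem h5 fun c hc => hZ₀ c hc))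
      exact DFunLike.congr_fun h6 (q₀ ξ)
    have h3 : fderiv ℝ Z (0, z₀) (p₀ ξ, 0) = p₀ ξ := by
      rw [hZA _ hD₀, hZ₀ _ hD₀, hA₀', hp₀]
    have h4 : (p₀ ξ, q₀ ξ) = (p₀ ξ, (0 : E)) + (0, q₀ ξ) := by simp
    change ξ = fderiv ℝ Z (0, z₀) (p₀ ξ, q₀ ξ)
    rw [h4, map_add, h2, h3, hq₀]
    abel
  obtain ⟨Φ, hΦ, h0Φ, hΦΩ, hsm, hder⟩ :=
    (hΘs.mono Set.inter_subset_left).exists_smooth_localInverse hΩ₃ h0Ω₃ hΘd₀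
  have hz₀t : z₀ ∈ Φ.target := by
    have := Φ.map_source h0Φ
    rwa [hΦ, hΘ₀] at this
  have hsymm₀ : Φ.symm z₀ = 0 := by
    have := Φ.left_inv h0Φ
    rwa [hΦ, hΘ₀] at this
  have hright : ∀ z ∈ Φ.target, Θ (Φ.symm z) = z := fun z hz => by
    have := Φ.right_inv hz
    rwa [hΦ] at this
  have htN : Φ.target ⊆ N := fun z hz => by
    have := (hΦΩ (Φ.map_target hz)).2
    rwa [Set.mem_preimage, hright z hz] at this
  have hwd : ∀ z ∈ Φ.target, ∀ e : E ≃L[ℝ] E, HasFDerivAt Θ (e : E →L[ℝ] E) (Φ.symm z) →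
      ∀ u, fderiv ℝ (fun z => q₀ (Φ.symm z)) z u = q₀ (e.symm u) := by
    intro z hz e he u
    have h1 : HasFDerivAt Φ.symm (e.symm : E →L[ℝ] E) z :=
      Φ.hasFDerivAt_symm hz (by rw [hΦ]; exact he)
    have h2 := q₀.hasFDerivAt.comp z h1
    have h3 : HasFDerivAt (fun z => q₀ (Φ.symm z)) (q₀.comp (e.symm : E →L[ℝ] E)) z := h2
    rw [h3.fderiv]
    rfl
  refine ⟨Φ.target, fun z => q₀ (Φ.symm z), Φ.open_target, hz₀t,
    fun z hz => (hNΩ (htN hz)).1, q₀.contDiff.comp_contDiffOn hsm, ?_, ?_, ?_⟩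
  · intro u
    rw [hwd z₀ hz₀t (ContinuousLinearEquiv.refl ℝ E) (by rw [hsymm₀]; exact hΘd₀)]
    rfl
  · intro z hz u
    obtain ⟨e, he⟩ := hder _ (Φ.map_target hz)
    rw [hwd z hz e he]
    have h1 := he.unique (hΘd _ (hΦΩ (Φ.map_target hz)).1)
    -- The flow carries a direction `p₀ x` to its lift `A (p₀ x)`, and the lift of a vector already
    -- in the plane is that vector. So a tangent vector of the plane comes from the `p₀`-direction,
    -- which `q₀` kills.
    have h2 : e (p₀ (p z u)) = p z u := by
      have h3 := DFunLike.congr_fun h1 (p₀ (p z u))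
      change e (p₀ (p z u)) = fderiv ℝ Z (ι (Φ.symm z)) (p₀ (p₀ (p z u)), q₀ (p₀ (p z u))) at h3
      rw [hq₀, hp₀, sub_self, hZA _ (hΦΩ (Φ.map_target hz)).1] at h3
      change e (p₀ (p z u)) = A (Θ (Φ.symm z)) (p₀ (p z u)) at h3
      rw [h3, hright z hz, hAp₀ z (htN hz), hAp z (htN hz)]
    rw [← h2, e.symm_apply_apply, hq₀, hp₀, sub_self]
  · intro z
    change p₀ (q₀ _) = 0
    rw [hq₀, map_sub, hp₀, sub_self]

end FirstIntegrals

/-! ### Umbilical and integrable structures in a chart -/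

/-- The mean curvature vector of the plane field with projector `p`. -/
def meanVec (G p : E4 → Matrix (Fin 4) (Fin 4) ℝ) (m : Fin 4) (y : E4) : ℝ :=
  (1 / 2) * ∑ r, ∑ s, (G y)⁻¹ r s * symSecondForm G p m r s y

/-- The mean curvature 1-form of the plane field with projector `p`. -/
def meanForm (G p : E4 → Matrix (Fin 4) (Fin 4) ℝ) (a : Fin 4) (y : E4) : ℝ :=
  ∑ m, G y a m * meanVec G p m y

theorem secondForm_eq (G p : E4 → Matrix (Fin 4) (Fin 4) ℝ) (a b c : Fin 4) (y : E4) :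
    secondForm G p a b c y
      = ∑ k, p y k b * ((1 - p y) * (pdm k p y + conn G k y * p y)) a c := by
  simp only [secondForm]
  rw [Finset.sum_comm]
  refine Finset.sum_congr rfl fun k _ => ?_
  rw [Matrix.mul_apply, Finset.mul_sum]
  refine Finset.sum_congr rfl fun m _ => ?_
  rw [Matrix.add_apply, Matrix.mul_apply]
  simp only [pdm_apply, conn, Matrix.of_apply]
  ring

theorem secondForm_of_umbilical {G p : E4 → Matrix (Fin 4) (Fin 4) ℝ} {y : E4}
    (hA : ∀ a b c, antisymSecondForm G p a b c y = 0)
    (hS : ∀ a b c, tracelessSecondForm G p a b c y = 0) (a b c : Fin 4) :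
    secondForm G p a b c y = (G y * p y) b c * meanVec G p a y := by
  have h1 := hA a b c
  have h2 := hS a b c
  simp only [tracelessSecondForm] at h2
  have h3 : secondForm G p a b c y = symSecondForm G p a b c y + antisymSecondForm G p a b c y := by
    simp only [symSecondForm, antisymSecondForm]
    ring
  rw [h3, h1, meanVec]
  linarith

theorem secondForm_lower {G p : E4 → Matrix (Fin 4) (Fin 4) ℝ} {y : E4}
    (hA : ∀ a b c, antisymSecondForm G p a b c y = 0)
    (hS : ∀ a b c, tracelessSecondForm G p a b c y = 0) (a b c : Fin 4) :
    ∑ k, p y k b * (G y * ((1 - p y) * (pdm k p y + conn G k y * p y))) a c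
      = (G y * p y) b c * meanForm G p a y := by
  have h : ∀ m, ∑ k, p y k b * ((1 - p y) * (pdm k p y + conn G k y * p y)) m c
      = (G y * p y) b c * meanVec G p m y := fun m => by
    rw [← secondForm_of_umbilical hA hS, secondForm_eq]
  calc _ = ∑ m, G y a m * ∑ k, p y k b * ((1 - p y) * (pdm k p y + conn G k y * p y)) m c := by
        simp only [Matrix.mul_apply (M := G y) (N := (1 - p y) * _), Finset.mul_sum]
        rw [Finset.sum_comm]
        exact Finset.sum_congr rfl fun m _ => Finset.sum_congr rfl fun k _ => by ring
    _ = _ := by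
        simp only [h, meanForm, Finset.mul_sum]
        exact Finset.sum_congr rfl fun m _ => by ring

/-- Two complementary orthogonal plane fields, `p` and `1 - p`. -/
structure IsSplitting (Ω : Set E4) (G p : E4 → Matrix (Fin 4) (Fin 4) ℝ) : Prop
    extends IsMetricOn Ω G where
  smooth_proj : SmoothMat Ω p
  idem : ∀ z ∈ Ω, p z * p z = p z
  self_adjoint : ∀ z ∈ Ω, (G z * p z).transpose = G z * p z

/-- A splitting with both plane fields umbilical and integrable. -/
structure IsUmbilicalSplitting (Ω : Set E4) (G p : E4 → Matrix (Fin 4) (Fin 4) ℝ) : Prop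
    extends IsSplitting Ω G p where
  antisymm : ∀ z ∈ Ω, ∀ a b c, antisymSecondForm G p a b c z = 0
  antisymm' : ∀ z ∈ Ω, ∀ a b c, antisymSecondForm G (fun z => 1 - p z) a b c z = 0
  traceless : ∀ z ∈ Ω, ∀ a b c, tracelessSecondForm G p a b c z = 0
  traceless' : ∀ z ∈ Ω, ∀ a b c, tracelessSecondForm G (fun z => 1 - p z) a b c z = 0

namespace IsSplitting

variable {Ω : Set E4} {G p : E4 → Matrix (Fin 4) (Fin 4) ℝ} (h : IsSplitting Ω G p) {y : E4}
include h

theorem smooth_secondForm (a b c : Fin 4) : ContDiffOn ℝ ∞ (secondForm G p a b c) Ω := by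
  have h1 : SmoothMat Ω (fun z => 1 - p z) := (smoothMat_const 1).sub h.smooth_proj
  refine ContDiffOn.sum fun m _ => ContDiffOn.sum fun k _ => ?_
  exact ((h1 a m).mul (h.smooth_proj k b)).mul ((contDiffOn_pd h.isOpen (h.smooth_proj m c) k).add
    (ContDiffOn.sum fun n _ => (h.toIsMetricOn.smooth_christoffel m k n).mul (h.smooth_proj n c)))

theorem smooth_meanForm (a : Fin 4) : ContDiffOn ℝ ∞ (meanForm G p a) Ω := by
  have h1 : ∀ a b c, ContDiffOn ℝ ∞ (symSecondForm G p a b c) Ω := fun a b c =>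
    contDiffOn_const.mul ((h.smooth_secondForm a b c).add (h.smooth_secondForm a c b))
  exact ContDiffOn.sum fun m _ => (h.smooth a m).mul (contDiffOn_const.mul
    (ContDiffOn.sum fun r _ => ContDiffOn.sum fun s _ =>
      (h.toIsMetricOn.smooth_inv r s).mul (h1 m r s)))

theorem compl : IsSplitting Ω G (fun z => 1 - p z) where
  toIsMetricOn := h.toIsMetricOn
  smooth_proj := (smoothMat_const 1).sub h.smooth_proj
  idem z hz := by
    have := h.idem z hz
    simp only [mul_sub, sub_mul, one_mul, mul_one, this]
    abel
  self_adjoint z hz := by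
    rw [mul_sub, mul_one, Matrix.transpose_sub, h.self_adjoint z hz, h.symm z hz]

/-- Differentiating p² = p. It says that the covariant derivative of a projector exchanges the two
planes, so its diagonal blocks vanish. -/
theorem covdEnd_proj (hy : y ∈ Ω) (k : Fin 4) :
    covdEnd G p k y * p y + p y * covdEnd G p k y = covdEnd G p k y := by
  rw [← h.toIsMetricOn.covdEnd_mul h.smooth_proj h.smooth_proj hy k, covdEnd, covdEnd,
    pdm_congr h.isOpen h.idem hy, h.idem y hy]

omit h in
theorem covd_transpose {T : E4 → Matrix (Fin 4) (Fin 4) ℝ} (k : Fin 4) :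
    (covd G T k y).transpose = covd G (fun z => (T z).transpose) k y := by
  simp only [covd, Matrix.transpose_sub, Matrix.transpose_mul, Matrix.transpose_transpose,
    pdm_transpose]
  abel

theorem covd_proj_symm (hy : y ∈ Ω) (k : Fin 4) :
    (covd G (fun z => G z * p z) k y).transpose = covd G (fun z => G z * p z) k y := by
  rw [covd_transpose, covd, covd, pdm_congr h.isOpen h.self_adjoint hy, h.self_adjoint y hy]

/-- `v ξ = 0`: the mean curvature vector is normal to the plane field. -/
theorem meanForm_mul_proj (hy : y ∈ Ω) (b : Fin 4) : ∑ a, meanForm G p a y * p y a b = 0 := by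
  have h1 : ∀ b r s, ∑ a, p y b a * secondForm G p a r s y = 0 := fun b r s => by
    simp only [secondForm_eq, Finset.mul_sum]
    rw [Finset.sum_comm]
    refine Finset.sum_eq_zero fun k _ => ?_
    have h2 : p y * ((1 - p y) * (pdm k p y + conn G k y * p y)) = 0 := by
      rw [← mul_assoc, mul_sub, mul_one, h.idem y hy, sub_self, zero_mul]
    have h3 := congrFun (congrFun h2 b) s
    rw [Matrix.mul_apply, Matrix.zero_apply] at h3
    simp only [mul_left_comm (p y b _), ← Finset.mul_sum, h3, mul_zero]
  have h2 : ∀ b r s, ∑ a, p y b a * symSecondForm G p a r s y = 0 := fun b r s => by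
    simp only [symSecondForm, mul_left_comm (p y b _), ← Finset.mul_sum, mul_add,
      Finset.sum_add_distrib, h1, add_zero, mul_zero]
  have h3 : ∀ m, ∑ a, G y a m * p y a b = ∑ n, G y b n * p y n m := fun m => by
    have h4 := congrFun (congrFun (h.self_adjoint y hy) b) m
    rw [Matrix.transpose_apply, Matrix.mul_apply, Matrix.mul_apply] at h4
    rw [← h4]
    exact Finset.sum_congr rfl fun a _ => by rw [h.toIsMetricOn.apply_symm hy a m]
  have h5 : ∀ n, ∑ m, p y n m * meanVec G p m y = 0 := fun n => by
    calc _ = (1 / 2) * ∑ r, ∑ s, (G y)⁻¹ r s * ∑ m, p y n m * symSecondForm G p m r s y := by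
          simp only [meanVec, Finset.mul_sum]
          rw [Finset.sum_comm]
          refine Finset.sum_congr rfl fun r _ => ?_
          rw [Finset.sum_comm]
          exact Finset.sum_congr rfl fun s _ => Finset.sum_congr rfl fun m _ => by ring
      _ = 0 := by simp only [h2, mul_zero, Finset.sum_const_zero]
  calc ∑ a, meanForm G p a y * p y a b = ∑ m, (∑ a, G y a m * p y a b) * meanVec G p m y := by
        simp only [meanForm, Finset.sum_mul]
        rw [Finset.sum_comm]
        exact Finset.sum_congr rfl fun m _ => Finset.sum_congr rfl fun a _ => by ring
    _ = ∑ n, G y b n * ∑ m, p y n m * meanVec G p m y := by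
        simp only [h3, Finset.sum_mul, Finset.mul_sum]
        rw [Finset.sum_comm]
        exact Finset.sum_congr rfl fun n _ => Finset.sum_congr rfl fun m _ => by ring
    _ = 0 := by simp only [h5, mul_zero, Finset.sum_const_zero]

end IsSplitting

/-- The derivative of a self-adjoint projector is off-diagonal and symmetric, so it is `E k` plus
its transpose, where `E k` is one off-diagonal block. Contracting the direction `k` with p turns
this block into the second fundamental form of V; contracting it with 1 - p gives minus that of H,
with the indices exchanged. For umbilical and integrable planes both are pure trace, and p + (1 - p)
= 1 recovers the block. The whole argument rests on this formula. -/
theorem IsUmbilicalSplitting.covd_proj {Ω : Set E4} {G p : E4 → Matrix (Fin 4) (Fin 4) ℝ}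
    (h : IsUmbilicalSplitting Ω G p) {y : E4} (hy : y ∈ Ω) (k a b : Fin 4) :
    covd G (fun z => G z * p z) k y a b
      = (G y * p y) k a * meanForm G p b y + (G y * p y) k b * meanForm G p a y
        - (G y * (1 - p y)) k a * meanForm G (fun z => 1 - p z) b y
        - (G y * (1 - p y)) k b * meanForm G (fun z => 1 - p z) a y := by
  have hs := h.toIsSplitting
  let E : Fin 4 → Matrix (Fin 4) (Fin 4) ℝ := fun k => G y * ((1 - p y) * covdEnd G p k y)
  obtain ⟨q, hq⟩ : ∃ q : E4 → Matrix (Fin 4) (Fin 4) ℝ, q = fun z => 1 - p z := ⟨_, rfl⟩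
  have hqy : q y = 1 - p y := by rw [hq]
  have hA' := h.antisymm' y hy
  have hT' := h.traceless' y hy
  rw [← hq] at hA' hT' ⊢
  rw [← hqy]
  have hcov : ∀ k, covd G (fun z => G z * p z) k y = G y * covdEnd G p k y :=
    fun k => hs.toIsMetricOn.covd_mul hs.smooth_proj hy k
  have hidem := h.idem y hy
  have hEt : ∀ k, (E k).transpose = G y * (p y * covdEnd G p k y) := fun k => by
    have h1 : E k = covd G (fun z => G z * p z) k y * p y := by
      rw [hcov, mul_assoc]
      simp only [E]
      congr 1
      rw [sub_mul, one_mul, sub_eq_iff_eq_add]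
      exact (hs.covdEnd_proj hy k).symm
    rw [h1, Matrix.transpose_mul, hs.covd_proj_symm hy, hcov, ← mul_assoc, ← mul_assoc]
    congr 1
    have h2 := h.self_adjoint y hy
    rwa [Matrix.transpose_mul, h.symm y hy] at h2
  have hN : ∀ k, covd G (fun z => G z * p z) k y = E k + (E k).transpose := fun k => by
    rw [hEt, hcov, ← mul_add, sub_mul, one_mul, sub_add_cancel]
  have h1 : ∀ a b c, ∑ k, p y k b * E k a c = (G y * p y) b c * meanForm G p a y := by
    intro a b c
    rw [← secondForm_lower (h.antisymm y hy) (h.traceless y hy) a b c]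
    refine Finset.sum_congr rfl fun k _ => ?_
    have h0 : (1 - p y) * covdEnd G p k y = (1 - p y) * (pdm k p y + conn G k y * p y) := by
      have hz : (1 - p y) * p y = 0 := by rw [sub_mul, one_mul, hidem, sub_self]
      rw [covdEnd, mul_sub, ← mul_assoc (1 - p y) (p y), hz, zero_mul, sub_zero]
    simp only [E, h0]
  -- For the complementary plane the roles of the projectors are exchanged and the derivative
  -- changes sign, so its second fundamental form is minus the transposed block.
  have h2 : ∀ a b c, ∑ k, q y k b * E k c a = -((G y * q y) b c * meanForm G q a y) := by
    intro a b c
    rw [← secondForm_lower hA' hT' a b c, ← Finset.sum_neg_distrib]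
    refine Finset.sum_congr rfl fun k _ => ?_
    have h3 : (G y * ((1 - q y) * (pdm k q y + conn G k y * q y))) = -(E k).transpose := by
      rw [hEt, ← mul_neg]
      congr 1
      have h4 : pdm k q y = -pdm k p y := by
        rw [hq, pdm_sub hs.isOpen (smoothMat_const 1) hs.smooth_proj hy, pdm_const, zero_sub]
      rw [h4, covdEnd]
      simp only [hqy, sub_sub_cancel, mul_add, mul_sub, mul_one, ← mul_assoc, hidem, mul_neg]
      abel
    rw [h3, Matrix.neg_apply, Matrix.transpose_apply, mul_neg, neg_neg]
  have h3 : ∀ k a c, E k a c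
      = (G y * p y) k c * meanForm G p a y - (G y * q y) k a * meanForm G q c y := by
    intro k a c
    have h4 : ∑ j, (1 : Matrix (Fin 4) (Fin 4) ℝ) j k * E j a c = E k a c := by
      simp [Matrix.one_apply]
    have h5 : (1 : Matrix (Fin 4) (Fin 4) ℝ) = p y + q y := by rw [hqy, add_sub_cancel]
    rw [← h4, h5]
    simp only [Matrix.add_apply, add_mul, Finset.sum_add_distrib]
    rw [h1, h2]
    ring
  rw [hN, Matrix.add_apply, Matrix.transpose_apply, h3, h3]
  ring

/-! ### Curvature of an umbilical splitting -/

/-- The covariant derivative of a 1-form. -/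
def covdForm (G : E4 → Matrix (Fin 4) (Fin 4) ℝ) (θ : Fin 4 → E4 → ℝ) (l b : Fin 4) (y : E4) : ℝ :=
  pd l (θ b) y - ∑ n, conn G l y n b * θ n y

/-- The second covariant derivative of the projector of an umbilical splitting. -/
def secondCovd (G p : E4 → Matrix (Fin 4) (Fin 4) ℝ) (y : E4) (l k a b : Fin 4) : ℝ :=
  let q : E4 → Matrix (Fin 4) (Fin 4) ℝ := fun z => 1 - p z
  let N := fun l => covd G (fun z => G z * p z) l y
  N l k a * meanForm G p b y + (G y * p y) k a * covdForm G (meanForm G p) l b y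
    + (N l k b * meanForm G p a y + (G y * p y) k b * covdForm G (meanForm G p) l a y)
    + (N l k a * meanForm G q b y - (G y * (1 - p y)) k a * covdForm G (meanForm G q) l b y)
    + (N l k b * meanForm G q a y - (G y * (1 - p y)) k b * covdForm G (meanForm G q) l a y)

namespace IsUmbilicalSplitting

variable {Ω : Set E4} {G p : E4 → Matrix (Fin 4) (Fin 4) ℝ} (h : IsUmbilicalSplitting Ω G p)
  {y : E4}

include h

/-- The metric is parallel, so the derivatives of v and h are opposite. This is the reason why
`secondCovd` contains the derivative of v with a plus sign in front of ζ. -/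
theorem covd_compl (hy : y ∈ Ω) (k : Fin 4) :
    covd G (fun z => G z * (1 - p z)) k y = -covd G (fun z => G z * p z) k y := by
  have h1 := h.toIsMetricOn.covd_metric hy k
  have h2 : pdm k (fun z => G z * (1 - p z)) y = pdm k G y - pdm k (fun z => G z * p z) y := by
    rw [← pdm_sub h.isOpen h.smooth (h.smooth.mul h.smooth_proj) hy]
    exact pdm_congr h.isOpen (fun z _ => by rw [mul_sub, mul_one]) hy k
  rw [covd] at h1
  rw [covd, covd, h2, sub_eq_iff_eq_add, sub_eq_iff_eq_add] at *
  rw [h1]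
  noncomm_ring

/-- The left side corrects only the two tensor indices, as in `ricci_identity`. The correction for
the derivative index `k` is the last sum; it is symmetric in `l` and `k` and disappears on
antisymmetrization. -/
theorem covd_covd_proj (hy : y ∈ Ω) (l k a b : Fin 4) :
    (pdm l (covd G (fun z => G z * p z) k) y
        - (conn G l y).transpose * covd G (fun z => G z * p z) k y
        - covd G (fun z => G z * p z) k y * conn G l y) a b
      = secondCovd G p y l k a b
        + ∑ n, conn G l y n k * covd G (fun z => G z * p z) n y a b := by
  obtain ⟨q, hq⟩ : ∃ q : E4 → Matrix (Fin 4) (Fin 4) ℝ, q = fun z => 1 - p z := ⟨_, rfl⟩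
  have hv : SmoothMat Ω (fun z => G z * p z) := h.smooth.mul h.smooth_proj
  have hh : SmoothMat Ω (fun z => G z * (1 - p z)) := h.smooth.mul h.compl.smooth_proj
  have hξ := h.smooth_meanForm
  have hζ := h.compl.smooth_meanForm
  have e1 : pdm l (covd G (fun z => G z * p z) k) y a b
      = pd l (fun z => (G z * p z) k a * meanForm G p b z + (G z * p z) k b * meanForm G p a z
        - (G z * (1 - p z)) k a * meanForm G (fun z => 1 - p z) b z
        - (G z * (1 - p z)) k b * meanForm G (fun z => 1 - p z) a z) y :=
    pd_congr h.isOpen (fun z hz => h.covd_proj hz k a b) hy l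
  rw [pd_sub h.isOpen ((((hv k a).mul (hξ b)).add ((hv k b).mul (hξ a))).sub
      ((hh k a).mul (hζ b))) ((hh k b).mul (hζ a)) hy,
    pd_sub h.isOpen (((hv k a).mul (hξ b)).add ((hv k b).mul (hξ a)))
      ((hh k a).mul (hζ b)) hy,
    pd_add h.isOpen ((hv k a).mul (hξ b)) ((hv k b).mul (hξ a)) hy,
    pd_mul h.isOpen (hv k a) (hξ b) hy, pd_mul h.isOpen (hv k b) (hξ a) hy,
    pd_mul h.isOpen (hh k a) (hζ b) hy, pd_mul h.isOpen (hh k b) (hζ a) hy] at e1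
  have e2 : ∀ a b, pd l (fun z => (G z * p z) a b) y = covd G (fun z => G z * p z) l y a b
      + ∑ n, conn G l y n a * (G y * p y) n b + ∑ n, (G y * p y) a n * conn G l y n b :=
    fun a b => congrFun (congrFun (IsMetricOn.pdm_eq_covd (G := G)
      (T := fun z => G z * p z) (y := y) l) a) b
  have e3 : ∀ a b, pd l (fun z => (G z * (1 - p z)) a b) y
      = -covd G (fun z => G z * p z) l y a b
      + ∑ n, conn G l y n a * (G y * (1 - p y)) n b
      + ∑ n, (G y * (1 - p y)) a n * conn G l y n b :=
    fun a b => by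
      have := congrFun (congrFun (IsMetricOn.pdm_eq_covd (G := G)
        (T := fun z => G z * (1 - p z)) (y := y) l) a) b
      rw [h.covd_compl hy] at this
      exact this
  have e4 : ∀ θ : Fin 4 → E4 → ℝ, ∀ b, pd l (θ b) y
      = covdForm G θ l b y + ∑ n, conn G l y n b * θ n y := fun θ b => by
    rw [covdForm, sub_add_cancel]
  have e5 : ∀ b, pd l (meanForm G (fun z => 1 - p z) b) y
      = covdForm G (meanForm G (fun z => 1 - p z)) l b y
        + ∑ n, conn G l y n b * meanForm G (fun z => 1 - p z) n y := e4 _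
  rw [e2, e2, e3, e3, e4, e4 (meanForm G p) a, e5, e5] at e1
  have e6 : ∀ n a b, covd G (fun z => G z * p z) n y a b = _ := fun n a b => h.covd_proj hy n a b
  rw [Matrix.sub_apply, Matrix.sub_apply, Matrix.mul_apply, Matrix.mul_apply, e1, secondCovd]
  rw [← hq]
  simp only [Matrix.transpose_apply, e6 k, e6 0, e6 1, e6 2, e6 3, Fin.sum_univ_four, ← hq]
  ring

/-- The Ricci identity for the projector of an umbilical splitting. -/
theorem secondCovd_antisymm (hy : y ∈ Ω) (l k a b : Fin 4) :
    secondCovd G p y l k a b - secondCovd G p y k l a b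
      = ∑ n, riemann G l k a n y * p y n b - ∑ n, p y n a * riemann G l k n b y := by
  have hG := h.toIsMetricOn
  have h1 := congrFun (congrFun (hG.ricci_identity (h.smooth.mul h.smooth_proj) hy l k) a) b
  rw [Matrix.sub_apply, h.covd_covd_proj hy, h.covd_covd_proj hy] at h1
  have h2 : ∀ n, conn G l y n k = conn G k y n l := fun n => hG.christoffel_symm hy n l k
  simp only [h2, add_sub_add_right_eq_sub] at h1
  rw [h1]
  have h3 : (curv G l k y).transpose * (G y * p y) = -(G y * curv G l k y * p y) := by
    rw [← mul_assoc, ← neg_mul]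
    congr 1
    ext a b
    have := hG.riemann_antisymm_left hy b a l k
    rw [IsMetricOn.riemann_eq, IsMetricOn.riemann_eq] at this
    rw [Matrix.neg_apply, ← this, ← Matrix.transpose_apply (G y * _), Matrix.transpose_mul,
      hG.symm y hy]
  have h4 : G y * p y = (p y).transpose * G y := by
    rw [← h.self_adjoint y hy, Matrix.transpose_mul, hG.symm y hy]
  rw [h3, h4, mul_assoc (p y).transpose, neg_add, neg_neg, Matrix.add_apply, Matrix.neg_apply,
    Matrix.mul_apply, Matrix.mul_apply, sub_eq_add_neg]
  simp only [← IsMetricOn.riemann_eq, hG.riemann_pair hy l k, Matrix.transpose_apply]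

/-- The derivative of the mean curvature form along the plane field. -/
theorem covdForm_mul_proj (hy : y ∈ Ω) (l b : Fin 4) :
    ∑ a, covdForm G (meanForm G p) l a y * p y a b
      = -∑ a, meanForm G p a y * ((G y)⁻¹ * covd G (fun z => G z * p z) l y) a b := by
  have hG := h.toIsMetricOn
  have hξ := h.smooth_meanForm
  have hp := h.smooth_proj
  -- The relation to be differentiated is the normality of ξ, which holds on all of `Ω`.
  have h1 : pd l (fun z => ∑ a, meanForm G p a z * p z a b) y = 0 := by
    rw [pd_congr h.isOpen (fun z hz => h.meanForm_mul_proj hz b) hy, pd_const]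
  rw [pd_sum _ h.isOpen (fun a _ => (hξ a).mul (hp a b)) hy] at h1
  have h2 : ∀ a, pd l (fun z => meanForm G p a z * p z a b) y
      = pd l (meanForm G p a) y * p y a b + meanForm G p a y * pd l (fun z => p z a b) y :=
    fun a => pd_mul h.isOpen (hξ a) (hp a b) hy l
  have h3 : (G y)⁻¹ * covd G (fun z => G z * p z) l y = covdEnd G p l y := by
    rw [hG.covd_mul hp hy, ← mul_assoc, Matrix.nonsing_inv_mul _ (hG.isUnit_det hy), one_mul]
  have h4 : ∀ a, pd l (fun z => p z a b) y = covdEnd G p l y a b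
      - ∑ n, conn G l y a n * p y n b + ∑ n, p y a n * conn G l y n b := fun a => by
    rw [covdEnd, Matrix.sub_apply, Matrix.add_apply, Matrix.mul_apply, Matrix.mul_apply, pdm_apply]
    ring
  have h5 : ∑ a, meanForm G p a y * ∑ n, p y a n * conn G l y n b = 0 := by
    simp only [Finset.mul_sum]
    rw [Finset.sum_comm]
    simp only [← mul_assoc, ← Finset.sum_mul, h.meanForm_mul_proj hy, zero_mul,
      Finset.sum_const_zero]
  simp only [h2, h4, mul_add, mul_sub, Finset.sum_add_distrib, Finset.sum_sub_distrib, h5] at h1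
  rw [h3]
  have h6 : ∑ a, (∑ n, conn G l y n a * meanForm G p n y) * p y a b
      = ∑ a, meanForm G p a y * ∑ n, conn G l y a n * p y n b := by
    simp only [Finset.sum_mul, Finset.mul_sum]
    rw [Finset.sum_comm]
    exact Finset.sum_congr rfl fun _ _ => Finset.sum_congr rfl fun _ _ => by ring
  simp only [covdForm, sub_mul, Finset.sum_sub_distrib, h6]
  linarith

/-- The hypotheses are symmetric in the two planes, so each result about ξ gives the corresponding
one about ζ. -/
theorem compl : IsUmbilicalSplitting Ω G (fun z => 1 - p z) where
  toIsSplitting := h.toIsSplitting.compl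
  antisymm := h.antisymm'
  antisymm' := by simpa only [sub_sub_cancel] using h.antisymm
  traceless := h.traceless'
  traceless' := by simpa only [sub_sub_cancel] using h.traceless

end IsUmbilicalSplitting

/-! ### Components in a frame -/

/-- Contraction of a covector with a vector. -/
def ct (b f : Fin 4 → ℝ) : ℝ := ∑ a, b a * f a

section Contraction

variable (b b' f f' : Fin 4 → ℝ) (r : ℝ)

/-- Frame components of tensors of any rank are iterated single contractions. Linearity of one
contraction therefore suffices to expand the frame components of every tensor expression below. -/
theorem ct_add : ct b (fun a => f a + f' a) = ct b f + ct b f' := by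
  simp only [ct, mul_add, Finset.sum_add_distrib]

theorem ct_sub : ct b (fun a => f a - f' a) = ct b f - ct b f' := by
  simp only [ct, mul_sub, Finset.sum_sub_distrib]

theorem ct_neg : ct b (fun a => -f a) = -ct b f := by
  simp only [ct, mul_neg, Finset.sum_neg_distrib]

theorem ct_const_mul : ct b (fun a => r * f a) = r * ct b f := by
  simp only [ct, Finset.mul_sum, mul_left_comm r]

theorem ct_mul_const : ct b (fun a => f a * r) = ct b f * r := by
  simp only [ct, Finset.sum_mul, mul_assoc]

theorem ct_sum {ι : Type*} (s : Finset ι) (F : ι → Fin 4 → ℝ) :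
    ct b (fun a => ∑ i ∈ s, F i a) = ∑ i ∈ s, ct b (F i) := by
  simp only [ct, Finset.mul_sum]
  exact Finset.sum_comm

theorem ct_comm (F : Fin 4 → Fin 4 → ℝ) :
    ct b (fun a => ct b' fun c => F a c) = ct b' (fun c => ct b fun a => F a c) := by
  simp only [ct, Finset.mul_sum]
  rw [Finset.sum_comm]
  exact Finset.sum_congr rfl fun _ _ => Finset.sum_congr rfl fun _ _ => by ring

end Contraction

/-- The components of a 1-form in the frame formed by the columns of `B`. -/
def fr1 (B : Matrix (Fin 4) (Fin 4) ℝ) (θ : Fin 4 → ℝ) (i : Fin 4) : ℝ := ct (fun a => B a i) θ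

/-- The components of a covariant 2-tensor in a frame. -/
def fr2 (B : Matrix (Fin 4) (Fin 4) ℝ) (T : Fin 4 → Fin 4 → ℝ) (i j : Fin 4) : ℝ :=
  fr1 B (fun a => fr1 B (T a) j) i

/-- The components of a covariant 3-tensor in a frame. -/
def fr3 (B : Matrix (Fin 4) (Fin 4) ℝ) (T : Fin 4 → Fin 4 → Fin 4 → ℝ) (i j k : Fin 4) : ℝ :=
  fr1 B (fun a => fr2 B (T a) j k) i

/-- The components of a covariant 4-tensor in a frame. -/
def fr4 (B : Matrix (Fin 4) (Fin 4) ℝ) (T : Fin 4 → Fin 4 → Fin 4 → Fin 4 → ℝ)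
    (i j k l : Fin 4) : ℝ :=
  fr1 B (fun a => fr3 B (T a) j k l) i

/-- The diagonal of the Minkowski matrix. -/
def sgn : Fin 4 → ℝ := ![-1, 1, 1, 1]

/-- The indicator function of the first two frame vectors. -/
def tl : Fin 4 → ℝ := ![1, 1, 0, 0]

theorem fr2_eq (B T : Matrix (Fin 4) (Fin 4) ℝ) (i j : Fin 4) :
    fr2 B T i j = (B.transpose * T * B) i j := by
  rw [mul_assoc, Matrix.mul_apply]
  simp only [fr2, fr1, ct, Matrix.transpose_apply, Matrix.mul_apply, mul_comm (B _ j)]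

theorem fr2_sub (B : Matrix (Fin 4) (Fin 4) ℝ) (T T' : Fin 4 → Fin 4 → ℝ) (i j : Fin 4) :
    fr2 B (fun a b => T a b - T' a b) i j = fr2 B T i j - fr2 B T' i j := by
  simp only [fr2, fr1, ct_sub]

theorem fr2_add (B : Matrix (Fin 4) (Fin 4) ℝ) (T T' : Fin 4 → Fin 4 → ℝ) (i j : Fin 4) :
    fr2 B (fun a b => T a b + T' a b) i j = fr2 B T i j + fr2 B T' i j := by
  simp only [fr2, fr1, ct_add]

theorem fr2_swap (B : Matrix (Fin 4) (Fin 4) ℝ) (T : Fin 4 → Fin 4 → ℝ) (i j : Fin 4) :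
    fr2 B (fun a b => T b a) i j = fr2 B T j i := by
  simp only [fr2, fr1]
  rw [ct_comm]

/-- An orthonormal frame of eigenvectors of `P`, with eigenvalues `t`. -/
structure IsAdaptedFrame (g P B : Matrix (Fin 4) (Fin 4) ℝ) (t : Fin 4 → ℝ) : Prop where
  orthonormal : B.transpose * g * B = minkowski
  adapted : P * B = B * Matrix.diagonal t

theorem minkowski_eq : minkowski = Matrix.diagonal sgn := rfl

theorem minkowski_sq : minkowski * minkowski = 1 := by
  rw [minkowski_eq, Matrix.diagonal_mul_diagonal, ← Matrix.diagonal_one]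
  congr 1
  ext i
  fin_cases i <;> simp [sgn]

namespace IsAdaptedFrame

variable {g P B : Matrix (Fin 4) (Fin 4) ℝ} {t : Fin 4 → ℝ}
  (hB : IsAdaptedFrame g P B t)
include hB

theorem left_inv : (minkowski * B.transpose * g) * B = 1 := by
  rw [mul_assoc minkowski, mul_assoc, hB.orthonormal, minkowski_sq]

theorem right_inv : B * (minkowski * B.transpose * g) = 1 :=
  mul_eq_one_comm.1 hB.left_inv

theorem inv_metric : g⁻¹ = B * minkowski * B.transpose :=
  Matrix.inv_eq_left_inv (by rw [mul_assoc, mul_assoc, ← mul_assoc minkowski]; exact hB.right_inv)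

theorem fr2_metric (i j : Fin 4) : fr2 B g i j = if i = j then sgn i else 0 := by
  rw [fr2_eq, hB.orthonormal, minkowski_eq, Matrix.diagonal_apply]

theorem fr2_proj (i j : Fin 4) : fr2 B (g * P) i j = if i = j then sgn i * t i else 0 := by
  rw [fr2_eq, mul_assoc, mul_assoc, hB.adapted, ← mul_assoc, ← mul_assoc, hB.orthonormal,
    minkowski_eq, Matrix.diagonal_mul_diagonal, Matrix.diagonal_apply]

theorem fr2_compl (i j : Fin 4) :
    fr2 B (g * (1 - P) : Matrix (Fin 4) (Fin 4) ℝ) i j = if i = j then sgn i * (1 - t i) else 0 := by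
  have h1 : fr2 B (g * (1 - P) : Matrix (Fin 4) (Fin 4) ℝ) i j = fr2 B g i j - fr2 B (g * P) i j := by
    rw [fr2_eq, fr2_eq, fr2_eq, mul_sub, mul_one, mul_sub, sub_mul, Matrix.sub_apply]
  rw [h1, hB.fr2_metric, hB.fr2_proj]
  split_ifs <;> ring

theorem compl : IsAdaptedFrame g (1 - P) B (fun i => 1 - t i) where
  orthonormal := hB.orthonormal
  adapted := by
    have : Matrix.diagonal (fun i => 1 - t i) = 1 - Matrix.diagonal t := by
      rw [← Matrix.diagonal_one, Matrix.diagonal_sub]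
    rw [this, sub_mul, mul_sub, hB.adapted, one_mul, mul_one]

theorem fr1_mul_proj (θ : Fin 4 → ℝ) (j : Fin 4) :
    fr1 B (fun b => ∑ a, θ a * P a b) j = fr1 B θ j * t j := by
  have h1 : ∀ a, ∑ b, P a b * B b j = B a j * t j := fun a => by
    have := congrFun (congrFun hB.adapted a) j
    rwa [Matrix.mul_apply, Matrix.mul_diagonal] at this
  calc fr1 B (fun b => ∑ a, θ a * P a b) j = ∑ a, θ a * ∑ b, P a b * B b j := by
        simp only [fr1, ct, Finset.mul_sum]
        rw [Finset.sum_comm]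
        exact Finset.sum_congr rfl fun _ _ => Finset.sum_congr rfl fun _ _ => by ring
    _ = _ := by
        simp only [h1, fr1, ct, Finset.sum_mul]
        exact Finset.sum_congr rfl fun _ _ => by ring

theorem fr1_inv_mul (θ : Fin 4 → ℝ) (T : Matrix (Fin 4) (Fin 4) ℝ) (j : Fin 4) :
    fr1 B (fun b => ∑ a, θ a * (g⁻¹ * T) a b) j
      = ∑ i, fr1 B θ i * (sgn i * fr2 B T i j) := by
  have h1 : ∀ a, ∑ b, (g⁻¹ * T) a b * B b j = ∑ i, B a i * (sgn i * fr2 B T i j) := fun a => by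
    have : g⁻¹ * T * B = B * (minkowski * (B.transpose * T * B)) := by
      rw [hB.inv_metric]
      simp only [mul_assoc]
    rw [← Matrix.mul_apply, this, Matrix.mul_apply]
    refine Finset.sum_congr rfl fun i _ => ?_
    rw [minkowski_eq, Matrix.diagonal_mul, fr2_eq]
  calc fr1 B (fun b => ∑ a, θ a * (g⁻¹ * T) a b) j = ∑ a, θ a * ∑ b, (g⁻¹ * T) a b * B b j := by
        simp only [fr1, ct, Finset.mul_sum]
        rw [Finset.sum_comm]
        exact Finset.sum_congr rfl fun _ _ => Finset.sum_congr rfl fun _ _ => by ring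
    _ = _ := by
        simp only [h1, fr1, ct, Finset.sum_mul, Finset.mul_sum]
        rw [Finset.sum_comm]
        exact Finset.sum_congr rfl fun _ _ => Finset.sum_congr rfl fun _ _ => by ring

theorem eq_zero_of_fr2 {T : Fin 4 → Fin 4 → ℝ} (hT : ∀ i j, fr2 B T i j = 0) (a b : Fin 4) :
    T a b = 0 := by
  have h1 : B.transpose * (Matrix.of T) * B = 0 := by
    ext i j
    rw [← fr2_eq]
    exact hT i j
  have h2 : Matrix.of T = 0 := by
    have h3 : B * (minkowski * B.transpose * g) = 1 := hB.right_inv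
    have h4 : (B * (minkowski * B.transpose * g)).transpose = 1 := by rw [h3, Matrix.transpose_one]
    rw [Matrix.transpose_mul] at h4
    calc Matrix.of T = ((minkowski * B.transpose * g).transpose * B.transpose) * Matrix.of T
          * (B * (minkowski * B.transpose * g)) := by rw [h3, h4, one_mul, mul_one]
      _ = (minkowski * B.transpose * g).transpose * (B.transpose * Matrix.of T * B)
          * (minkowski * B.transpose * g) := by simp only [mul_assoc]
      _ = 0 := by rw [h1, mul_zero, zero_mul]
  exact congrFun (congrFun h2 a) b

end IsAdaptedFrame

/-! ### Frame components of the curvature of an umbilical splitting. -/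

namespace IsUmbilicalSplitting

variable {Ω : Set E4} {G p : E4 → Matrix (Fin 4) (Fin 4) ℝ} (h : IsUmbilicalSplitting Ω G p)
  {y : E4} {B : Matrix (Fin 4) (Fin 4) ℝ} {t : Fin 4 → ℝ}
  (hB : IsAdaptedFrame (G y) (p y) B t)

include h hB

theorem fr1_meanForm (hy : y ∈ Ω) (i : Fin 4) :
    fr1 B (fun a => meanForm G p a y) i * t i = 0 := by
  rw [← hB.fr1_mul_proj]
  simp only [h.meanForm_mul_proj hy, fr1, ct, mul_zero, Finset.sum_const_zero]

theorem fr1_meanForm_compl (hy : y ∈ Ω) (i : Fin 4) :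
    fr1 B (fun a => meanForm G (fun z => 1 - p z) a y) i * (1 - t i) = 0 := by
  have h1 := h.compl.meanForm_mul_proj hy
  have h2 : ∀ b, ∑ a, meanForm G (fun z => 1 - p z) a y * p y a b
      = meanForm G (fun z => 1 - p z) b y := fun b => by
    have := h1 b
    simp only [Matrix.sub_apply, mul_sub, Finset.sum_sub_distrib, Matrix.one_apply, mul_ite,
      mul_one, mul_zero, Finset.sum_ite_eq', Finset.mem_univ, if_true] at this
    linarith
  rw [mul_sub, ← hB.fr1_mul_proj]
  simp only [h2, mul_one, sub_self]

omit hB in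
theorem fr3_covd (hy : y ∈ Ω) (k i j : Fin 4) :
    fr3 B (fun k => covd G (fun z => G z * p z) k y) k i j
      = fr2 B (G y * p y) k i * fr1 B (fun a => meanForm G p a y) j
        + fr2 B (G y * p y) k j * fr1 B (fun a => meanForm G p a y) i
        - fr2 B (G y * (1 - p y) : Matrix (Fin 4) (Fin 4) ℝ) k i * fr1 B (fun a => meanForm G (fun z => 1 - p z) a y) j
        - fr2 B (G y * (1 - p y) : Matrix (Fin 4) (Fin 4) ℝ) k j * fr1 B (fun a => meanForm G (fun z => 1 - p z) a y) i := by
  change fr3 B (fun k a b => covd G (fun z => G z * p z) k y a b) k i j = _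
  simp only [h.covd_proj hy]
  simp only [fr3, fr2, fr1, ct_add, ct_sub, ct_const_mul, ct_mul_const]

omit h hB in
theorem fr4_secondCovd (l k i j : Fin 4) :
    fr4 B (secondCovd G p y) l k i j
      = fr3 B (fun k => covd G (fun z => G z * p z) k y) l k i
          * fr1 B (fun a => meanForm G p a y) j
        + fr2 B (G y * p y) k i * fr2 B (fun l b => covdForm G (meanForm G p) l b y) l j
        + (fr3 B (fun k => covd G (fun z => G z * p z) k y) l k j
            * fr1 B (fun a => meanForm G p a y) i
          + fr2 B (G y * p y) k j * fr2 B (fun l b => covdForm G (meanForm G p) l b y) l i)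
        + (fr3 B (fun k => covd G (fun z => G z * p z) k y) l k i
            * fr1 B (fun a => meanForm G (fun z => 1 - p z) a y) j
          - fr2 B (G y * (1 - p y) : Matrix (Fin 4) (Fin 4) ℝ) k i
            * fr2 B (fun l b => covdForm G (meanForm G (fun z => 1 - p z)) l b y) l j)
        + (fr3 B (fun k => covd G (fun z => G z * p z) k y) l k j
            * fr1 B (fun a => meanForm G (fun z => 1 - p z) a y) i
          - fr2 B (G y * (1 - p y) : Matrix (Fin 4) (Fin 4) ℝ) k j
            * fr2 B (fun l b => covdForm G (meanForm G (fun z => 1 - p z)) l b y) l i) := by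
  change fr4 B (fun l k a b => secondCovd G p y l k a b) l k i j = _
  simp only [secondCovd]
  simp only [fr4, fr3, fr2, fr1, ct_add, ct_sub, ct_const_mul, ct_mul_const]

/-- The mixed components of the curvature tensor. -/
theorem fr4_riemann (hy : y ∈ Ω) {i j : Fin 4} (hi : t i = 1) (hj : t j = 0) (l k : Fin 4) :
    fr4 B (fun l k a b => riemann G l k a b y) l k i j
      = fr4 B (secondCovd G p y) k l i j - fr4 B (secondCovd G p y) l k i j := by
  have e1 : fr4 B (fun l k a b => secondCovd G p y k l a b) l k i j
      = fr4 B (secondCovd G p y) k l i j := by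
    simp only [fr4, fr3, fr2, fr1]
    rw [ct_comm]
  have e2 : fr4 B (fun l k a b => secondCovd G p y l k a b - secondCovd G p y k l a b) l k i j
      = fr4 B (secondCovd G p y) l k i j - fr4 B (secondCovd G p y) k l i j := by
    rw [← e1]
    simp only [fr4, fr3, fr2, fr1, ct_sub]
  -- The frame vector `j` is killed by p and the frame vector `i` is fixed by it, so of the two
  -- curvature terms in the Ricci identity the first vanishes and the second is the mixed component
  -- itself.
  have e3 : fr4 B (fun l k a b => ∑ n, riemann G l k a n y * p y n b) l k i j = 0 := by
    have : ∀ θ : Fin 4 → ℝ, ct (fun a => B a j) (fun b => ∑ n, θ n * p y n b) = 0 := fun θ => by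
      have := hB.fr1_mul_proj θ j
      rwa [hj, mul_zero] at this
    have this' : ∀ l k a, ct (fun a => B a j) (fun b => ∑ n, riemann G l k a n y * p y n b) = 0 :=
      fun l k a => this fun n => riemann G l k a n y
    simp only [fr4, fr3, fr2, fr1, this']
    simp only [ct, mul_zero, Finset.sum_const_zero]
  have e4 : fr4 B (fun l k a b => ∑ n, p y n a * riemann G l k n b y) l k i j
      = fr4 B (fun l k a b => riemann G l k a b y) l k i j := by
    have : ∀ θ : Fin 4 → ℝ, ct (fun a => B a i) (fun b => ∑ n, p y n b * θ n)
        = ct (fun a => B a i) θ := fun θ => by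
      have := hB.fr1_mul_proj θ i
      rw [hi, mul_one] at this
      simpa only [fr1, mul_comm] using this
    simp only [fr4, fr3, fr2, fr1]
    congr 1
    ext l
    congr 1
    ext k
    rw [ct_comm, ct_comm (fun a => B a i)]
    congr 1
    ext b
    exact this fun n => riemann G l k n b y
  simp only [h.secondCovd_antisymm hy] at e2
  have e5 : fr4 B (fun l k a b => ∑ n, riemann G l k a n y * p y n b
      - ∑ n, p y n a * riemann G l k n b y) l k i j
      = fr4 B (fun l k a b => ∑ n, riemann G l k a n y * p y n b) l k i j
        - fr4 B (fun l k a b => ∑ n, p y n a * riemann G l k n b y) l k i j := by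
    simp only [fr4, fr3, fr2, fr1, ct_sub]
  rw [e5, e3, e4] at e2
  linarith

/-- The differentiated normality relation `covdForm_mul_proj` read in the frame: components of ∇ξ
whose second index lies in V involve no derivative of ξ, only ξ and ∇v. -/
theorem fr2_covdForm (hy : y ∈ Ω) (l : Fin 4) {j : Fin 4} (hj : t j = 1) :
    fr2 B (fun l b => covdForm G (meanForm G p) l b y) l j
      = -∑ i, fr1 B (fun a => meanForm G p a y) i
        * (sgn i * fr3 B (fun k => covd G (fun z => G z * p z) k y) l i j) := by
  have e1 : ∀ l, fr1 B (fun b => covdForm G (meanForm G p) l b y) j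
      = -∑ i, fr1 B (fun a => meanForm G p a y) i
        * (sgn i * fr2 B (covd G (fun z => G z * p z) l y) i j) := fun l => by
    have e2 := hB.fr1_mul_proj (fun b => covdForm G (meanForm G p) l b y) j
    rw [hj, mul_one] at e2
    rw [← e2, ← hB.fr1_inv_mul]
    simp only [h.covdForm_mul_proj hy, fr1, ct_neg]
  have e0 : fr2 B (fun l b => covdForm G (meanForm G p) l b y) l j
      = fr1 B (fun l => fr1 B (fun b => covdForm G (meanForm G p) l b y) j) l := rfl
  rw [e0]
  simp only [e1]
  simp only [fr1, fr3, ct_neg, ct_sum, ct_const_mul]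

end IsUmbilicalSplitting

/-! ### Mixed curvature and the closedness of ξ + ζ. -/

namespace IsUmbilicalSplitting

variable {Ω : Set E4} {G p : E4 → Matrix (Fin 4) (Fin 4) ℝ} (h : IsUmbilicalSplitting Ω G p)
  {y : E4} {B : Matrix (Fin 4) (Fin 4) ℝ} {t : Fin 4 → ℝ}
  (hB : IsAdaptedFrame (G y) (p y) B t)

/-- The frame components of `∇ξ - ξ ⊗ ξ`, where `ξ` is the mean curvature form. -/
def hessForm (G p : E4 → Matrix (Fin 4) (Fin 4) ℝ) (y : E4) (B : Matrix (Fin 4) (Fin 4) ℝ)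
    (l i : Fin 4) : ℝ :=
  fr2 B (fun l b => covdForm G (meanForm G p) l b y) l i
    - fr1 B (fun a => meanForm G p a y) l * fr1 B (fun a => meanForm G p a y) i

include h hB

/-- The mixed curvature components of an umbilical splitting. -/
theorem fr4_riemann_eq (hy : y ∈ Ω) {i j : Fin 4} (hi : t i = 1) (hj : t j = 0) (l k : Fin 4) :
    fr4 B (fun l k a b => riemann G l k a b y) l k i j
      = (if l = i then sgn l else 0) * hessForm G p y B k j
        - (if k = i then sgn k else 0) * hessForm G p y B l j
        + (if k = j then sgn k else 0) * hessForm G (fun z => 1 - p z) y B l i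
        - (if l = j then sgn l else 0) * hessForm G (fun z => 1 - p z) y B k i := by
  have hξ : fr1 B (fun a => meanForm G p a y) i = 0 := by
    simpa [hi] using h.fr1_meanForm hB hy i
  have hζ : fr1 B (fun a => meanForm G (fun z => 1 - p z) a y) j = 0 := by
    simpa [hj] using h.fr1_meanForm_compl hB hy j
  have hvi : ∀ k, fr2 B (G y * p y) k i = if k = i then sgn k else 0 := fun k => by
    rw [hB.fr2_proj]
    split_ifs with hk
    · rw [hk, hi, mul_one]
    · rfl
  have hvj : ∀ k, fr2 B (G y * p y) k j = 0 := fun k => by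
    rw [hB.fr2_proj]
    split_ifs with hk
    · rw [hk, hj, mul_zero]
    · rfl
  have hhi : ∀ k, fr2 B (G y * (1 - p y) : Matrix (Fin 4) (Fin 4) ℝ) k i = 0 := fun k => by
    rw [hB.fr2_compl]
    split_ifs with hk
    · rw [hk, hi, sub_self, mul_zero]
    · rfl
  have hhj : ∀ k, fr2 B (G y * (1 - p y) : Matrix (Fin 4) (Fin 4) ℝ) k j
      = if k = j then sgn k else 0 := fun k => by
    rw [hB.fr2_compl]
    split_ifs with hk
    · rw [hk, hj, sub_zero, mul_one]
    · rfl
  have hvs : fr2 B (G y * p y) l k = fr2 B (G y * p y) k l := by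
    rw [hB.fr2_proj, hB.fr2_proj]
    by_cases hkl : l = k
    · subst hkl; rfl
    · rw [if_neg hkl, if_neg (Ne.symm hkl)]
  have hhs : fr2 B (G y * (1 - p y) : Matrix (Fin 4) (Fin 4) ℝ) l k
      = fr2 B (G y * (1 - p y) : Matrix (Fin 4) (Fin 4) ℝ) k l := by
    rw [hB.fr2_compl, hB.fr2_compl]
    by_cases hkl : l = k
    · subst hkl; rfl
    · rw [if_neg hkl, if_neg (Ne.symm hkl)]
  rw [h.fr4_riemann hB hy hi hj]
  simp only [fr4_secondCovd, h.fr3_covd hy, hvi, hvj, hhi, hhj, hξ, hζ, hessForm, hvs, hhs]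
  ring

/-- The mixed components of `∇ξ` along the complementary plane field. -/
theorem covdForm_mixed (hy : y ∈ Ω) (ht : ∀ i, t i = 1 ∨ t i = 0) {i j : Fin 4}
    (hi : t i = 0) (hj : t j = 1) :
    fr2 B (fun l b => covdForm G (meanForm G p) l b y) i j
      = fr1 B (fun a => meanForm G p a y) i
        * fr1 B (fun a => meanForm G (fun z => 1 - p z) a y) j := by
  have hξj : fr1 B (fun a => meanForm G p a y) j = 0 := by
    simpa [hj] using h.fr1_meanForm hB hy j
  have hζi : fr1 B (fun a => meanForm G (fun z => 1 - p z) a y) i = 0 := by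
    simpa [hi] using h.fr1_meanForm_compl hB hy i
  -- For `k` in V the factor ξ_k vanishes. For `k` in H different from `i`, the frame is orthogonal
  -- and no term of ∇_i v_kj survives.
  rw [h.fr2_covdForm hB hy i hj, Finset.sum_eq_single i]
  · have hs : sgn i * sgn i = 1 := by fin_cases i <;> simp [sgn]
    rw [h.fr3_covd hy]
    simp only [hB.fr2_proj, hB.fr2_compl, hξj, hζi, if_true, hi, mul_zero, ite_self]
    linear_combination (fr1 B (fun a => meanForm G p a y) i
      * fr1 B (fun a => meanForm G (fun z => 1 - p z) a y) j) * hs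
  · intro k _ hk
    rw [h.fr3_covd hy]
    rcases ht k with hk' | hk'
    · have : fr1 B (fun a => meanForm G p a y) k = 0 := by
        simpa [hk'] using h.fr1_meanForm hB hy k
      rw [this, zero_mul]
    · have hij : i ≠ j := fun e => by rw [e, hj] at hi; exact one_ne_zero hi
      simp only [hB.fr2_proj, hB.fr2_compl, hξj, if_neg hk.symm, if_neg hij]
      ring
  · simp

/-- `∇ξ` is symmetric along the plane field itself. -/
theorem covdForm_symm (hy : y ∈ Ω) (ht : ∀ i, t i = 1 ∨ t i = 0) {i j : Fin 4}
    (hi : t i = 1) (hj : t j = 1) :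
    fr2 B (fun l b => covdForm G (meanForm G p) l b y) i j
      = fr2 B (fun l b => covdForm G (meanForm G p) l b y) j i := by
  rw [h.fr2_covdForm hB hy i hj, h.fr2_covdForm hB hy j hi]
  congr 1
  refine Finset.sum_congr rfl fun k _ => ?_
  rcases ht k with hk | hk
  · have : fr1 B (fun a => meanForm G p a y) k = 0 := by
      simpa [hk] using h.fr1_meanForm hB hy k
    rw [this, zero_mul, zero_mul]
  · have hξi : fr1 B (fun a => meanForm G p a y) i = 0 := by
      simpa [hi] using h.fr1_meanForm hB hy i
    have hξj : fr1 B (fun a => meanForm G p a y) j = 0 := by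
      simpa [hj] using h.fr1_meanForm hB hy j
    have hik : i ≠ k := fun e => by rw [e, hk] at hi; exact zero_ne_one hi
    have hjk : j ≠ k := fun e => by rw [e, hk] at hj; exact zero_ne_one hj
    rw [h.fr3_covd hy, h.fr3_covd hy]
    simp only [hB.fr2_proj, hB.fr2_compl, if_neg hik, if_neg hjk, hi, hj, sub_self, mul_zero,
      ite_self]
    by_cases hij : i = j
    · subst hij; rfl
    · rw [if_neg hij, if_neg (Ne.symm hij)]
      ring

/-- If the mixed parts of `∇ξ` and `∇ζ` agree, then `ξ + ζ` is closed. -/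
theorem closed_meanForm_add (hy : y ∈ Ω) (ht : ∀ i, t i = 1 ∨ t i = 0)
    (hX : ∀ i j, t i = 0 → t j = 0 → hessForm G p y B i j = hessForm G p y B j i)
    (hZ : ∀ i j, t i = 1 → t j = 1 → hessForm G (fun z => 1 - p z) y B i j
      = hessForm G (fun z => 1 - p z) y B j i)
    (hY : ∀ i j, t i = 1 → t j = 0 → hessForm G p y B i j
      = hessForm G (fun z => 1 - p z) y B j i) (a b : Fin 4) :
    pd a (fun z => meanForm G p b z + meanForm G (fun z => 1 - p z) b z) y
      = pd b (fun z => meanForm G p a z + meanForm G (fun z => 1 - p z) a z) y := by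
  have hc := h.compl
  have hBc := hB.compl
  have ht' : ∀ i, 1 - t i = 1 ∨ 1 - t i = 0 := fun i => by
    rcases ht i with e | e <;> simp [e]
  have hsub : (fun z => 1 - (1 - p z)) = p := by ext1 z; rw [sub_sub_cancel]
  let Dξ : Fin 4 → Fin 4 → ℝ := fun l b => covdForm G (meanForm G p) l b y
  let Dζ : Fin 4 → Fin 4 → ℝ := fun l b => covdForm G (meanForm G (fun z => 1 - p z)) l b y
  have key : ∀ i j, t i = 1 → t j = 0 →
      fr2 B Dξ i j + fr2 B Dζ i j = fr2 B Dξ j i + fr2 B Dζ j i := by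
    intro i j hi hj
    -- The products ξ_j ζ_i coming from ∇_j ξ_i and from ∇_i ζ_j are equal, and the hypothesis `hY`
    -- identifies the two remaining derivatives; ξ_i = ζ_j = 0 removes the quadratic terms from the
    -- latter.
    have e1 := h.covdForm_mixed hB hy ht hj hi
    have e2 := hc.covdForm_mixed hBc hy ht' (i := i) (j := j) (by simp [hi]) (by simp [hj])
    rw [hsub] at e2
    have e3 := hY i j hi hj
    have hξ : fr1 B (fun a => meanForm G p a y) i = 0 := by
      simpa [hi] using h.fr1_meanForm hB hy i
    have hζ : fr1 B (fun a => meanForm G (fun z => 1 - p z) a y) j = 0 := by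
      simpa [hj] using h.fr1_meanForm_compl hB hy j
    simp only [hessForm, hξ, hζ, zero_mul, sub_zero] at e3
    simp only [Dξ, Dζ, e1, e2, e3]
    ring
  have hfr : ∀ i j, fr2 B (fun a b => (Dξ a b + Dζ a b) - (Dξ b a + Dζ b a)) i j = 0 := by
    intro i j
    rw [fr2_sub, fr2_swap B (fun a b => Dξ a b + Dζ a b), fr2_add, fr2_add, sub_eq_zero]
    rcases ht i with hi | hi <;> rcases ht j with hj | hj
    · have e1 := h.covdForm_symm hB hy ht hi hj
      have e2 := hZ i j hi hj
      simp only [hessForm] at e2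
      simp only [Dξ, Dζ, e1]
      linarith
    · exact key i j hi hj
    · exact (key j i hj hi).symm
    · have e1 := hc.covdForm_symm hBc hy ht' (i := i) (j := j) (by simp [hi]) (by simp [hj])
      have e2 := hX i j hi hj
      simp only [hessForm] at e2
      simp only [Dξ, Dζ, e1]
      linarith
  have e1 := hB.eq_zero_of_fr2 hfr a b
  rw [pd_add h.isOpen (h.smooth_meanForm b) (h.compl.smooth_meanForm b) hy,
    pd_add h.isOpen (h.smooth_meanForm a) (h.compl.smooth_meanForm a) hy]
  simp only [Dξ, Dζ, covdForm] at e1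
  -- Without torsion the antisymmetrized covariant derivative is the exterior derivative.
  have e2 : ∀ n, conn G a y n b = conn G b y n a :=
    fun n => h.toIsMetricOn.christoffel_symm hy n a b
  simp only [e2] at e1
  linarith

end IsUmbilicalSplitting

/-! ### Self-dual 2-forms in a frame -/

/-- The real matrix `B` as a complex matrix. -/
def cx (B : Matrix (Fin 4) (Fin 4) ℝ) : Matrix (Fin 4) (Fin 4) ℂ := B.map Complex.ofReal

/-- The components of a complex 2-tensor in a frame. -/
def frC (B : Matrix (Fin 4) (Fin 4) ℝ) (F : Matrix (Fin 4) (Fin 4) ℂ) :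
    Matrix (Fin 4) (Fin 4) ℂ := (cx B).transpose * F * cx B

theorem cx_mul (A B : Matrix (Fin 4) (Fin 4) ℝ) : cx (A * B) = cx A * cx B := by
  ext i j
  simp [cx, Matrix.mul_apply]

theorem cx_transpose (A : Matrix (Fin 4) (Fin 4) ℝ) : cx A.transpose = (cx A).transpose := rfl

theorem cx_one : cx 1 = 1 := by
  ext i j
  simp only [cx, Matrix.map_apply, Matrix.one_apply]
  split_ifs <;> simp

theorem frC_cx (B U : Matrix (Fin 4) (Fin 4) ℝ) (i j : Fin 4) :
    frC B (cx U) i j = ((B.transpose * U * B) i j : ℝ) := by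
  rw [frC, ← cx_transpose, ← cx_mul, ← cx_mul]
  rfl

theorem sum_comm_pairs {ι K : Type*} [Fintype ι] [AddCommMonoid K] (f : ι → ι → ι → ι → K) :
    ∑ m, ∑ n, ∑ k, ∑ l, f m n k l = ∑ k, ∑ l, ∑ m, ∑ n, f m n k l := by
  calc _ = ∑ m, ∑ k, ∑ n, ∑ l, f m n k l := Finset.sum_congr rfl fun m _ => Finset.sum_comm
    _ = ∑ k, ∑ m, ∑ l, ∑ n, f m n k l := by
      rw [Finset.sum_comm]
      exact Finset.sum_congr rfl fun k _ => Finset.sum_congr rfl fun m _ => Finset.sum_comm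
    _ = _ := Finset.sum_congr rfl fun k _ => Finset.sum_comm

theorem frC_apply (B : Matrix (Fin 4) (Fin 4) ℝ) (F : Matrix (Fin 4) (Fin 4) ℂ) (i j : Fin 4) :
    frC B F i j = ∑ a, ∑ b, (B a i : ℂ) * (B b j : ℂ) * F a b := by
  rw [frC, mul_assoc, Matrix.mul_apply]
  refine Finset.sum_congr rfl fun a _ => ?_
  rw [Matrix.mul_apply, Finset.mul_sum]
  refine Finset.sum_congr rfl fun b _ => ?_
  simp only [cx, Matrix.transpose_apply, Matrix.map_apply]
  ring

theorem frC_add (B : Matrix (Fin 4) (Fin 4) ℝ) (F F' : Matrix (Fin 4) (Fin 4) ℂ) :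
    frC B (F + F') = frC B F + frC B F' := by
  simp only [frC, mul_add, add_mul]

theorem frC_smul (B : Matrix (Fin 4) (Fin 4) ℝ) (c : ℂ) (F : Matrix (Fin 4) (Fin 4) ℂ) :
    frC B (c • F) = c • frC B F := by
  simp only [frC, Matrix.mul_smul, Matrix.smul_mul]

theorem frC_transpose (B : Matrix (Fin 4) (Fin 4) ℝ) (F : Matrix (Fin 4) (Fin 4) ℂ) :
    frC B F.transpose = (frC B F).transpose := by
  simp only [frC, Matrix.transpose_mul, Matrix.transpose_transpose, mul_assoc]

theorem frC_antisymm (B : Matrix (Fin 4) (Fin 4) ℝ) {F : Matrix (Fin 4) (Fin 4) ℂ} (hF : F.transpose = -F) (i j : Fin 4) :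
    frC B F j i = -frC B F i j := by
  have h := congrFun (congrFun (frC_transpose B F) i) j
  rw [hF, ← neg_one_smul ℂ, frC_smul] at h
  simpa using h.symm

/-- The action of a real double 2-form on complex 2-forms. -/
def dblApply (g : Matrix (Fin 4) (Fin 4) ℝ) (T : Fin 4 → Fin 4 → Fin 4 → Fin 4 → ℝ)
    (F : Matrix (Fin 4) (Fin 4) ℂ) : Matrix (Fin 4) (Fin 4) ℂ :=
  Matrix.of fun a b => (1 / 2 : ℂ) * ∑ m, ∑ n, (T a b m n : ℂ)
    * ∑ p, ∑ q, ((g⁻¹ m p : ℝ) : ℂ) * ((g⁻¹ n q : ℝ) : ℂ) * F p q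

theorem act_ofReal (g : Matrix (Fin 4) (Fin 4) ℝ) (T : Fin 4 → Fin 4 → Fin 4 → Fin 4 → ℝ)
    (F : Matrix (Fin 4) (Fin 4) ℂ) :
    act g (fun a b c d => (T a b c d : ℂ)) F = dblApply g T F := by
  ext a b
  simp only [act, dblApply, LinearMap.coe_mk, AddHom.coe_mk, Matrix.of_apply, Finset.mul_sum]
  exact Finset.sum_congr rfl fun m _ => Finset.sum_congr rfl fun n _ =>
    Finset.sum_congr rfl fun p _ => Finset.sum_congr rfl fun q _ => by ring

theorem hodge_complex (g : Matrix (Fin 4) (Fin 4) ℝ) (η : FourForm)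
    (F : Matrix (Fin 4) (Fin 4) ℂ) : hodge g η F = dblApply g η F := by
  ext a b
  simp only [hodge, dblApply, Matrix.of_apply, Finset.mul_sum, Complex.real_smul]
  exact Finset.sum_congr rfl fun m _ => Finset.sum_congr rfl fun n _ =>
    Finset.sum_congr rfl fun p _ => Finset.sum_congr rfl fun q _ => by push_cast; ring

theorem cx_hodge (g : Matrix (Fin 4) (Fin 4) ℝ) (η : FourForm) (U : Matrix (Fin 4) (Fin 4) ℝ) :
    cx (hodge (K := ℝ) g η U) = hodge g η (cx U) := by
  ext a b
  simp only [hodge, cx, Matrix.map_apply, Complex.ofReal_sum, Complex.real_smul, smul_eq_mul,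
    Complex.ofReal_mul]

theorem sgn_values : sgn 0 = -1 ∧ sgn 1 = 1 ∧ sgn 2 = 1 ∧ sgn 3 = 1 := ⟨rfl, rfl, rfl, rfl⟩

/-- The sign of the permutation `(i, j, k, l)`, or `0`. -/
def leviCivita (i j k l : Fin 4) : ℝ :=
  (((j : ℕ) : ℝ) - (i : ℕ)) * ((k : ℕ) - (i : ℕ)) * ((l : ℕ) - (i : ℕ)) * ((k : ℕ) - (j : ℕ))
    * ((l : ℕ) - (j : ℕ)) * ((l : ℕ) - (k : ℕ)) / 12

/-- An orthonormal frame with volume `s`. -/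
structure IsOrientedFrame (g B : Matrix (Fin 4) (Fin 4) ℝ) (η : FourForm) (s : ℝ) : Prop where
  orthonormal : B.transpose * g * B = minkowski
  volume : ∀ i j k l, fr4 B η i j k l = s * leviCivita i j k l
  sq : s * s = 1

namespace IsOrientedFrame

variable {g B : Matrix (Fin 4) (Fin 4) ℝ} {η : FourForm} {s : ℝ} (hB : IsOrientedFrame g B η s)
include hB

theorem left_inv : (minkowski * B.transpose * g) * B = 1 := by
  rw [mul_assoc minkowski, mul_assoc, hB.orthonormal, minkowski_sq]

theorem inv_metric : g⁻¹ = B * minkowski * B.transpose :=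
  Matrix.inv_eq_left_inv (by
    rw [mul_assoc, mul_assoc, ← mul_assoc minkowski]
    exact mul_eq_one_comm.1 hB.left_inv)

theorem frC_injective {F F' : Matrix (Fin 4) (Fin 4) ℂ} (h : frC B F = frC B F') : F = F' := by
  have h1 : cx B * cx (minkowski * B.transpose * g) = 1 := by
    rw [← cx_mul, mul_eq_one_comm.1 hB.left_inv, cx_one]
  have h2 : (cx (minkowski * B.transpose * g)).transpose * (cx B).transpose = 1 := by
    rw [← Matrix.transpose_mul, h1, Matrix.transpose_one]
  have h3 : ∀ F, F = (cx (minkowski * B.transpose * g)).transpose * frC B F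
      * cx (minkowski * B.transpose * g) := fun F => by
    rw [frC, ← mul_assoc, ← mul_assoc, h2, one_mul, mul_assoc, h1, mul_one]
  rw [h3 F, h3 F', h]

theorem raise (F : Matrix (Fin 4) (Fin 4) ℂ) (m n : Fin 4) :
    ∑ p, ∑ q, ((g⁻¹ m p : ℝ) : ℂ) * ((g⁻¹ n q : ℝ) : ℂ) * F p q
      = ∑ k, ∑ l, (B m k : ℂ) * (B n l : ℂ) * ((sgn k : ℂ) * (sgn l : ℂ) * frC B F k l) := by
  have h1 : cx g⁻¹ = cx B * cx minkowski * (cx B).transpose := by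
    rw [hB.inv_metric, cx_mul, cx_mul, cx_transpose]
  have h2 : (cx g⁻¹).transpose = cx B * cx minkowski * (cx B).transpose := by
    rw [h1, Matrix.transpose_mul, Matrix.transpose_mul, Matrix.transpose_transpose, mul_assoc,
      ← cx_transpose minkowski, minkowski_eq, Matrix.diagonal_transpose]
  have hm : cx minkowski = Matrix.diagonal (fun k => (sgn k : ℂ)) := by
    rw [minkowski_eq, cx, Matrix.diagonal_map Complex.ofReal_zero]
  have h3 : cx g⁻¹ * F * (cx g⁻¹).transpose
      = cx B * (cx minkowski * frC B F * cx minkowski) * (cx B).transpose := by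
    rw [h2, h1, frC]
    simp only [mul_assoc]
  have h4 := congrFun (congrFun h3 m) n
  have e1 : (cx g⁻¹ * F * (cx g⁻¹).transpose) m n
      = ∑ p, ∑ q, ((g⁻¹ m p : ℝ) : ℂ) * ((g⁻¹ n q : ℝ) : ℂ) * F p q := by
    rw [mul_assoc, Matrix.mul_apply]
    refine Finset.sum_congr rfl fun p _ => ?_
    rw [Matrix.mul_apply, Finset.mul_sum]
    refine Finset.sum_congr rfl fun q _ => ?_
    simp only [cx, Matrix.transpose_apply, Matrix.map_apply]
    ring
  have e2 : (cx B * (cx minkowski * frC B F * cx minkowski) * (cx B).transpose) m n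
      = ∑ k, ∑ l, (B m k : ℂ) * (B n l : ℂ) * ((sgn k : ℂ) * (sgn l : ℂ) * frC B F k l) := by
    rw [mul_assoc, Matrix.mul_apply]
    refine Finset.sum_congr rfl fun p _ => ?_
    rw [Matrix.mul_apply, Finset.mul_sum]
    refine Finset.sum_congr rfl fun q _ => ?_
    rw [hm, Matrix.mul_diagonal, Matrix.diagonal_mul]
    simp only [cx, Matrix.transpose_apply, Matrix.map_apply]
    ring
  rw [← e1, h4, e2]

theorem frC_dblApply (T : Fin 4 → Fin 4 → Fin 4 → Fin 4 → ℝ) (F : Matrix (Fin 4) (Fin 4) ℂ)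
    (i j : Fin 4) :
    frC B (dblApply g T F) i j = (1 / 2 : ℂ) * ∑ k, ∑ l, (fr4 B T i j k l : ℂ)
      * ((sgn k : ℂ) * (sgn l : ℂ) * frC B F k l) := by
  have h1 : ∀ a b, dblApply g T F a b = (1 / 2 : ℂ) * ∑ k, ∑ l, (fr2 B (T a b) k l : ℂ)
      * ((sgn k : ℂ) * (sgn l : ℂ) * frC B F k l) := fun a b => by
    simp only [dblApply, Matrix.of_apply, hB.raise, fr2, fr1, ct, Complex.ofReal_sum,
      Complex.ofReal_mul, Finset.mul_sum, Finset.sum_mul]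
    rw [sum_comm_pairs]
    exact Finset.sum_congr rfl fun m _ => Finset.sum_congr rfl fun n _ =>
      Finset.sum_congr rfl fun p _ => Finset.sum_congr rfl fun q _ => by ring
  obtain ⟨T', hT'⟩ : ∃ T' : Fin 4 → Fin 4 → Fin 4 → Fin 4 → ℝ,
    T' = fun k l a b => fr2 B (T a b) k l := ⟨_, rfl⟩
  have h2 : ∀ k l, fr4 B T i j k l = fr2 B (T' k l) i j := fun k l => by rw [hT']; rfl
  have h3 : ∀ a b k l, fr2 B (T a b) k l = T' k l a b := fun a b k l => by rw [hT']
  rw [frC_apply]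
  simp only [h1, h2, h3]
  simp only [fr2, fr1, ct, Complex.ofReal_sum, Complex.ofReal_mul, Finset.mul_sum,
    Finset.sum_mul]
  rw [sum_comm_pairs]
  exact Finset.sum_congr rfl fun m _ => Finset.sum_congr rfl fun n _ =>
    Finset.sum_congr rfl fun p _ => Finset.sum_congr rfl fun q _ => by ring

theorem antisymm_iff {F : Matrix (Fin 4) (Fin 4) ℂ} :
    F.transpose = -F ↔ ∀ i j, frC B F j i = -frC B F i j := by
  refine ⟨frC_antisymm B, fun h => hB.frC_injective ?_⟩
  rw [frC_transpose, ← neg_one_smul ℂ, frC_smul]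
  ext i j
  simp [h i j]

theorem frC_hodge (F : Matrix (Fin 4) (Fin 4) ℂ) (i j : Fin 4) :
    frC B (hodge g η F) i j = (1 / 2 : ℂ) * ∑ k, ∑ l, ((s : ℂ) * (leviCivita i j k l : ℂ))
      * ((sgn k : ℂ) * (sgn l : ℂ) * frC B F k l) := by
  simp only [hodge_complex, hB.frC_dblApply, hB.volume, Complex.ofReal_mul]

theorem hodge_antisymm (F : Matrix (Fin 4) (Fin 4) ℂ) :
    (hodge g η F).transpose = -hodge g η F := by
  refine hB.antisymm_iff.2 fun i j => ?_
  have h : ∀ k l, leviCivita j i k l = -leviCivita i j k l := fun k l => by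
    simp only [leviCivita]; ring
  simp only [hB.frC_hodge, h, Complex.ofReal_neg, mul_neg, neg_mul, Finset.sum_neg_distrib]

theorem ext_antisymm {F F' : Matrix (Fin 4) (Fin 4) ℂ} (hF : F.transpose = -F)
    (hF' : F'.transpose = -F') (h1 : frC B F 0 1 = frC B F' 0 1)
    (h2 : frC B F 0 2 = frC B F' 0 2) (h3 : frC B F 0 3 = frC B F' 0 3)
    (h4 : frC B F 2 3 = frC B F' 2 3) (h5 : frC B F 3 1 = frC B F' 3 1)
    (h6 : frC B F 1 2 = frC B F' 1 2) : F = F' := by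
  refine hB.frC_injective ?_
  have hf := frC_antisymm B hF
  have hf' := frC_antisymm B hF'
  ext i j
  have hd : ∀ k, frC B F k k = frC B F' k k := fun k => by
    linear_combination (1 / 2 : ℂ) * hf k k - (1 / 2 : ℂ) * hf' k k
  fin_cases i <;> fin_cases j <;>
    first
    | exact hd _
    | assumption
    | (refine neg_injective ?_
       refine (hf _ _).symm.trans (Eq.trans ?_ (hf' _ _))
       assumption)

theorem frC_hodge_eq {F : Matrix (Fin 4) (Fin 4) ℂ} (hF : F.transpose = -F) :
    frC B (hodge g η F) 0 1 = s * frC B F 2 3 ∧ frC B (hodge g η F) 0 2 = s * frC B F 3 1 ∧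
    frC B (hodge g η F) 0 3 = s * frC B F 1 2 ∧ frC B (hodge g η F) 2 3 = -(s * frC B F 0 1) ∧
    frC B (hodge g η F) 3 1 = -(s * frC B F 0 2) ∧
    frC B (hodge g η F) 1 2 = -(s * frC B F 0 3) := by
  have hf := frC_antisymm B hF
  have h10 := hf 0 1
  have h20 := hf 0 2
  have h30 := hf 0 3
  have h21 := hf 1 2
  have h31 := hf 1 3
  have h32 := hf 2 3
  obtain ⟨s0, s1, s2, s3⟩ := sgn_values
  refine ⟨?_, ?_, ?_, ?_, ?_, ?_⟩ <;>
  · simp only [hB.frC_hodge, Fin.sum_univ_four, leviCivita, s0, s1, s2, s3, h10, h20, h30, h21, h31, h32]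
    norm_num
    ring

theorem hodge_hodge {F : Matrix (Fin 4) (Fin 4) ℂ} (hF : F.transpose = -F) :
    hodge g η (hodge g η F) = -F := by
  have hs : (s : ℂ) * s = 1 := by exact_mod_cast hB.sq
  obtain ⟨a1, a2, a3, a4, a5, a6⟩ := hB.frC_hodge_eq hF
  obtain ⟨b1, b2, b3, b4, b5, b6⟩ := hB.frC_hodge_eq (hB.hodge_antisymm F)
  have hn : ∀ i j, frC B (-F) i j = -frC B F i j := fun i j => by
    rw [← neg_one_smul ℂ, frC_smul]; simp
  refine hB.ext_antisymm (hB.hodge_antisymm _) (by rw [Matrix.transpose_neg, hF]) ?_ ?_ ?_ ?_ ?_ ?_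
  · rw [hn, b1, a4]; linear_combination (-frC B F 0 1) * hs
  · rw [hn, b2, a5]; linear_combination (-frC B F 0 2) * hs
  · rw [hn, b3, a6]; linear_combination (-frC B F 0 3) * hs
  · rw [hn, b4, a1]; linear_combination (-frC B F 2 3) * hs
  · rw [hn, b5, a2]; linear_combination (-frC B F 3 1) * hs
  · rw [hn, b6, a3]; linear_combination (-frC B F 1 2) * hs

/-- The star exchanges the components 0k with the dual ones up to the orientation sign `s`. Since s²
= 1 and i² = -1, three of the six equations imply the others, and a self-dual form is determined by
its components 0k. -/
theorem mem_sdBivectors {F : Matrix (Fin 4) (Fin 4) ℂ} :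
    F ∈ sdBivectors g η ↔ F.transpose = -F ∧ frC B F 2 3 = Complex.I * s * frC B F 0 1 ∧
      frC B F 3 1 = Complex.I * s * frC B F 0 2 ∧ frC B F 1 2 = Complex.I * s * frC B F 0 3 := by
  have hs : (s : ℂ) * s = 1 := by exact_mod_cast hB.sq
  have hI : Complex.I * Complex.I = -1 := Complex.I_mul_I
  have hc : ∀ i j, frC B (Complex.I • F) i j = Complex.I * frC B F i j := fun i j => by
    rw [frC_smul]; simp
  constructor
  · rintro ⟨hF, h⟩
    obtain ⟨a1, a2, a3, a4, a5, a6⟩ := hB.frC_hodge_eq hF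
    rw [h, hc] at a1 a2 a3
    refine ⟨hF, ?_, ?_, ?_⟩
    · linear_combination (-frC B F 2 3) * hs - s * a1
    · linear_combination (-frC B F 3 1) * hs - s * a2
    · linear_combination (-frC B F 1 2) * hs - s * a3
  · rintro ⟨hF, h1, h2, h3⟩
    obtain ⟨a1, a2, a3, a4, a5, a6⟩ := hB.frC_hodge_eq hF
    refine ⟨hF, hB.ext_antisymm (hB.hodge_antisymm F)
      (by rw [Matrix.transpose_smul, hF, smul_neg]) ?_ ?_ ?_ ?_ ?_ ?_⟩
    · rw [a1, hc, h1]; linear_combination (Complex.I * frC B F 0 1) * hs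
    · rw [a2, hc, h2]; linear_combination (Complex.I * frC B F 0 2) * hs
    · rw [a3, hc, h3]; linear_combination (Complex.I * frC B F 0 3) * hs
    · rw [a4, hc, h1]; linear_combination (-s * frC B F 0 1) * hI
    · rw [a5, hc, h2]; linear_combination (-s * frC B F 0 2) * hI
    · rw [a6, hc, h3]; linear_combination (-s * frC B F 0 3) * hI

end IsOrientedFrame

/-! ### The action of the self-dual Weyl tensor in a frame -/

/-- The action is a linear combination of the slices of `Q` with fixed last indices. Applying a
second action termwise gives the composition law `act_dcomp`. -/
theorem act_eq_sum (g : Matrix (Fin 4) (Fin 4) ℝ) (Q : DoubleForm)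
    (F : Matrix (Fin 4) (Fin 4) ℂ) :
    act g Q F = ∑ m, ∑ n, ∑ p, ∑ q, ((1 / 2 : ℂ) * (g⁻¹ m p : ℝ) * (g⁻¹ n q : ℝ) * F p q) •
      Matrix.of fun a b => Q a b m n := by
  ext a b
  simp only [act, LinearMap.coe_mk, AddHom.coe_mk, Matrix.of_apply, Matrix.sum_apply,
    Matrix.smul_apply, smul_eq_mul]
  exact Finset.sum_congr rfl fun m _ => Finset.sum_congr rfl fun n _ =>
    Finset.sum_congr rfl fun p _ => Finset.sum_congr rfl fun q _ => by ring

theorem act_dcomp (g : Matrix (Fin 4) (Fin 4) ℝ) (P Q : DoubleForm)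
    (F : Matrix (Fin 4) (Fin 4) ℂ) : act g (dcomp g P Q) F = act g P (act g Q F) := by
  rw [act_eq_sum g Q F, act_eq_sum g (dcomp g P Q) F]
  simp only [map_sum, map_smul]
  rfl

theorem fr4_mul (B A C : Matrix (Fin 4) (Fin 4) ℝ) (i j k l : Fin 4) :
    fr4 B (fun a b c d => A a c * C b d) i j k l = fr2 B A i k * fr2 B C j l := by
  simp only [fr4, fr3, fr2, fr1, ct_const_mul, ct_mul_const]

theorem fr4_mul' (B A C : Matrix (Fin 4) (Fin 4) ℝ) (i j k l : Fin 4) :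
    fr4 B (fun a b c d => A a d * C b c) i j k l = fr2 B A i l * fr2 B C j k := by
  simp only [fr4, fr3, fr2, fr1, ct_const_mul, ct_mul_const]

theorem fr4_add (B : Matrix (Fin 4) (Fin 4) ℝ) (T T' : Fin 4 → Fin 4 → Fin 4 → Fin 4 → ℝ)
    (i j k l : Fin 4) : fr4 B (fun a b c d => T a b c d + T' a b c d) i j k l
      = fr4 B T i j k l + fr4 B T' i j k l := by
  simp only [fr4, fr3, fr2, fr1, ct_add]

theorem fr4_sub (B : Matrix (Fin 4) (Fin 4) ℝ) (T T' : Fin 4 → Fin 4 → Fin 4 → Fin 4 → ℝ)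
    (i j k l : Fin 4) : fr4 B (fun a b c d => T a b c d - T' a b c d) i j k l
      = fr4 B T i j k l - fr4 B T' i j k l := by
  simp only [fr4, fr3, fr2, fr1, ct_sub]

theorem fr4_const_mul (B : Matrix (Fin 4) (Fin 4) ℝ) (r : ℝ)
    (T : Fin 4 → Fin 4 → Fin 4 → Fin 4 → ℝ) (i j k l : Fin 4) :
    fr4 B (fun a b c d => r * T a b c d) i j k l = r * fr4 B T i j k l := by
  simp only [fr4, fr3, fr2, fr1, ct_const_mul]

theorem fr4_swap_right (B : Matrix (Fin 4) (Fin 4) ℝ) (T : Fin 4 → Fin 4 → Fin 4 → Fin 4 → ℝ)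
    (i j k l : Fin 4) : fr4 B (fun a b c d => T a b d c) i j k l = fr4 B T i j l k := by
  change fr2 B (fun a b => fr2 B (fun c d => T a b d c) k l) i j = _
  rw [funext fun a => funext fun b => fr2_swap B (T a b) k l]
  rfl

theorem fr4_swap_left (B : Matrix (Fin 4) (Fin 4) ℝ) (T : Fin 4 → Fin 4 → Fin 4 → Fin 4 → ℝ)
    (i j k l : Fin 4) : fr4 B (fun a b c d => T b a c d) i j k l = fr4 B T j i k l :=
  fr2_swap B (fun a b => fr2 B (T a b) k l) i j

theorem fr4_pair (B : Matrix (Fin 4) (Fin 4) ℝ) (T : Fin 4 → Fin 4 → Fin 4 → Fin 4 → ℝ)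
    (i j k l : Fin 4) : fr4 B (fun a b c d => T c d a b) i j k l = fr4 B T k l i j := by
  simp only [fr4, fr3, fr2, fr1, ct, Finset.mul_sum]
  rw [sum_comm_pairs]
  exact Finset.sum_congr rfl fun m _ => Finset.sum_congr rfl fun n _ =>
    Finset.sum_congr rfl fun p _ => Finset.sum_congr rfl fun q _ => by ring

/-- The first index of the 2-form dual to `b⁰ ∧ b^k`. -/
def dualL : Fin 3 → Fin 4 := ![2, 3, 1]

/-- The second index of the 2-form dual to `b⁰ ∧ b^k`. -/
def dualR : Fin 3 → Fin 4 := ![3, 1, 2]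

/-- The matrix of the self-dual part of a double 2-form. -/
def sdBlock (s : ℝ) (w : Fin 4 → Fin 4 → Fin 4 → Fin 4 → ℝ) : Matrix (Fin 3) (Fin 3) ℂ :=
  fun k j => (1 / 2 : ℂ) * ((w (dualL k) (dualR k) (dualL j) (dualR j) - w 0 k.succ 0 j.succ : ℝ)
    + Complex.I * s * (w 0 k.succ (dualL j) (dualR j) + w (dualL k) (dualR k) 0 j.succ : ℝ))

namespace IsOrientedFrame

variable {g B : Matrix (Fin 4) (Fin 4) ℝ} {η : FourForm} {s : ℝ} (hB : IsOrientedFrame g B η s)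
include hB

theorem fr2_metric (i j : Fin 4) : fr2 B g i j = if i = j then sgn i else 0 := by
  rw [fr2_eq, hB.orthonormal, minkowski_eq, Matrix.diagonal_apply]

/-- The first term of the bivector metric acts as the identity on antisymmetric tensors and the
volume term acts as the star. The result is the projection onto self-dual forms. -/
theorem act_sdMetric {F : Matrix (Fin 4) (Fin 4) ℂ} (hF : F.transpose = -F) :
    act g (sdMetric g η) F = (1 / 2 : ℂ) • (F - Complex.I • hodge g η F) := by
  have h1 : dblApply g (fun a b c d => g a c * g b d - g a d * g b c) F = F := by
    refine hB.frC_injective ?_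
    ext i j
    rw [hB.frC_dblApply]
    simp only [fr4_sub, fr4_mul, fr4_mul', hB.fr2_metric]
    have hf := frC_antisymm B hF i j
    have hs : ∀ i, (sgn i : ℂ) * sgn i = 1 := fun i => by
      fin_cases i <;> norm_num [sgn]
    simp only [Complex.ofReal_sub, Complex.ofReal_mul, apply_ite Complex.ofReal,
      Complex.ofReal_zero, sub_mul, Finset.sum_sub_distrib, Finset.sum_ite_irrel,
      Finset.sum_const_zero, ite_mul, mul_ite, zero_mul, mul_zero,
      Finset.sum_ite_eq, Finset.mem_univ, if_true]
    linear_combination (1 / 2 : ℂ) * (frC B F i j * (sgn j * sgn j) - frC B F j i * (sgn j * sgn j)) * hs i + (1 / 2 : ℂ) * (frC B F i j - frC B F j i) * hs j - (1 / 2 : ℂ) * hf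
  have h2 : act g (sdMetric g η) F = (1 / 2 : ℂ) •
      (act g (fun a b c d => ((g a c * g b d - g a d * g b c : ℝ) : ℂ)) F
        - Complex.I • act g (fun a b c d => (η a b c d : ℂ)) F) := by
    simp only [act_eq_sum, Finset.smul_sum, ← Finset.sum_sub_distrib, smul_sub]
    refine Finset.sum_congr rfl fun m _ => Finset.sum_congr rfl fun n _ =>
      Finset.sum_congr rfl fun p _ => Finset.sum_congr rfl fun q _ => ?_
    ext a b
    simp only [Matrix.sub_apply, Matrix.smul_apply, smul_eq_mul, sdMetric, Matrix.of_apply]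
    ring
  rw [h2, act_ofReal g (fun a b c d => g a c * g b d - g a d * g b c), h1, act_ofReal,
    hodge_complex]

theorem act_sdPart {W : Fin 4 → Fin 4 → Fin 4 → Fin 4 → ℝ}
    (hW : ∀ a b c d, W b a c d = -W a b c d) {F : Matrix (Fin 4) (Fin 4) ℂ}
    (hF : F ∈ sdBivectors g η) : (dblApply g W F).transpose = -dblApply g W F ∧
    act g (sdPart g η W) F
      = (1 / 2 : ℂ) • (dblApply g W F - Complex.I • hodge g η (dblApply g W F)) := by
  have hZ : (dblApply g W F).transpose = -dblApply g W F := by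
    ext a b
    simp only [Matrix.transpose_apply, Matrix.neg_apply, dblApply, Matrix.of_apply, hW a b,
      Complex.ofReal_neg, neg_mul, Finset.sum_neg_distrib, mul_neg]
  refine ⟨hZ, ?_⟩
  have h : act g (sdMetric g η) F = F := by
    rw [hB.act_sdMetric hF.1, hF.2, smul_smul, Complex.I_mul_I, neg_one_smul, sub_neg_eq_add,
      ← two_smul ℂ F, smul_smul]
    norm_num
  rw [sdPart, act_dcomp, act_dcomp, h, act_ofReal, hB.act_sdMetric hZ]

theorem act_sdPart_mem {W : Fin 4 → Fin 4 → Fin 4 → Fin 4 → ℝ}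
    (hW : ∀ a b c d, W b a c d = -W a b c d) {F : Matrix (Fin 4) (Fin 4) ℂ}
    (hF : F ∈ sdBivectors g η) : act g (sdPart g η W) F ∈ sdBivectors g η := by
  obtain ⟨hZ, h⟩ := hB.act_sdPart hW hF
  have hsub : ∀ A C : Matrix (Fin 4) (Fin 4) ℂ,
      hodge g η (A - Complex.I • C) = hodge g η A - Complex.I • hodge g η C := fun A C => by
    simp only [hodge_complex, ← act_ofReal, map_sub, map_smul]
  rw [h]
  refine Submodule.smul_mem _ _ ⟨?_, ?_⟩
  · rw [Matrix.transpose_sub, Matrix.transpose_smul, hZ, hB.hodge_antisymm]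
    simp only [smul_neg, neg_sub, sub_neg_eq_add]
    abel
  · rw [hsub, hB.hodge_hodge hZ, smul_sub, smul_smul, Complex.I_mul_I, neg_one_smul, smul_neg]
    abel

theorem sd_ext {F F' : Matrix (Fin 4) (Fin 4) ℂ} (hF : F ∈ sdBivectors g η)
    (hF' : F' ∈ sdBivectors g η) (h : ∀ k : Fin 3, frC B F 0 k.succ = frC B F' 0 k.succ) :
    F = F' := by
  obtain ⟨h0, h1, h2, h3⟩ := hB.mem_sdBivectors.1 hF
  obtain ⟨h0', h1', h2', h3'⟩ := hB.mem_sdBivectors.1 hF'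
  have a1 : frC B F 0 1 = frC B F' 0 1 := h 0
  have a2 : frC B F 0 2 = frC B F' 0 2 := h 1
  have a3 : frC B F 0 3 = frC B F' 0 3 := h 2
  exact hB.ext_antisymm h0 h0' a1 a2 a3 (by rw [h1, h1', a1]) (by rw [h2, h2', a2])
    (by rw [h3, h3', a3])

/-- The double form is contracted with all six components of F, and self-duality expresses three of
them by the components 0k. The projection ½(1 - i*) then combines the rows 0k with their duals,
which gives the four terms of `sdBlock`. -/
theorem frC_act_sdPart {W : Fin 4 → Fin 4 → Fin 4 → Fin 4 → ℝ}
    (hW : ∀ a b c d, W b a c d = -W a b c d) (hW' : ∀ a b c d, W a b d c = -W a b c d)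
    {F : Matrix (Fin 4) (Fin 4) ℂ} (hF : F ∈ sdBivectors g η) (k : Fin 3) :
    frC B (act g (sdPart g η W) F) 0 k.succ
      = ∑ j, sdBlock s (fr4 B W) k j * frC B F 0 j.succ := by
  obtain ⟨hZ, h⟩ := hB.act_sdPart hW hF
  obtain ⟨h0, h1, h2, h3⟩ := hB.mem_sdBivectors.1 hF
  have hf := frC_antisymm B h0
  have hd : ∀ i, frC B F i i = 0 := fun i => by linear_combination (1 / 2 : ℂ) * hf i i
  have hw : ∀ i j k l, fr4 B W i j l k = -fr4 B W i j k l := fun i j k l => by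
    rw [← fr4_swap_right, funext fun a => funext fun b => funext fun c => funext fun d =>
      (hW' a b c d).trans (neg_one_mul _).symm, fr4_const_mul, neg_one_mul]
  have hz : ∀ i j, frC B (dblApply g W F) i j = -fr4 B W i j 0 1 * frC B F 0 1
      - fr4 B W i j 0 2 * frC B F 0 2 - fr4 B W i j 0 3 * frC B F 0 3
      + Complex.I * s * (fr4 B W i j 2 3 * frC B F 0 1 + fr4 B W i j 3 1 * frC B F 0 2
        + fr4 B W i j 1 2 * frC B F 0 3) := fun i j => by
    obtain ⟨s0, s1, s2, s3⟩ := sgn_values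
    rw [hB.frC_dblApply]
    simp only [Fin.sum_univ_four, s0, s1, s2, s3, hd, hf 0 1, hf 0 2, hf 0 3, hf 1 2, hf 2 3,
      hf 3 1, hw i j 0 1, hw i j 0 2, hw i j 0 3, hw i j 1 2, hw i j 2 3, hw i j 3 1, h1, h2, h3]
    push_cast
    ring
  obtain ⟨a1, a2, a3, -, -, -⟩ := hB.frC_hodge_eq hZ
  have hs : (s : ℂ) * s = 1 := by exact_mod_cast hB.sq
  have hI : Complex.I * Complex.I = -1 := Complex.I_mul_I
  have hr : ∀ i j, frC B (act g (sdPart g η W) F) i j = (1 / 2 : ℂ) *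
      (frC B (dblApply g W F) i j - Complex.I * frC B (hodge g η (dblApply g W F)) i j) :=
    fun i j => by
      rw [h, frC_smul, sub_eq_add_neg, frC_add, ← neg_smul, frC_smul]
      simp only [Matrix.smul_apply, Matrix.add_apply, smul_eq_mul]
      ring
  rw [hr]
  have e1 : Fin.succ (0 : Fin 3) = 1 := rfl
  have e2 : Fin.succ (1 : Fin 3) = 2 := rfl
  have e3 : Fin.succ (2 : Fin 3) = 3 := rfl
  have l1 : dualL 0 = 2 := rfl
  have l2 : dualL 1 = 3 := rfl
  have l3 : dualL 2 = 1 := rfl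
  have r1 : dualR 0 = 3 := rfl
  have r2 : dualR 1 = 1 := rfl
  have r3 : dualR 2 = 2 := rfl
  -- The only place where the squares of `s` and of the imaginary unit enter: the star of the
  -- imaginary part returns to the real part with sign +1.
  have key : ∀ A C D E : ℂ, -A + Complex.I * s * C - Complex.I * (s * (-D + Complex.I * s * E))
      = -A + Complex.I * s * (C + D) + E := fun A C D E => by
    linear_combination (-E * Complex.I * Complex.I) * hs - E * hI
  simp only [Fin.sum_univ_three, sdBlock, e1, e2, e3, l1, l2, l3, r1, r2, r3]
  match k with
  | 0 =>
    rw [e1, a1, hz, hz]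
    simp only [l1, r1]
    push_cast
    linear_combination (1 / 2 : ℂ) * key (fr4 B W 0 1 0 1 * frC B F 0 1
      + fr4 B W 0 1 0 2 * frC B F 0 2 + fr4 B W 0 1 0 3 * frC B F 0 3)
      (fr4 B W 0 1 2 3 * frC B F 0 1 + fr4 B W 0 1 3 1 * frC B F 0 2
        + fr4 B W 0 1 1 2 * frC B F 0 3) (fr4 B W 2 3 0 1 * frC B F 0 1
      + fr4 B W 2 3 0 2 * frC B F 0 2 + fr4 B W 2 3 0 3 * frC B F 0 3)
      (fr4 B W 2 3 2 3 * frC B F 0 1 + fr4 B W 2 3 3 1 * frC B F 0 2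
        + fr4 B W 2 3 1 2 * frC B F 0 3)
  | 1 =>
    rw [e2, a2, hz, hz]
    simp only [l2, r2]
    push_cast
    linear_combination (1 / 2 : ℂ) * key (fr4 B W 0 2 0 1 * frC B F 0 1
      + fr4 B W 0 2 0 2 * frC B F 0 2 + fr4 B W 0 2 0 3 * frC B F 0 3)
      (fr4 B W 0 2 2 3 * frC B F 0 1 + fr4 B W 0 2 3 1 * frC B F 0 2
        + fr4 B W 0 2 1 2 * frC B F 0 3) (fr4 B W 3 1 0 1 * frC B F 0 1
      + fr4 B W 3 1 0 2 * frC B F 0 2 + fr4 B W 3 1 0 3 * frC B F 0 3)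
      (fr4 B W 3 1 2 3 * frC B F 0 1 + fr4 B W 3 1 3 1 * frC B F 0 2
        + fr4 B W 3 1 1 2 * frC B F 0 3)
  | 2 =>
    rw [e3, a3, hz, hz]
    simp only [l3, r3]
    push_cast
    linear_combination (1 / 2 : ℂ) * key (fr4 B W 0 3 0 1 * frC B F 0 1
      + fr4 B W 0 3 0 2 * frC B F 0 2 + fr4 B W 0 3 0 3 * frC B F 0 3)
      (fr4 B W 0 3 2 3 * frC B F 0 1 + fr4 B W 0 3 3 1 * frC B F 0 2
        + fr4 B W 0 3 1 2 * frC B F 0 3) (fr4 B W 1 2 0 1 * frC B F 0 1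
      + fr4 B W 1 2 0 2 * frC B F 0 2 + fr4 B W 1 2 0 3 * frC B F 0 3)
      (fr4 B W 1 2 2 3 * frC B F 0 1 + fr4 B W 1 2 3 1 * frC B F 0 2
        + fr4 B W 1 2 1 2 * frC B F 0 3)

theorem mem_sdEigenspace {W : Fin 4 → Fin 4 → Fin 4 → Fin 4 → ℝ}
    (hW : ∀ a b c d, W b a c d = -W a b c d) (hW' : ∀ a b c d, W a b d c = -W a b c d)
    {F : Matrix (Fin 4) (Fin 4) ℂ} {ρ : ℂ} :
    F ∈ sdEigenspace g η (sdPart g η W) ρ ↔ F ∈ sdBivectors g η ∧ ∀ k : Fin 3,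
      ∑ j, sdBlock s (fr4 B W) k j * frC B F 0 j.succ = ρ * frC B F 0 k.succ := by
  rw [sdEigenspace, Submodule.mem_inf, Module.End.mem_eigenspace_iff]
  refine and_congr_right fun hF => ?_
  have hρ : ∀ k : Fin 3, frC B (ρ • F) 0 k.succ = ρ * frC B F 0 k.succ := fun k => by
    rw [frC_smul]; rfl
  refine ⟨fun h k => ?_, fun h => hB.sd_ext (hB.act_sdPart_mem hW hF)
    (Submodule.smul_mem _ _ hF) fun k => ?_⟩
  · rw [← hB.frC_act_sdPart hW hW' hF, h, hρ]
  · rw [hB.frC_act_sdPart hW hW' hF, h, hρ]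

end IsOrientedFrame

/-! ### Double 2-forms with the mixed components of an umbilical splitting -/

/-- A double 2-form with the symmetries of the curvature tensor, whose mixed components are those
of an umbilical splitting. -/
structure HasMixedForm (w : Fin 4 → Fin 4 → Fin 4 → Fin 4 → ℝ) (X Z : Fin 4 → Fin 4 → ℝ) :
    Prop where
  left : ∀ l k i j, w k l i j = -w l k i j
  right : ∀ l k i j, w l k j i = -w l k i j
  pair : ∀ l k i j, w i j l k = w l k i j
  mixed : ∀ l k i j, tl i = 1 → tl j = 0 → w l k i j
    = (if l = i then sgn l else 0) * X k j - (if k = i then sgn k else 0) * X l j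
      + (if k = j then sgn k else 0) * Z l i - (if l = j then sgn l else 0) * Z k i

theorem tl_values : tl 0 = 1 ∧ tl 1 = 1 ∧ tl 2 = 0 ∧ tl 3 = 0 := ⟨rfl, rfl, rfl, rfl⟩

theorem tl_eq_one_iff (i : Fin 4) : tl i = 1 ↔ i = 0 ∨ i = 1 := by
  fin_cases i <;> simp [tl]

theorem tl_eq_zero_iff (i : Fin 4) : tl i = 0 ↔ i = 2 ∨ i = 3 := by
  fin_cases i <;> simp [tl]

namespace HasMixedForm

variable {w : Fin 4 → Fin 4 → Fin 4 → Fin 4 → ℝ} {X Z : Fin 4 → Fin 4 → ℝ}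
  (h : HasMixedForm w X Z)
include h

theorem components : (∀ l k, w l k 0 2 = (if l = 0 then -1 else 0) * X k 2
      - (if k = 0 then -1 else 0) * X l 2 + (if k = 2 then 1 else 0) * Z l 0
      - (if l = 2 then 1 else 0) * Z k 0) ∧
    (∀ l k, w l k 0 3 = (if l = 0 then -1 else 0) * X k 3
      - (if k = 0 then -1 else 0) * X l 3 + (if k = 3 then 1 else 0) * Z l 0
      - (if l = 3 then 1 else 0) * Z k 0) ∧
    (∀ l k, w l k 1 2 = (if l = 1 then 1 else 0) * X k 2
      - (if k = 1 then 1 else 0) * X l 2 + (if k = 2 then 1 else 0) * Z l 1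
      - (if l = 2 then 1 else 0) * Z k 1) ∧
    (∀ l k, w l k 1 3 = (if l = 1 then 1 else 0) * X k 3
      - (if k = 1 then 1 else 0) * X l 3 + (if k = 3 then 1 else 0) * Z l 1
      - (if l = 3 then 1 else 0) * Z k 1) := by
  obtain ⟨t0, t1, t2, t3⟩ := tl_values
  obtain ⟨s0, s1, s2, s3⟩ := sgn_values
  have e : ∀ (l i : Fin 4) (r : ℝ), sgn i = r →
      (if l = i then sgn l else 0) = if l = i then r else 0 := fun l i r hr => by
    split_ifs with hl
    · rw [hl, hr]
    · rfl
  refine ⟨fun l k => ?_, fun l k => ?_, fun l k => ?_, fun l k => ?_⟩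
  · rw [h.mixed l k 0 2 t0 t2, e l _ _ s0, e k _ _ s0, e l _ _ s2, e k _ _ s2]
  · rw [h.mixed l k 0 3 t0 t3, e l _ _ s0, e k _ _ s0, e l _ _ s3, e k _ _ s3]
  · rw [h.mixed l k 1 2 t1 t2, e l _ _ s1, e k _ _ s1, e l _ _ s2, e k _ _ s2]
  · rw [h.mixed l k 1 3 t1 t3, e l _ _ s1, e k _ _ s1, e l _ _ s3, e k _ _ s3]

/-- Pair symmetry compares two mixed components to which the formula applies on both sides, such as
0203 and 0302. -/
theorem symm_values : X 2 3 = X 3 2 ∧ Z 0 1 = Z 1 0 := by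
  obtain ⟨c02, c03, c12, c13⟩ := h.components
  have e1 := h.pair 0 2 0 3
  have e2 := h.pair 0 2 1 2
  rw [c02, c03] at e1
  rw [c02, c12] at e2
  simp +decide only [if_true, if_false] at e1 e2
  exact ⟨by linarith, by linarith⟩

theorem symm_left {i j : Fin 4} (hi : tl i = 0) (hj : tl j = 0) : X i j = X j i := by
  rcases (tl_eq_zero_iff i).1 hi with rfl | rfl <;> rcases (tl_eq_zero_iff j).1 hj with rfl | rfl
  exacts [rfl, h.symm_values.1, h.symm_values.1.symm, rfl]

theorem symm_right {i j : Fin 4} (hi : tl i = 1) (hj : tl j = 1) : Z i j = Z j i := by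
  rcases (tl_eq_one_iff i).1 hi with rfl | rfl <;> rcases (tl_eq_one_iff j).1 hj with rfl | rfl
  exacts [rfl, h.symm_values.2, h.symm_values.2.symm, rfl]

/-- The self-dual block of such a double 2-form. -/
theorem sdBlock_values (s : ℝ) :
    (∃ q : ℝ, sdBlock s w 1 1 = q ∧ sdBlock s w 2 2 = q) ∧ sdBlock s w 1 2 = 0 ∧
    sdBlock s w 2 1 = 0 ∧ sdBlock s w 1 0 = sdBlock s w 0 1 ∧ sdBlock s w 2 0 = sdBlock s w 0 2 ∧
    sdBlock s w 0 1 = (1 / 2 : ℂ) * ((X 1 2 - Z 2 1 : ℝ) + Complex.I * s * (X 0 3 - Z 3 0 : ℝ)) ∧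
    sdBlock s w 0 2 = (1 / 2 : ℂ) * ((X 1 3 - Z 3 1 : ℝ)
      + Complex.I * s * (Z 2 0 - X 0 2 : ℝ)) := by
  obtain ⟨c02, c03, c12, c13⟩ := h.components
  obtain ⟨hX, hZ⟩ := h.symm_values
  have r31 : ∀ l k, w l k 3 1 = -w l k 1 3 := fun l k => h.right l k 1 3
  have p : ∀ l k, sdBlock s w l k = sdBlock s w k l := fun l k => by
    simp only [sdBlock, h.pair (dualL k) (dualR k), h.pair 0 k.succ]
    rw [add_comm (w (dualL k) (dualR k) 0 l.succ)]
  have e1 : Fin.succ (0 : Fin 3) = 1 := rfl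
  have e2 : Fin.succ (1 : Fin 3) = 2 := rfl
  have e3 : Fin.succ (2 : Fin 3) = 3 := rfl
  have l1 : dualL 0 = 2 := rfl
  have l2 : dualL 1 = 3 := rfl
  have l3 : dualL 2 = 1 := rfl
  have r1 : dualR 0 = 3 := rfl
  have r2 : dualR 1 = 1 := rfl
  have r3 : dualR 2 = 2 := rfl
  -- The real part cancels by the symmetry of Z on V together with that of X on H, and so does the
  -- imaginary part; the components involved are all mixed.
  have b12 : sdBlock s w 1 2 = 0 := by
    simp only [sdBlock, e2, e3, l2, l3, r2, r3, c12, c03]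
    simp +decide only [if_true, if_false, hX, hZ]
    push_cast
    ring
  -- The common diagonal entry is half the sum of the trace of X over H and the trace of Z over V.
  -- The minus sign comes from the time-like vector, and the value is real because the imaginary
  -- contributions cancel.
  refine ⟨⟨(X 2 2 + X 3 3 + Z 1 1 - Z 0 0) / 2, ?_, ?_⟩, b12, p 2 1 ▸ b12, p 1 0, p 2 0, ?_, ?_⟩
  all_goals
    simp only [sdBlock, e1, e2, e3, l1, l2, l3, r1, r2, r3, r31, c12, c13, c02, c03]
    simp +decide only [if_true, if_false]
    try simp only [h.left 1 3, c13]
    try simp +decide only [if_true, if_false]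
    push_cast
    ring

end HasMixedForm

/-- A linear functional on a plane has a kernel. It is used to choose eigenvectors for the double
eigenvalue with one prescribed coordinate equal to zero. -/
theorem exists_ne_zero_of_finrank_eq_two {V : Type*} [AddCommGroup V] [Module ℂ V]
    {K : Submodule ℂ V} (hK : Module.finrank ℂ K = 2) (φ : V →ₗ[ℂ] ℂ) :
    ∃ F ∈ K, F ≠ 0 ∧ φ F = 0 := by
  by_contra! hne
  have hinj : Function.Injective (φ.comp K.subtype) := by
    rw [injective_iff_map_eq_zero]
    intro F hF
    by_contra hF0
    exact hne F F.2 (fun e => hF0 (Subtype.ext e)) hF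
  have := LinearMap.finrank_le_finrank_of_injective hinj
  rw [hK, Module.finrank_self] at this
  omega

namespace IsOrientedFrame

variable {g B : Matrix (Fin 4) (Fin 4) ℝ} {η : FourForm} {s : ℝ} (hB : IsOrientedFrame g B η s)
include hB

/-- The type D condition for a double 2-form with the mixed components of an umbilical
splitting. -/
theorem typeD {W : Fin 4 → Fin 4 → Fin 4 → Fin 4 → ℝ}
    (hW : ∀ a b c d, W b a c d = -W a b c d) (hW' : ∀ a b c d, W a b d c = -W a b c d)
    {X Z : Fin 4 → Fin 4 → ℝ} (h : HasMixedForm (fr4 B W) X Z) {ρ : ℂ} (hρ : ρ ≠ 0)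
    (h2 : Module.finrank ℂ (sdEigenspace g η (sdPart g η W) ρ) = 2)
    (h1 : Module.finrank ℂ (sdEigenspace g η (sdPart g η W) (-2 * ρ)) = 1) :
    ρ.im = 0 ∧ (∀ σ, sdEigenspace g η (sdPart g η W) σ ≠ ⊥ → σ.im = 0) ∧
    (∀ F ∈ sdBivectors g η, frC B F 0 2 = 0 → frC B F 0 3 = 0 →
      F ∈ sdEigenspace g η (sdPart g η W) (-2 * ρ)) ∧
    ∀ i j, tl i = 1 → tl j = 0 → X i j = Z j i := by
  obtain ⟨⟨q, h11, h22⟩, h12, h21, h10, h20, h01, h02⟩ := h.sdBlock_values s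
  -- The eigenvalue equation for the matrix with rows (m, a, b), (a, q, 0), (b, 0, q) in the
  -- coordinates F_01, F_02, F_03.
  have mem : ∀ {F : Matrix (Fin 4) (Fin 4) ℂ} {σ : ℂ},
      F ∈ sdEigenspace g η (sdPart g η W) σ ↔ F ∈ sdBivectors g η ∧
        sdBlock s (fr4 B W) 0 0 * frC B F 0 1 + sdBlock s (fr4 B W) 0 1 * frC B F 0 2
          + sdBlock s (fr4 B W) 0 2 * frC B F 0 3 = σ * frC B F 0 1 ∧
        sdBlock s (fr4 B W) 0 1 * frC B F 0 1 + q * frC B F 0 2 = σ * frC B F 0 2 ∧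
        sdBlock s (fr4 B W) 0 2 * frC B F 0 1 + q * frC B F 0 3 = σ * frC B F 0 3 := by
    intro F σ
    rw [hB.mem_sdEigenspace hW hW']
    refine and_congr_right fun _ => ?_
    rw [Fin.forall_fin_succ, Fin.forall_fin_succ, Fin.forall_fin_one]
    simp only [Fin.sum_univ_three]
    change (sdBlock s (fr4 B W) 0 0 * frC B F 0 1 + sdBlock s (fr4 B W) 0 1 * frC B F 0 2
          + sdBlock s (fr4 B W) 0 2 * frC B F 0 3 = σ * frC B F 0 1 ∧
        sdBlock s (fr4 B W) 1 0 * frC B F 0 1 + sdBlock s (fr4 B W) 1 1 * frC B F 0 2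
          + sdBlock s (fr4 B W) 1 2 * frC B F 0 3 = σ * frC B F 0 2 ∧
        sdBlock s (fr4 B W) 2 0 * frC B F 0 1 + sdBlock s (fr4 B W) 2 1 * frC B F 0 2
          + sdBlock s (fr4 B W) 2 2 * frC B F 0 3 = σ * frC B F 0 3) ↔ _
    rw [h10, h20, h11, h22, h12, h21]
    simp only [zero_mul, add_zero]
  have hne : ∀ {F : Matrix (Fin 4) (Fin 4) ℂ}, F ∈ sdBivectors g η → F ≠ 0 →
      frC B F 0 1 = 0 → frC B F 0 2 = 0 → frC B F 0 3 = 0 → False := by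
    intro F hF hF0 e1 e2 e3
    have hz : frC B (0 : Matrix (Fin 4) (Fin 4) ℂ) = 0 := by simp [frC]
    refine hF0 (hB.sd_ext hF (Submodule.zero_mem _) fun k => ?_)
    rw [hz]
    match k with
    | 0 => exact e1
    | 1 => exact e2
    | 2 => exact e3
  let coord : Fin 4 → Matrix (Fin 4) (Fin 4) ℂ →ₗ[ℂ] ℂ := fun k =>
    { toFun := fun F => frC B F 0 k
      map_add' := fun F F' => by rw [frC_add]; rfl
      map_smul' := fun c F => by rw [frC_smul]; rfl }
  generalize ha : sdBlock s (fr4 B W) 0 1 = a at *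
  generalize hb : sdBlock s (fr4 B W) 0 2 = b at *
  generalize hm : sdBlock s (fr4 B W) 0 0 = m at *
  -- the double eigenvalue is the real number `q`
  have hqρ : (q : ℂ) = ρ := by
    obtain ⟨F, hF, hF0, e⟩ := exists_ne_zero_of_finrank_eq_two h2 (coord 1)
    replace e : frC B F 0 1 = 0 := e
    obtain ⟨hsd, -, e2, e3⟩ := mem.1 hF
    rw [e, mul_zero, zero_add] at e2 e3
    by_contra hq
    exact hne hsd hF0 e (by_contra fun hn => hq (mul_right_cancel₀ hn e2))
      (by_contra fun hn => hq (mul_right_cancel₀ hn e3))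
  -- For an eigenvector with F_03 = 0 the second row gives a F_01 = 0. If F_01 = 0, the first row
  -- leaves a F_02 = 0 with F_02 nonzero. The argument for `b` uses F_02 = 0 in the same way.
  have ha0 : a = 0 := by
    obtain ⟨F, hF, hF0, e⟩ := exists_ne_zero_of_finrank_eq_two h2 (coord 3)
    replace e : frC B F 0 3 = 0 := e
    obtain ⟨hsd, e1, e2, e3⟩ := mem.1 hF
    rw [hqρ] at e2
    rw [e, mul_zero, add_zero] at e1
    have e4 : a * frC B F 0 1 = 0 := by linear_combination e2
    rcases mul_eq_zero.1 e4 with e4 | e4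
    · exact e4
    · rw [e4, mul_zero, mul_zero, zero_add] at e1
      rcases mul_eq_zero.1 e1 with e5 | e5
      · exact e5
      · exact (hne hsd hF0 e4 e5 e).elim
  have hb0 : b = 0 := by
    obtain ⟨F, hF, hF0, e⟩ := exists_ne_zero_of_finrank_eq_two h2 (coord 2)
    replace e : frC B F 0 2 = 0 := e
    obtain ⟨hsd, e1, e2, e3⟩ := mem.1 hF
    rw [hqρ] at e3
    rw [e, mul_zero, add_zero] at e1
    have e4 : b * frC B F 0 1 = 0 := by linear_combination e3
    rcases mul_eq_zero.1 e4 with e4 | e4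
    · exact e4
    · rw [e4, mul_zero, mul_zero, zero_add] at e1
      rcases mul_eq_zero.1 e1 with e5 | e5
      · exact e5
      · exact (hne hsd hF0 e4 e e5).elim
  -- The matrix is now diagonal. Since 3ρ is nonzero, an eigenvector for -2ρ has no second or third
  -- coordinate, so it is supported on the first.
  have hm0 : m = -2 * ρ := by
    have hne1 : sdEigenspace g η (sdPart g η W) (-2 * ρ) ≠ ⊥ := fun e => by
      rw [e, finrank_bot] at h1
      omega
    obtain ⟨F, hF, hF0⟩ := Submodule.exists_mem_ne_zero_of_ne_bot hne1
    obtain ⟨hsd, e1, e2, e3⟩ := mem.1 hF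
    rw [ha0, hb0, zero_mul, zero_mul, add_zero, add_zero] at e1
    rw [ha0, hqρ, zero_mul, zero_add] at e2
    rw [hb0, hqρ, zero_mul, zero_add] at e3
    have h3 : (3 : ℂ) * ρ ≠ 0 := mul_ne_zero (by norm_num) hρ
    have f2 : frC B F 0 2 = 0 := by
      refine (mul_eq_zero.1 (?_ : 3 * ρ * frC B F 0 2 = 0)).resolve_left h3
      linear_combination e2
    have f3 : frC B F 0 3 = 0 := by
      refine (mul_eq_zero.1 (?_ : 3 * ρ * frC B F 0 3 = 0)).resolve_left h3
      linear_combination e3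
    exact mul_right_cancel₀ (fun f1 => hne hsd hF0 f1 f2 f3) e1
  have him : ρ.im = 0 := by rw [← hqρ, Complex.ofReal_im]
  refine ⟨him, fun σ hσ => ?_, fun F hF f2 f3 => ?_, ?_⟩
  · obtain ⟨F, hF, hF0⟩ := Submodule.exists_mem_ne_zero_of_ne_bot hσ
    obtain ⟨hsd, e1, e2, e3⟩ := mem.1 hF
    rw [ha0, hb0, hm0, zero_mul, zero_mul, add_zero, add_zero] at e1
    rw [ha0, zero_mul, zero_add] at e2
    rw [hb0, zero_mul, zero_add] at e3
    by_cases f1 : frC B F 0 1 = 0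
    · by_cases f2 : frC B F 0 2 = 0
      · have f3 : frC B F 0 3 ≠ 0 := fun f3 => hne hsd hF0 f1 f2 f3
        rw [← mul_right_cancel₀ f3 e3, Complex.ofReal_im]
      · rw [← mul_right_cancel₀ f2 e2, Complex.ofReal_im]
    · rw [← mul_right_cancel₀ f1 e1]
      simp [him]
  · refine mem.2 ⟨hF, ?_, ?_, ?_⟩
    · rw [ha0, hb0, hm0]; ring
    · rw [ha0, f2]; ring
    · rw [hb0, f3]; ring
  · have hs : s ≠ 0 := fun e => by
      have := hB.sq
      rw [e, mul_zero] at this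
      exact zero_ne_one this
    -- As `s` is real and nonzero, each of the complex equations a = 0 and b = 0 splits into two
    -- real ones; together they are the four mixed relations between X and Z.
    have key : ∀ x y : ℝ, (1 / 2 : ℂ) * ((x : ℝ) + Complex.I * s * (y : ℝ)) = 0 →
        x = 0 ∧ y = 0 := fun x y hxy => by
      have h3 : ((x : ℝ) : ℂ) + Complex.I * s * (y : ℝ) = 0 :=
        (mul_eq_zero.1 hxy).resolve_left (by norm_num)
      have hre := congrArg Complex.re h3
      have him := congrArg Complex.im h3
      simp at hre him
      exact ⟨hre, him.resolve_left hs⟩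
    rw [ha0] at h01
    rw [hb0] at h02
    obtain ⟨x1, x2⟩ := key _ _ h01.symm
    obtain ⟨x3, x4⟩ := key _ _ h02.symm
    intro i j hi hj
    rcases (tl_eq_one_iff i).1 hi with rfl | rfl <;>
      rcases (tl_eq_zero_iff j).1 hj with rfl | rfl <;> linarith

end IsOrientedFrame

/-! ### The Weyl tensor of an umbilical splitting -/

namespace IsMetricOn

variable {Ω : Set E4} {G : E4 → Matrix (Fin 4) (Fin 4) ℝ} (hG : IsMetricOn Ω G) {y : E4}
include hG

theorem riemannUp_eq (hy : y ∈ Ω) (a b c d : Fin 4) :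
    riemannUp G a b c d y = ∑ e, (G y)⁻¹ a e * riemann G e b c d y := by
  have h : curv G c d y = (G y)⁻¹ * (G y * curv G c d y) := by
    rw [← mul_assoc, Matrix.nonsing_inv_mul _ (hG.isUnit_det hy), one_mul]
  rw [← curv_apply, h, Matrix.mul_apply]
  simp only [riemann_eq]

theorem inv_apply_symm (hy : y ∈ Ω) (a b : Fin 4) : (G y)⁻¹ a b = (G y)⁻¹ b a := by
  conv_lhs => rw [← hG.symm y hy, ← Matrix.transpose_nonsing_inv]
  rfl

theorem ricci_symm (hy : y ∈ Ω) (b d : Fin 4) : ricci G b d y = ricci G d b y := by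
  simp only [ricci, hG.riemannUp_eq hy]
  rw [Finset.sum_comm]
  exact Finset.sum_congr rfl fun a _ => Finset.sum_congr rfl fun e _ => by
    rw [hG.inv_apply_symm hy, hG.riemann_pair hy]

theorem weyl_antisymm_left (hy : y ∈ Ω) (a b c d : Fin 4) :
    weyl G y b a c d = -weyl G y a b c d := by
  simp only [weyl, hG.riemann_antisymm_left hy b a]
  ring

omit hG in
theorem weyl_antisymm_right (a b c d : Fin 4) : weyl G y a b d c = -weyl G y a b c d := by
  simp only [weyl, riemann_antisymm_right a b d c]
  ring

theorem weyl_pair (hy : y ∈ Ω) (a b c d : Fin 4) : weyl G y c d a b = weyl G y a b c d := by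
  simp only [weyl, hG.riemann_pair hy c d a b, hG.ricci_symm hy d b, hG.ricci_symm hy c a,
    hG.ricci_symm hy d a, hG.ricci_symm hy c b, hG.apply_symm hy c a, hG.apply_symm hy d b,
    hG.apply_symm hy c b, hG.apply_symm hy d a]
  ring

end IsMetricOn

theorem fr4_antisymm_right (B : Matrix (Fin 4) (Fin 4) ℝ)
    {T : Fin 4 → Fin 4 → Fin 4 → Fin 4 → ℝ} (hT : ∀ a b c d, T a b d c = -T a b c d)
    (i j k l : Fin 4) : fr4 B T i j l k = -fr4 B T i j k l := by
  rw [← fr4_swap_right, funext fun a => funext fun b => funext fun c => funext fun d =>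
    (hT a b c d).trans (neg_one_mul _).symm, fr4_const_mul, neg_one_mul]

theorem fr4_antisymm_left (B : Matrix (Fin 4) (Fin 4) ℝ)
    {T : Fin 4 → Fin 4 → Fin 4 → Fin 4 → ℝ} (hT : ∀ a b c d, T b a c d = -T a b c d)
    (i j k l : Fin 4) : fr4 B T j i k l = -fr4 B T i j k l := by
  rw [← fr4_swap_left, funext fun a => funext fun b => funext fun c => funext fun d =>
    (hT a b c d).trans (neg_one_mul _).symm, fr4_const_mul, neg_one_mul]

namespace IsUmbilicalSplitting

variable {Ω : Set E4} {G p : E4 → Matrix (Fin 4) (Fin 4) ℝ} (h : IsUmbilicalSplitting Ω G p)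
  {y : E4} {B : Matrix (Fin 4) (Fin 4) ℝ} (hB : IsAdaptedFrame (G y) (p y) B tl)
include h hB

/-- The trace terms that distinguish the Weyl tensor from the curvature tensor have the same index
pattern as the mixed formula, so they only shift X and Z. The scalar term is put entirely into X; it
is diagonal in the frame and does not affect symmetry or the entries with one index in each plane.
-/
theorem fr4_weyl (hy : y ∈ Ω) : HasMixedForm (fr4 B (weyl G y))
    (fun i j => hessForm G p y B i j - (1 / 2) * fr2 B (fun a b => ricci G a b y) i j
      + (scalarCurv G y / 6) * if i = j then sgn i else 0)
    (fun i j => hessForm G (fun z => 1 - p z) y B i j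
      - (1 / 2) * fr2 B (fun a b => ricci G a b y) i j) where
  left l k i j := fr4_antisymm_left B (h.weyl_antisymm_left hy) l k i j
  right l k i j := fr4_antisymm_right B IsMetricOn.weyl_antisymm_right l k i j
  pair l k i j := by
    rw [← fr4_pair]
    congr 1
    ext a b c d
    exact h.weyl_pair hy a b c d
  mixed l k i j hi hj := by
    have e : fr4 B (weyl G y) l k i j = fr4 B (fun l k a b => riemann G l k a b y) l k i j
        - (1 / 2) * ((if l = i then sgn l else 0) * fr2 B (fun a b => ricci G a b y) k j
          + (if k = j then sgn k else 0) * fr2 B (fun a b => ricci G a b y) l i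
          - (if l = j then sgn l else 0) * fr2 B (fun a b => ricci G a b y) k i
          - (if k = i then sgn k else 0) * fr2 B (fun a b => ricci G a b y) l j)
        + (scalarCurv G y / 6) * ((if l = i then sgn l else 0) * (if k = j then sgn k else 0)
          - (if l = j then sgn l else 0) * (if k = i then sgn k else 0)) := by
      have hw : weyl G y = fun l k a b => riemann G l k a b y
          - (1 / 2) * (G y l a * ricci G k b y + ricci G l a y * G y k b
            - G y l b * ricci G k a y - ricci G l b y * G y k a)
          + (scalarCurv G y / 6) * (G y l a * G y k b - G y l b * G y k a) := by
        ext l k a b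
        rw [weyl]
        ring
      have m1 := fr4_mul B (G y) (Matrix.of fun a b => ricci G a b y) l k i j
      have m2 := fr4_mul B (Matrix.of fun a b => ricci G a b y) (G y) l k i j
      have m3 := fr4_mul' B (G y) (Matrix.of fun a b => ricci G a b y) l k i j
      have m4 := fr4_mul' B (Matrix.of fun a b => ricci G a b y) (G y) l k i j
      simp only [Matrix.of_apply, hB.fr2_metric] at m1 m2 m3 m4
      rw [hw]
      simp only [fr4_add, fr4_sub, fr4_const_mul, fr4_mul, fr4_mul', hB.fr2_metric, m1, m2, m3, m4]
      change _ - 1 / 2 * (_ * fr2 B (fun a b => ricci G a b y) k j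
        + fr2 B (fun a b => ricci G a b y) l i * _ - _ * fr2 B (fun a b => ricci G a b y) k i
        - fr2 B (fun a b => ricci G a b y) l j * _) + _ = _
      ring
    rw [e, h.fr4_riemann_eq hB hy hi hj]
    ring

/-- In type D, the structure is principal, the eigenvalues are real, and the sum of the mean
curvature forms is closed. -/
theorem typeD (hy : y ∈ Ω) {η : FourForm} {s : ℝ} (ho : IsOrientedFrame (G y) B η s) {ρ : ℂ}
    (hρ : ρ ≠ 0) (h2 : Module.finrank ℂ (sdEigenspace (G y) η (sdPart (G y) η (weyl G y)) ρ) = 2)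
    (h1 : Module.finrank ℂ (sdEigenspace (G y) η (sdPart (G y) η (weyl G y)) (-2 * ρ)) = 1) :
    (∀ σ, sdEigenspace (G y) η (sdPart (G y) η (weyl G y)) σ ≠ ⊥ → σ.im = 0) ∧
    (∀ F ∈ sdBivectors (G y) η, frC B F 0 2 = 0 → frC B F 0 3 = 0 →
      F ∈ sdEigenspace (G y) η (sdPart (G y) η (weyl G y)) (-2 * ρ)) ∧
    ∀ a b, pd a (fun z => meanForm G p b z + meanForm G (fun z => 1 - p z) b z) y
      = pd b (fun z => meanForm G p a z + meanForm G (fun z => 1 - p z) a z) y := by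
  have hm := h.fr4_weyl hB hy
  obtain ⟨-, hreal, hprin, hXZ⟩ := ho.typeD (h.weyl_antisymm_left hy)
    IsMetricOn.weyl_antisymm_right hm hρ h2 h1
  have hric : ∀ i j, fr2 B (fun a b => ricci G a b y) i j
      = fr2 B (fun a b => ricci G a b y) j i := fun i j => by
    rw [← fr2_swap]
    congr 1
    ext a b
    exact h.ricci_symm hy b a
  have ht : ∀ i, tl i = 1 ∨ tl i = 0 := fun i => by fin_cases i <;> simp [tl]
  refine ⟨hreal, hprin, h.closed_meanForm_add hB hy ht (fun i j hi hj => ?_)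
    (fun i j hi hj => ?_) fun i j hi hj => ?_⟩
  -- The shifts by Ricci and scalar curvature are symmetric, so the relations for X and Z pass to ∇ξ
  -- - ξ⊗ξ and ∇ζ - ζ⊗ζ.
  · have e := hm.symm_left hi hj
    by_cases hij : i = j
    · rw [hij]
    · simp only [if_neg hij, if_neg (Ne.symm hij), hric j i] at e
      linarith
  · have e := hm.symm_right hi hj
    simp only [hric j i] at e
    linarith
  · have e := hXZ i j hi hj
    have hij : i ≠ j := fun e => by rw [e, hj] at hi; exact zero_ne_one hi
    simp only [if_neg hij, hric j i] at e
    linarith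

end IsUmbilicalSplitting

/-! ### The canonical 2-form of a 2+2 structure in a chart -/

/-- The components of the canonical 2-form in an adapted frame. -/
def canonicalForm : Matrix (Fin 4) (Fin 4) ℝ :=
  fun i j => if i = 0 ∧ j = 1 then 1 else if i = 1 ∧ j = 0 then -1 else 0

/-- The chart components of a metric, a canonical 2-form and a volume element. -/
structure IsStructureOn (Ω : Set E4) (G U : E4 → Matrix (Fin 4) (Fin 4) ℝ) (η : E4 → FourForm) :
    Prop where
  isOpen : IsOpen Ω
  smooth_metric : SmoothMat Ω G
  smooth_form : SmoothMat Ω U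
  smooth_volume : ∀ a b c d, ContDiffOn ℝ ∞ (fun z => η z a b c d) Ω
  frame : ∀ z ∈ Ω, ∃ B s, IsOrientedFrame (G z) B (η z) s ∧
    B.transpose * U z * B = canonicalForm

namespace IsOrientedFrame

variable {g B : Matrix (Fin 4) (Fin 4) ℝ} {η : FourForm} {s : ℝ} (hB : IsOrientedFrame g B η s)
include hB

theorem conj_injective {A A' : Matrix (Fin 4) (Fin 4) ℝ}
    (h : B.transpose * A * B = B.transpose * A' * B) : A = A' := by
  have h1 := mul_eq_one_comm.1 hB.left_inv
  have h2 : (minkowski * B.transpose * g).transpose * B.transpose = 1 := by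
    rw [← Matrix.transpose_mul, h1, Matrix.transpose_one]
  have h3 : ∀ A, A = (minkowski * B.transpose * g).transpose * (B.transpose * A * B)
      * (minkowski * B.transpose * g) := fun A => by
    generalize minkowski * B.transpose * g = L at h1 h2
    rw [← mul_assoc, ← mul_assoc, h2, one_mul, mul_assoc, h1, mul_one]
  rw [h3 A, h, ← h3 A']

theorem conj_mul_inv_mul (T S : Matrix (Fin 4) (Fin 4) ℝ) :
    B.transpose * (T * g⁻¹ * S) * B
      = (B.transpose * T * B) * minkowski * (B.transpose * S * B) := by
  rw [hB.inv_metric]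
  simp only [mul_assoc]

theorem conj_hodge {U : Matrix (Fin 4) (Fin 4) ℝ} (hU : B.transpose * U * B = canonicalForm)
    (i j : Fin 4) :
    (B.transpose * hodge (K := ℝ) g η U * B) i j = -(s * leviCivita i j 0 1) := by
  have h := hB.frC_hodge (cx U) i j
  rw [← cx_hodge, frC_cx] at h
  simp only [frC_cx, hU] at h
  have h' : (B.transpose * hodge (K := ℝ) g η U * B) i j = (1 / 2) * ∑ k, ∑ l,
      (s * leviCivita i j k l) * (sgn k * sgn l * canonicalForm k l) := by
    apply Complex.ofReal_injective
    rw [h]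
    push_cast
    rfl
  obtain ⟨s0, s1, s2, s3⟩ := sgn_values
  have e : leviCivita i j 1 0 = -leviCivita i j 0 1 := by
    simp only [leviCivita]; ring
  rw [h']
  simp +decide only [Fin.sum_univ_four, canonicalForm, if_true, if_false, s0, s1, e]
  ring

theorem symm_metric : g.transpose = g := by
  refine hB.conj_injective ?_
  have h := congrArg Matrix.transpose hB.orthonormal
  rw [minkowski_eq, Matrix.diagonal_transpose, ← minkowski_eq, ← hB.orthonormal,
    Matrix.transpose_mul, Matrix.transpose_mul, Matrix.transpose_transpose, ← mul_assoc] at h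
  exact h

theorem det_metric_ne : g.det ≠ 0 := by
  intro h
  have h1 := congrArg Matrix.det hB.left_inv
  rw [Matrix.det_mul, Matrix.det_mul, h, mul_zero, zero_mul, Matrix.det_one] at h1
  exact zero_ne_one h1

theorem form_antisymm {U : Matrix (Fin 4) (Fin 4) ℝ}
    (hU : B.transpose * U * B = canonicalForm) : U.transpose = -U := by
  refine hB.conj_injective ?_
  have h := congrArg Matrix.transpose hU
  rw [Matrix.transpose_mul, Matrix.transpose_mul, Matrix.transpose_transpose, ← mul_assoc] at h
  rw [h, mul_neg, neg_mul, hU]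
  ext i j
  fin_cases i <;> fin_cases j <;> simp [canonicalForm]

theorem mul_frame {U : Matrix (Fin 4) (Fin 4) ℝ}
    (hU : B.transpose * U * B = canonicalForm) :
    g⁻¹ * U * B = B * (minkowski * canonicalForm) := by
  rw [hB.inv_metric, ← hU]
  simp only [mul_assoc]

theorem adapted {U : Matrix (Fin 4) (Fin 4) ℝ} (hU : B.transpose * U * B = canonicalForm) :
    IsAdaptedFrame g ((g⁻¹ * U) * (g⁻¹ * U)) B tl where
  orthonormal := hB.orthonormal
  adapted := by
    have h : minkowski * canonicalForm * (minkowski * canonicalForm) = Matrix.diagonal tl := by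
      ext i j
      fin_cases i <;> fin_cases j <;>
        simp [minkowski, Matrix.mul_apply, Matrix.diagonal_apply, Fin.sum_univ_four,
          canonicalForm, tl]
    rw [mul_assoc, hB.mul_frame hU, ← mul_assoc, hB.mul_frame hU, mul_assoc, h]

end IsOrientedFrame

namespace IsStructureOn

variable {Ω : Set E4} {G U : E4 → Matrix (Fin 4) (Fin 4) ℝ} {η : E4 → FourForm}
  (h : IsStructureOn Ω G U η)
include h

theorem isMetricOn : IsMetricOn Ω G where
  isOpen := h.isOpen
  smooth := h.smooth_metric
  symm z hz := by
    obtain ⟨B, s, hB, -⟩ := h.frame z hz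
    exact hB.symm_metric
  det_ne z hz := by
    obtain ⟨B, s, hB, -⟩ := h.frame z hz
    exact hB.det_metric_ne

theorem form_antisymm {z : E4} (hz : z ∈ Ω) : (U z).transpose = -U z := by
  obtain ⟨B, s, hB, hU⟩ := h.frame z hz
  exact hB.form_antisymm hU

theorem smooth_timelikeProj : SmoothMat Ω (timelikeProj G U) := by
  have h1 := h.isMetricOn.smooth_inv.mul h.smooth_form
  exact h1.mul h1

theorem isSplitting : IsSplitting Ω G (timelikeProj G U) where
  toIsMetricOn := h.isMetricOn
  smooth_proj := h.smooth_timelikeProj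
  idem z hz := by
    obtain ⟨B, s, hB, hU⟩ := h.frame z hz
    have ha := hB.adapted hU
    have ht : Matrix.diagonal tl * Matrix.diagonal tl = Matrix.diagonal tl := by
      rw [Matrix.diagonal_mul_diagonal]
      congr 1
      ext i
      fin_cases i <;> simp [tl]
    have h1 : ∀ A A' : Matrix (Fin 4) (Fin 4) ℝ, A * B = A' * B → A = A' := fun A A' e => by
      rw [← mul_one A, ← ha.right_inv, ← mul_assoc, e, mul_assoc, ha.right_inv, mul_one]
    refine h1 _ _ ?_
    have h2 : timelikeProj G U z * B = B * Matrix.diagonal tl := ha.adapted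
    rw [mul_assoc, h2, ← mul_assoc, h2, mul_assoc, ht]
  self_adjoint z hz := by
    have h1 : G z * timelikeProj G U z = U z * ((G z)⁻¹ * U z) := by
      rw [timelikeProj, ← mul_assoc, ← mul_assoc (G z) (G z)⁻¹,
        Matrix.mul_nonsing_inv _ (h.isMetricOn.isUnit_det hz), one_mul]
    rw [h1, Matrix.transpose_mul, Matrix.transpose_mul, h.form_antisymm hz,
      Matrix.transpose_nonsing_inv, h.isMetricOn.symm z hz]
    simp only [neg_mul, mul_neg, neg_neg, mul_assoc]

/-- The dual of the canonical 2-form is smooth. -/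
theorem smooth_hodge {F : E4 → Matrix (Fin 4) (Fin 4) ℝ} (hF : SmoothMat Ω F) :
    SmoothMat Ω (fun z => hodge (K := ℝ) (G z) (η z) (F z)) := fun a b => by
  have h1 := h.isMetricOn.smooth_inv
  simp only [hodge, smul_eq_mul]
  exact ContDiffOn.sum fun c _ => ContDiffOn.sum fun d _ => ContDiffOn.sum fun p _ =>
    ContDiffOn.sum fun q _ => (((contDiffOn_const.mul (h.smooth_volume a b c d)).mul
      (h1 c p)).mul (h1 d q)).mul (hF p q)

end IsStructureOn

/-! ### Derivatives of the canonical 2-form -/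

namespace IsOrientedFrame

variable {g B : Matrix (Fin 4) (Fin 4) ℝ} {η : FourForm} {s : ℝ} (hB : IsOrientedFrame g B η s)
include hB

theorem inv_metric_apply (a c : Fin 4) : g⁻¹ a c = ∑ i, B a i * sgn i * B c i := by
  rw [hB.inv_metric, minkowski_eq, Matrix.mul_apply]
  refine Finset.sum_congr rfl fun i _ => ?_
  rw [Matrix.mul_diagonal, Matrix.transpose_apply]

theorem sum_inv_mul (S : Fin 4 → Fin 4 → ℝ) :
    ∑ a, ∑ c, g⁻¹ a c * S c a = ∑ i, sgn i * fr2 B S i i := by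
  simp only [hB.inv_metric_apply, fr2, fr1, ct, Finset.mul_sum, Finset.sum_mul]
  rw [Finset.sum_comm, Finset.sum_comm (s := Finset.univ (α := Fin 4))
    (f := fun i c => ∑ a, sgn i * (B c i * (B a i * S c a)))]
  refine Finset.sum_congr rfl fun c _ => ?_
  rw [Finset.sum_comm]
  exact Finset.sum_congr rfl fun i _ => Finset.sum_congr rfl fun a _ => by ring

theorem fr1_applyForm (A : Matrix (Fin 4) (Fin 4) ℝ) (θ : Fin 4 → ℝ) (i : Fin 4) :
    fr1 B (applyForm g A θ) i = ∑ j, sgn j * fr2 B A i j * fr1 B θ j := by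
  have e : ∀ m, applyForm g A θ m = ∑ j, sgn j * fr1 B (A m) j * fr1 B θ j := fun m => by
    simp only [applyForm, hB.inv_metric_apply, fr1, ct, Finset.mul_sum, Finset.sum_mul]
    rw [Finset.sum_comm, Finset.sum_comm (s := Finset.univ (α := Fin 4))
      (f := fun j r => ∑ n, sgn j * (B n j * A m n) * (B r j * θ r))]
    refine Finset.sum_congr rfl fun c _ => ?_
    rw [Finset.sum_comm]
    exact Finset.sum_congr rfl fun i _ => Finset.sum_congr rfl fun a _ => by ring
  have e' : applyForm g A θ = fun m => ∑ j, sgn j * fr1 B (A m) j * fr1 B θ j := funext e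
  rw [e']
  simp only [fr2, fr1, ct_sum, ct_const_mul, ct_mul_const]

theorem conj_mul_inv_mul' (T S : Matrix (Fin 4) (Fin 4) ℝ) (i j : Fin 4) :
    (B.transpose * (T * g⁻¹ * S) * B) i j = ∑ m, fr2 B T i m * sgn m * fr2 B S m j := by
  rw [hB.conj_mul_inv_mul, Matrix.mul_apply]
  refine Finset.sum_congr rfl fun m _ => ?_
  rw [minkowski_eq, Matrix.mul_diagonal, fr2_eq, fr2_eq]

end IsOrientedFrame

namespace IsMetricOn

variable {Ω : Set E4} {G : E4 → Matrix (Fin 4) (Fin 4) ℝ} (hG : IsMetricOn Ω G) {y : E4}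
include hG

theorem covd_congr {T T' : E4 → Matrix (Fin 4) (Fin 4) ℝ} (h : ∀ z ∈ Ω, T z = T' z) (hy : y ∈ Ω)
    (k : Fin 4) : covd G T k y = covd G T' k y := by
  rw [covd, covd, pdm_congr hG.isOpen h hy, h y hy]

theorem covd_sub {T T' : E4 → Matrix (Fin 4) (Fin 4) ℝ} (hT : SmoothMat Ω T)
    (hT' : SmoothMat Ω T') (hy : y ∈ Ω) (k : Fin 4) :
    covd G (fun z => T z - T' z) k y = covd G T k y - covd G T' k y := by
  rw [covd, covd, covd, pdm_sub hG.isOpen hT hT' hy]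
  noncomm_ring

/-- The Leibniz rule with an index raised in between. Passing to endomorphisms by raising the first
index, and lowering it again, avoids differentiating the inverse metric. -/
theorem covd_mul_inv_mul {T S : E4 → Matrix (Fin 4) (Fin 4) ℝ} (hT : SmoothMat Ω T)
    (hS : SmoothMat Ω S) (hy : y ∈ Ω) (k : Fin 4) :
    covd G (fun z => T z * (G z)⁻¹ * S z) k y
      = covd G T k y * (G y)⁻¹ * S y + T y * (G y)⁻¹ * covd G S k y := by
  have hl : ∀ z ∈ Ω, ∀ A, G z * ((G z)⁻¹ * A) = A := fun z hz A => by
    rw [← mul_assoc, Matrix.mul_nonsing_inv _ (hG.isUnit_det hz), one_mul]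
  have hl' : ∀ z ∈ Ω, ∀ A, (G z)⁻¹ * (G z * A) = A := fun z hz A => by
    rw [← mul_assoc, Matrix.nonsing_inv_mul _ (hG.isUnit_det hz), one_mul]
  have hP := hG.smooth_inv.mul hT
  have hQ := hG.smooth_inv.mul hS
  have e1 : ∀ {A : E4 → Matrix (Fin 4) (Fin 4) ℝ}, SmoothMat Ω A →
      covdEnd G (fun z => (G z)⁻¹ * A z) k y = (G y)⁻¹ * covd G A k y := fun {A} hA => by
    have h := hG.covd_mul (hG.smooth_inv.mul hA) hy k
    rw [hG.covd_congr (fun z hz => hl z hz (A z)) hy] at h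
    rw [h, hl' y hy]
  have h := hG.covd_mul (hP.mul hQ) hy k
  rw [hG.covdEnd_mul hP hQ hy, e1 hT, e1 hS] at h
  have e2 : ∀ z ∈ Ω, G z * ((G z)⁻¹ * T z * ((G z)⁻¹ * S z)) = T z * (G z)⁻¹ * S z :=
    fun z hz => by rw [mul_assoc (G z)⁻¹, hl z hz, mul_assoc]
  rw [hG.covd_congr e2 hy] at h
  rw [h, mul_add, mul_assoc (G y)⁻¹, mul_assoc (G y)⁻¹, hl y hy, hl y hy, mul_assoc, mul_assoc]

theorem covd_antisymm {T : E4 → Matrix (Fin 4) (Fin 4) ℝ} (hT : SmoothMat Ω T)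
    (h : ∀ z ∈ Ω, (T z).transpose = -T z) (hy : y ∈ Ω) (k : Fin 4) :
    (covd G T k y).transpose = -covd G T k y := by
  have h0 : ∀ z ∈ Ω, (T z).transpose = 0 - T z := fun z hz => by rw [h z hz, zero_sub]
  have e : covd G (fun _ => (0 : Matrix (Fin 4) (Fin 4) ℝ)) k y = 0 := by
    rw [covd, pdm_const]
    simp
  have e1 : (covd G T k y).transpose = covd G (fun z => (T z).transpose) k y := by
    simp only [covd, Matrix.transpose_sub, Matrix.transpose_mul, Matrix.transpose_transpose,
      pdm_transpose]
    abel
  rw [e1, hG.covd_congr h0 hy, hG.covd_sub (smoothMat_const 0) hT hy, e, zero_sub]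

end IsMetricOn

/-- The codifferential is minus the metric trace of the covariant derivative over the derivative
index and the first index, and in an orthonormal frame this trace is a signed sum. -/
theorem IsOrientedFrame.codiff_eq {G : E4 → Matrix (Fin 4) (Fin 4) ℝ} {y : E4}
    {B : Matrix (Fin 4) (Fin 4) ℝ} {η : FourForm} {s : ℝ}
    (hB : IsOrientedFrame (G y) B η s) (F : E4 → Matrix (Fin 4) (Fin 4) ℝ) (j : Fin 4) :
    fr1 B (fun b => codiff G F b y) j
      = -∑ i, sgn i * fr3 B (fun k a b => covd G F k y a b) i i j := by
  have e : ∀ b, codiff G F b y = -∑ a, ∑ c, (G y)⁻¹ a c * covd G F c y a b := fun b => by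
    simp only [codiff, covd, Matrix.sub_apply, pdm_apply, Matrix.mul_apply,
      Matrix.transpose_apply, conn, Matrix.of_apply, Finset.sum_add_distrib]
    congr 1
    refine Finset.sum_congr rfl fun a _ => Finset.sum_congr rfl fun c _ => ?_
    have : ∑ n, christoffel G n c b y * F y a n = ∑ n, F y a n * christoffel G n c b y :=
      Finset.sum_congr rfl fun n _ => mul_comm _ _
    rw [this]
    ring
  have e' : ∀ b, codiff G F b y
      = -∑ i, sgn i * fr2 B (fun c a => covd G F c y a b) i i := fun b => by
    rw [e, hB.sum_inv_mul fun c a => covd G F c y a b]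
  simp only [e', fr1, ct_neg, ct_sum, ct_const_mul]
  congr 1
  refine Finset.sum_congr rfl fun i _ => ?_
  congr 1
  simp only [fr3, fr2, fr1]
  rw [ct_comm]
  congr 1
  ext c
  rw [ct_comm]

theorem fr3_congr_of_fr2 {B : Matrix (Fin 4) (Fin 4) ℝ} {S T : Fin 4 → Fin 4 → Fin 4 → ℝ} {r : ℝ}
    {i j i' j' : Fin 4} (h : ∀ a, fr2 B (S a) i j = r * fr2 B (T a) i' j') (k : Fin 4) :
    fr3 B S k i j = r * fr3 B T k i' j' := by
  simp only [fr3, h, fr1, ct_const_mul]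

/-- The components of the dual of the canonical 2-form in an adapted frame, up to sign. -/
def dualForm : Matrix (Fin 4) (Fin 4) ℝ :=
  fun i j => if i = 2 ∧ j = 3 then 1 else if i = 3 ∧ j = 2 then -1 else 0

theorem leviCivita_eq (i j : Fin 4) : leviCivita i j 0 1 = dualForm i j := by
  fin_cases i <;> fin_cases j <;> simp +decide [leviCivita, dualForm] <;> norm_num

namespace IsStructureOn

variable {Ω : Set E4} {G U : E4 → Matrix (Fin 4) (Fin 4) ℝ} {η : E4 → FourForm}
  (h : IsStructureOn Ω G U η) {y : E4} {B : Matrix (Fin 4) (Fin 4) ℝ} {s : ℝ}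
  (hB : IsOrientedFrame (G y) B (η y) s)
include h

theorem metric_mul_proj {z : E4} (hz : z ∈ Ω) :
    G z * timelikeProj G U z = U z * (G z)⁻¹ * U z := by
  rw [timelikeProj, ← mul_assoc, ← mul_assoc (G z) (G z)⁻¹,
    Matrix.mul_nonsing_inv _ (h.isMetricOn.isUnit_det hz), one_mul, mul_assoc]

theorem smooth_metric_mul_proj : SmoothMat Ω (fun z => G z * timelikeProj G U z) :=
  h.smooth_metric.mul h.smooth_timelikeProj

/-- A relation between tensor products may be checked in frames. -/
theorem eq_of_frame {A A' : E4 → Matrix (Fin 4) (Fin 4) ℝ}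
    (hA : ∀ z ∈ Ω, ∀ B s, IsOrientedFrame (G z) B (η z) s →
      B.transpose * U z * B = canonicalForm → B.transpose * A z * B = B.transpose * A' z * B) :
    ∀ z ∈ Ω, A z = A' z := fun z hz => by
  obtain ⟨B, s, hB, hU⟩ := h.frame z hz
  exact hB.conj_injective (hA z hz B s hB hU)

include hB

/-- The derivative of the canonical 2-form in an adapted frame. -/
theorem fr3_covd_form (hU : B.transpose * U y * B = canonicalForm) (hy : y ∈ Ω) :
    let C := fr3 B (fun k a b => covd G U k y a b)
    let N := fr3 B (fun k a b => covd G (fun z => G z * timelikeProj G U z) k y a b)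
    ∀ k, (∀ i j, C k j i = -C k i j) ∧ C k 0 1 = -(1 / 2) * N k 0 0 ∧ C k 2 3 = 0 ∧
      C k 1 2 = N k 0 2 ∧ C k 1 3 = N k 0 3 ∧ C k 0 2 = N k 1 2 ∧ C k 0 3 = N k 1 3 := by
  intro C N k
  obtain ⟨s0, s1, s2, s3⟩ := sgn_values
  obtain ⟨t0, t1, t2, t3⟩ := tl_values
  have hu : ∀ i j, fr2 B (U y) i j = canonicalForm i j := fun i j => by rw [fr2_eq, hU]
  have ha := h.isMetricOn.covd_antisymm h.smooth_form (fun z hz => h.form_antisymm hz) hy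
  have hc : ∀ a i j, fr2 B (covd G U a y) j i = -1 * fr2 B (covd G U a y) i j := fun a i j => by
    refine (fr2_swap B (covd G U a y) i j).symm.trans ?_
    change fr2 B (covd G U a y).transpose i j = _
    rw [ha a, neg_one_mul, fr2_eq, fr2_eq, mul_neg, neg_mul, Matrix.neg_apply]
  -- Differentiation of U² = v. Together with the antisymmetry of ∇U it determines the mixed
  -- components of ∇U from ∇v.
  have hn : ∀ a i j, fr2 B (covd G (fun z => G z * timelikeProj G U z) a y) i j
      = ∑ m, fr2 B (covd G U a y) i m * sgn m * canonicalForm m j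
        + ∑ m, canonicalForm i m * sgn m * fr2 B (covd G U a y) m j := fun a i j => by
    rw [h.isMetricOn.covd_congr (fun z hz => h.metric_mul_proj hz) hy,
      h.isMetricOn.covd_mul_inv_mul h.smooth_form h.smooth_form hy, fr2_eq, mul_add, add_mul,
      Matrix.add_apply, hB.conj_mul_inv_mul', hB.conj_mul_inv_mul']
    simp only [hu]
  -- The identity U v = U, whose derivative gives what U² = v does not see: the component 23 of ∇U
  -- vanishes.
  have hv : ∀ z ∈ Ω, U z = U z * (G z)⁻¹ * (G z * timelikeProj G U z) := by
    refine h.eq_of_frame fun z hz B s hB hU => ?_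
    ext i j
    rw [hB.conj_mul_inv_mul', hU]
    have : ∀ i j, fr2 B (U z) i j = canonicalForm i j := fun i j => by rw [fr2_eq, hU]
    have hp : ∀ i j, fr2 B (G z * timelikeProj G U z) i j = if i = j then sgn i * tl i else 0 :=
      (hB.adapted hU).fr2_proj
    simp only [this, hp]
    fin_cases i <;> fin_cases j <;> simp +decide [canonicalForm, sgn, tl]
  have hc' : ∀ a i j, fr2 B (covd G U a y) i j
      = ∑ m, fr2 B (covd G U a y) i m * sgn m * (if m = j then sgn m * tl m else 0)
        + ∑ m, canonicalForm i m * sgn m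
          * fr2 B (covd G (fun z => G z * timelikeProj G U z) a y) m j := fun a i j => by
    have hp : ∀ i j, fr2 B (G y * timelikeProj G U y) i j = if i = j then sgn i * tl i else 0 :=
      (hB.adapted hU).fr2_proj
    conv_lhs => rw [h.isMetricOn.covd_congr hv hy,
      h.isMetricOn.covd_mul_inv_mul h.smooth_form h.smooth_metric_mul_proj hy, fr2_eq, mul_add,
      add_mul, Matrix.add_apply, hB.conj_mul_inv_mul', hB.conj_mul_inv_mul']
    simp only [hu, hp]
  have key : ∀ a, fr2 B (covd G U a y) 0 1
      = -(1 / 2) * fr2 B (covd G (fun z => G z * timelikeProj G U z) a y) 0 0 ∧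
      fr2 B (covd G U a y) 2 3 = 0 := fun a => by
    have e1 := hn a 0 0
    have e2 := hc a 0 1
    have e3 := hc' a 2 3
    simp +decide only [Fin.sum_univ_four, canonicalForm, if_true, if_false, s0, s1, s2, s3] at e1
    simp +decide only [Fin.sum_univ_four, canonicalForm, if_true, if_false, s0, s1, s2, s3, t2,
      t3] at e3
    norm_num at e1 e3
    exact ⟨by linarith, e3⟩
  have key' : ∀ a j, j = 2 ∨ j = 3 → fr2 B (covd G U a y) 1 j
      = 1 * fr2 B (covd G (fun z => G z * timelikeProj G U z) a y) 0 j ∧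
      fr2 B (covd G U a y) 0 j
      = 1 * fr2 B (covd G (fun z => G z * timelikeProj G U z) a y) 1 j := fun a j hj => by
    have e1 := hn a 0 j
    have e2 := hn a 1 j
    rcases hj with rfl | rfl <;>
    · simp +decide only [Fin.sum_univ_four, canonicalForm, if_true, if_false, s0, s1, s2, s3]
        at e1 e2
      norm_num at e1 e2
      exact ⟨by linarith, by linarith⟩
  refine ⟨fun i j => (fr3_congr_of_fr2 (fun a => hc a i j) k).trans (neg_one_mul _),
    fr3_congr_of_fr2 (fun a => (key a).1) k, ?_,
    (fr3_congr_of_fr2 (fun a => (key' a 2 (Or.inl rfl)).1) k).trans (one_mul _),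
    (fr3_congr_of_fr2 (fun a => (key' a 3 (Or.inr rfl)).1) k).trans (one_mul _),
    (fr3_congr_of_fr2 (fun a => (key' a 2 (Or.inl rfl)).2) k).trans (one_mul _),
    (fr3_congr_of_fr2 (fun a => (key' a 3 (Or.inr rfl)).2) k).trans (one_mul _)⟩
  have := fr3_congr_of_fr2 (S := fun k a b => covd G U k y a b)
    (T := fun k a b => covd G U k y a b) (r := 0) (i' := 0) (j' := 0)
    (fun a => ((key a).2).trans (zero_mul _).symm) k
  rw [zero_mul] at this
  exact this

/-- The derivative of the dual of the canonical 2-form in an adapted frame. -/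
theorem fr3_covd_dual (hU : B.transpose * U y * B = canonicalForm) (hy : y ∈ Ω) :
    let D := fr3 B (fun k a b => covd G (fun z => hodge (K := ℝ) (G z) (η z) (U z)) k y a b)
    let N := fr3 B (fun k a b => covd G (fun z => G z * timelikeProj G U z) k y a b)
    ∀ k, (∀ i j, D k j i = -D k i j) ∧ D k 2 3 = s / 2 * N k 2 2 ∧ D k 0 1 = 0 ∧
      D k 2 0 = s * N k 3 0 ∧ D k 2 1 = s * N k 3 1 ∧ D k 3 0 = -s * N k 2 0 ∧
      D k 3 1 = -s * N k 2 1 := by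
  intro D N k
  set V : E4 → Matrix (Fin 4) (Fin 4) ℝ := fun z => hodge (K := ℝ) (G z) (η z) (U z) with hVdef
  obtain ⟨s0, s1, s2, s3⟩ := sgn_values
  obtain ⟨t0, t1, t2, t3⟩ := tl_values
  have hV : SmoothMat Ω V := h.smooth_hodge h.smooth_form
  have hf : ∀ z ∈ Ω, ∀ B s, IsOrientedFrame (G z) B (η z) s →
      B.transpose * U z * B = canonicalForm → ∀ i j, fr2 B (V z) i j = -(s * dualForm i j) :=
    fun z hz B s hB hU i j => by rw [fr2_eq, hVdef, hB.conj_hodge hU, leviCivita_eq]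
  have hu := hf y hy B s hB hU
  have hVa : ∀ z ∈ Ω, (V z).transpose = -V z := by
    refine h.eq_of_frame fun z hz B s hB hU => ?_
    ext i j
    rw [← fr2_eq, ← fr2_eq]
    refine (fr2_swap B (V z) i j).trans ?_
    rw [hf z hz B s hB hU, fr2_eq, mul_neg, neg_mul, Matrix.neg_apply, ← fr2_eq,
      hf z hz B s hB hU]
    fin_cases i <;> fin_cases j <;> simp [dualForm]
  have ha := h.isMetricOn.covd_antisymm hV hVa hy
  have hc : ∀ a i j, fr2 B (covd G V a y) j i = -1 * fr2 B (covd G V a y) i j := fun a i j => by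
    refine (fr2_swap B (covd G V a y) i j).symm.trans ?_
    change fr2 B (covd G V a y).transpose i j = _
    rw [ha a, neg_one_mul, fr2_eq, fr2_eq, mul_neg, neg_mul, Matrix.neg_apply]
  -- The square of *U is -h = v - 1, with s² = 1. As the metric is parallel, its derivative is again
  -- ∇v.
  have hsq : ∀ z ∈ Ω, G z * timelikeProj G U z - G z = V z * (G z)⁻¹ * V z := by
    refine h.eq_of_frame fun z hz B s hB hU => ?_
    ext i j
    have hp : (B.transpose * (G z * timelikeProj G U z) * B) i j
        = if i = j then sgn i * tl i else 0 := by
      rw [← fr2_eq]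
      exact (hB.adapted hU).fr2_proj i j
    rw [hB.conj_mul_inv_mul', mul_sub, sub_mul, Matrix.sub_apply, hp, hB.orthonormal,
      minkowski_eq, Matrix.diagonal_apply]
    simp only [hf z hz B s hB hU, Fin.sum_univ_four, s0, s1, s2, s3]
    have e := hB.sq
    fin_cases i <;> fin_cases j <;> simp +decide [dualForm, sgn, tl, e]
  have hn : ∀ a i j, fr2 B (covd G (fun z => G z * timelikeProj G U z) a y) i j
      = ∑ m, fr2 B (covd G V a y) i m * sgn m * -(s * dualForm m j)
        + ∑ m, -(s * dualForm i m) * sgn m * fr2 B (covd G V a y) m j := fun a i j => by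
    have e : covd G (fun z => G z * timelikeProj G U z) a y
        = covd G (fun z => V z * (G z)⁻¹ * V z) a y := by
      rw [← h.isMetricOn.covd_congr hsq hy,
        h.isMetricOn.covd_sub h.smooth_metric_mul_proj h.smooth_metric hy,
        h.isMetricOn.covd_metric hy, sub_zero]
    rw [e, h.isMetricOn.covd_mul_inv_mul hV hV hy, fr2_eq, mul_add, add_mul,
      Matrix.add_apply, hB.conj_mul_inv_mul', hB.conj_mul_inv_mul']
    simp only [hu]
  -- *U annihilates V. The derivative of this relation kills the component 01 of ∇*U.
  have hv : ∀ z ∈ Ω, 0 = V z * (G z)⁻¹ * (G z * timelikeProj G U z) := by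
    refine h.eq_of_frame fun z hz B s hB hU => ?_
    ext i j
    have hp : ∀ i j, fr2 B (G z * timelikeProj G U z) i j = if i = j then sgn i * tl i else 0 :=
      (hB.adapted hU).fr2_proj
    rw [hB.conj_mul_inv_mul']
    simp only [hf z hz B s hB hU, hp, mul_zero, zero_mul, Matrix.zero_apply, Fin.sum_univ_four]
    fin_cases i <;> fin_cases j <;> simp +decide [dualForm, sgn, tl]
  have hc' : ∀ a i j, (0 : ℝ)
      = ∑ m, fr2 B (covd G V a y) i m * sgn m * (if m = j then sgn m * tl m else 0)
        + ∑ m, -(s * dualForm i m) * sgn m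
          * fr2 B (covd G (fun z => G z * timelikeProj G U z) a y) m j := fun a i j => by
    have hp : ∀ i j, fr2 B (G y * timelikeProj G U y) i j = if i = j then sgn i * tl i else 0 :=
      (hB.adapted hU).fr2_proj
    have e : covd G (fun _ => (0 : Matrix (Fin 4) (Fin 4) ℝ)) a y = 0 := by
      rw [covd, pdm_const]
      simp
    rw [h.isMetricOn.covd_congr hv hy,
      h.isMetricOn.covd_mul_inv_mul hV h.smooth_metric_mul_proj hy] at e
    have e' : (B.transpose * (covd G V a y * (G y)⁻¹ * (G y * timelikeProj G U y)) * B) i j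
        + (B.transpose * (V y * (G y)⁻¹ * covd G (fun z => G z * timelikeProj G U z) a y) * B) i j
        = 0 := by
      rw [← Matrix.add_apply, ← add_mul, ← mul_add, e, mul_zero, zero_mul, Matrix.zero_apply]
    rw [hB.conj_mul_inv_mul', hB.conj_mul_inv_mul'] at e'
    simp only [hu, hp] at e'
    exact e'.symm
  have hs := hB.sq
  have key : ∀ a, fr2 B (covd G V a y) 2 3
      = s / 2 * fr2 B (covd G (fun z => G z * timelikeProj G U z) a y) 2 2 ∧
      fr2 B (covd G V a y) 0 1 = 0 := fun a => by
    have e1 := hn a 2 2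
    have e2 := hc a 2 3
    have e3 := hc' a 0 1
    simp +decide only [Fin.sum_univ_four, dualForm, if_true, if_false, s0, s1, s2, s3] at e1
    simp +decide only [Fin.sum_univ_four, dualForm, if_true, if_false, s0, s1, s2, s3, t0, t1]
      at e3
    norm_num at e1 e3
    refine ⟨?_, e3.symm⟩
    linear_combination (-s / 2) * e1 - (fr2 B (covd G V a y) 2 3) * hs + s * s / 2 * e2
  have key' : ∀ a j, j = 0 ∨ j = 1 → fr2 B (covd G V a y) 2 j
      = s * fr2 B (covd G (fun z => G z * timelikeProj G U z) a y) 3 j ∧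
      fr2 B (covd G V a y) 3 j
      = -s * fr2 B (covd G (fun z => G z * timelikeProj G U z) a y) 2 j := fun a j hj => by
    have e1 := hn a 2 j
    have e2 := hn a 3 j
    rcases hj with rfl | rfl <;>
    · simp +decide only [Fin.sum_univ_four, dualForm, if_true, if_false, s0, s1, s2, s3]
        at e1 e2
      norm_num at e1 e2
      rw [e1, e2]
      constructor
      · linear_combination (-fr2 B (covd G V a y) 2 _) * hs
      · linear_combination (-fr2 B (covd G V a y) 3 _) * hs
  refine ⟨fun i j => (fr3_congr_of_fr2 (fun a => hc a i j) k).trans (neg_one_mul _),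
    fr3_congr_of_fr2 (fun a => (key a).1) k, ?_,
    fr3_congr_of_fr2 (fun a => (key' a 0 (Or.inl rfl)).1) k,
    fr3_congr_of_fr2 (fun a => (key' a 1 (Or.inr rfl)).1) k,
    fr3_congr_of_fr2 (fun a => (key' a 0 (Or.inl rfl)).2) k,
    fr3_congr_of_fr2 (fun a => (key' a 1 (Or.inr rfl)).2) k⟩
  have := fr3_congr_of_fr2 (S := fun k a b => covd G V k y a b)
    (T := fun k a b => covd G V k y a b) (r := 0) (i' := 0) (j' := 0)
    (fun a => ((key a).2).trans (zero_mul _).symm) k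
  rw [zero_mul] at this
  exact this

end IsStructureOn

/-! ### The expansion and rotation forms, and Maxwell's equations -/

theorem IsOrientedFrame.eq_of_fr1 {g B : Matrix (Fin 4) (Fin 4) ℝ} {η : FourForm} {s : ℝ}
    (hB : IsOrientedFrame g B η s) {θ θ' : Fin 4 → ℝ} (h : ∀ i, fr1 B θ i = fr1 B θ' i) :
    θ = θ' := by
  have h1 := mul_eq_one_comm.1 hB.left_inv
  have h2 : ∀ θ : Fin 4 → ℝ, θ = Matrix.vecMul (Matrix.vecMul θ B) (minkowski * B.transpose * g) :=
    fun θ => by rw [Matrix.vecMul_vecMul, h1, Matrix.vecMul_one]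
  have h3 : ∀ θ : Fin 4 → ℝ, Matrix.vecMul θ B = fun i => fr1 B θ i := fun θ => by
    ext i
    simp only [Matrix.vecMul, dotProduct, fr1, ct, mul_comm]
  rw [h2 θ, h2 θ', h3, h3, funext h]

namespace IsStructureOn

variable {Ω : Set E4} {G U : E4 → Matrix (Fin 4) (Fin 4) ℝ} {η : E4 → FourForm}
  (h : IsStructureOn Ω G U η) (hu : IsUmbilicalSplitting Ω G (timelikeProj G U))
  {y : E4} {B : Matrix (Fin 4) (Fin 4) ℝ} {s : ℝ} (hB : IsOrientedFrame (G y) B (η y) s)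
  (hU : B.transpose * U y * B = canonicalForm)
include h hu hB hU

omit h in
theorem fr3_covd_proj (hy : y ∈ Ω) (k i j : Fin 4) :
    fr3 B (fun k a b => covd G (fun z => G z * timelikeProj G U z) k y a b) k i j
      = (if k = i then sgn k * tl k else 0) * fr1 B (fun a => meanForm G (timelikeProj G U) a y) j
        + (if k = j then sgn k * tl k else 0)
          * fr1 B (fun a => meanForm G (timelikeProj G U) a y) i
        - (if k = i then sgn k * (1 - tl k) else 0)
          * fr1 B (fun a => meanForm G (fun z => 1 - timelikeProj G U z) a y) j
        - (if k = j then sgn k * (1 - tl k) else 0)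
          * fr1 B (fun a => meanForm G (fun z => 1 - timelikeProj G U z) a y) i := by
  have ha := hB.adapted hU
  have h1 := hu.fr3_covd (B := B) hy k i j
  have h2 : ∀ i j, fr2 B (G y * timelikeProj G U y) i j = if i = j then sgn i * tl i else 0 :=
    ha.fr2_proj
  have h3 : ∀ i j, fr2 B (G y * (1 - timelikeProj G U y) : Matrix (Fin 4) (Fin 4) ℝ) i j
    = if i = j then sgn i * (1 - tl i) else 0 := ha.fr2_compl
  rw [h2, h2, h3, h3] at h1
  exact h1

omit h in
theorem fr1_meanForm_values (hy : y ∈ Ω) :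
    fr1 B (fun a => meanForm G (timelikeProj G U) a y) 0 = 0 ∧
    fr1 B (fun a => meanForm G (timelikeProj G U) a y) 1 = 0 ∧
    fr1 B (fun a => meanForm G (fun z => 1 - timelikeProj G U z) a y) 2 = 0 ∧
    fr1 B (fun a => meanForm G (fun z => 1 - timelikeProj G U z) a y) 3 = 0 := by
  have ha := hB.adapted hU
  obtain ⟨t0, t1, t2, t3⟩ := tl_values
  have e1 := hu.fr1_meanForm ha hy
  have e2 := hu.fr1_meanForm_compl ha hy
  have a0 := e1 0
  have a1 := e1 1
  have a2 := e2 2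
  have a3 := e2 3
  rw [t0, mul_one] at a0
  rw [t1, mul_one] at a1
  rw [t2, sub_zero, mul_one] at a2
  rw [t3, sub_zero, mul_one] at a3
  exact ⟨a0, a1, a2, a3⟩

/-- The codifferential of the canonical 2-form in an adapted frame. -/
theorem fr1_codiff_form (hy : y ∈ Ω) :
    fr1 B (fun b => codiff G U b y) 0
      = -2 * fr1 B (fun a => meanForm G (fun z => 1 - timelikeProj G U z) a y) 1 ∧
    fr1 B (fun b => codiff G U b y) 1
      = -2 * fr1 B (fun a => meanForm G (fun z => 1 - timelikeProj G U z) a y) 0 ∧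
    fr1 B (fun b => codiff G U b y) 2 = 0 ∧ fr1 B (fun b => codiff G U b y) 3 = 0 := by
  obtain ⟨s0, s1, s2, s3⟩ := sgn_values
  obtain ⟨t0, t1, t2, t3⟩ := tl_values
  obtain ⟨x0, x1, z2, z3⟩ := fr1_meanForm_values hu hB hU hy
  have hC := h.fr3_covd_form hB hU hy
  have hN := fr3_covd_proj hu hB hU hy
  simp only at hC
  have hd : ∀ k i, fr3 B (fun k a b => covd G U k y a b) k i i = 0 := fun k i => by
    linarith [(hC k).1 i i]
  have h10 := fun k => (hC k).1 0 1
  have h20 := fun k => (hC k).1 0 2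
  have h30 := fun k => (hC k).1 0 3
  have h21 := fun k => (hC k).1 1 2
  have h31 := fun k => (hC k).1 1 3
  have h32 := fun k => (hC k).1 2 3
  have h01 := fun k => (hC k).2.1
  have h23 := fun k => (hC k).2.2.1
  have h12 := fun k => (hC k).2.2.2.1
  have h13 := fun k => (hC k).2.2.2.2.1
  have h02 := fun k => (hC k).2.2.2.2.2.1
  have h03 := fun k => (hC k).2.2.2.2.2.2
  refine ⟨?_, ?_, ?_, ?_⟩ <;>
  · rw [hB.codiff_eq]
    simp only [Fin.sum_univ_four, hd, h10, h20, h30, h21, h31, h32, h01, h23, h12, h13, h02, h03,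
      hN]
    simp +decide only [if_true, if_false, s0, s1, s2, s3, t0, t1, t2, t3, x0, x1, z2, z3]
    ring

/-- The codifferential of the dual of the canonical 2-form in an adapted frame. -/
theorem fr1_codiff_dual (hy : y ∈ Ω) :
    fr1 B (fun b => codiff G (fun z => hodge (K := ℝ) (G z) (η z) (U z)) b y) 2
      = 2 * s * fr1 B (fun a => meanForm G (timelikeProj G U) a y) 3 ∧
    fr1 B (fun b => codiff G (fun z => hodge (K := ℝ) (G z) (η z) (U z)) b y) 3
      = -2 * s * fr1 B (fun a => meanForm G (timelikeProj G U) a y) 2 ∧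
    fr1 B (fun b => codiff G (fun z => hodge (K := ℝ) (G z) (η z) (U z)) b y) 0 = 0 ∧
    fr1 B (fun b => codiff G (fun z => hodge (K := ℝ) (G z) (η z) (U z)) b y) 1 = 0 := by
  obtain ⟨s0, s1, s2, s3⟩ := sgn_values
  obtain ⟨t0, t1, t2, t3⟩ := tl_values
  obtain ⟨x0, x1, z2, z3⟩ := fr1_meanForm_values hu hB hU hy
  have hC := h.fr3_covd_dual hB hU hy
  have hN := fr3_covd_proj hu hB hU hy
  simp only at hC
  have hd : ∀ k i, fr3 B (fun k a b => covd G (fun z => hodge (K := ℝ) (G z) (η z) (U z)) k y a b)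
      k i i = 0 := fun k i => by
    linarith [(hC k).1 i i]
  have h10 := fun k => (hC k).1 0 1
  have h02 := fun k => (hC k).1 2 0
  have h03 := fun k => (hC k).1 3 0
  have h12 := fun k => (hC k).1 2 1
  have h13 := fun k => (hC k).1 3 1
  have h32 := fun k => (hC k).1 2 3
  have h23 := fun k => (hC k).2.1
  have h01 := fun k => (hC k).2.2.1
  have h20 := fun k => (hC k).2.2.2.1
  have h21 := fun k => (hC k).2.2.2.2.1
  have h30 := fun k => (hC k).2.2.2.2.2.1
  have h31 := fun k => (hC k).2.2.2.2.2.2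
  refine ⟨?_, ?_, ?_, ?_⟩ <;>
  · rw [hB.codiff_eq]
    simp only [Fin.sum_univ_four, hd, h10, h20, h30, h12, h31, h32, h01, h23, h21, h13, h02, h03,
      hN]
    simp +decide only [if_true, if_false, s0, s1, s2, s3, t0, t1, t2, t3, x0, x1, z2, z3]
    ring

end IsStructureOn

/-! ### Φ and Ψ in terms of mean curvatures, and the Maxwell solution. -/

namespace IsStructureOn

variable {Ω : Set E4} {G U : E4 → Matrix (Fin 4) (Fin 4) ℝ} {η : E4 → FourForm}
  (h : IsStructureOn Ω G U η) (hu : IsUmbilicalSplitting Ω G (timelikeProj G U)) {y : E4}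
include h hu

/-- δU lies in V and is twice ζ turned by a quarter within V; δ*U lies in H and is twice ξ turned
within H. Applying U and *U turns them back, and the orientation sign enters squared. The factor 2
is the trace over a plane, as the mean curvature is normalized by ½. -/
theorem expansionForm_eq (hy : y ∈ Ω) (m : Fin 4) : expansionForm G η U m y
    = 2 * (meanForm G (timelikeProj G U) m y
      + meanForm G (fun z => 1 - timelikeProj G U z) m y) := by
  obtain ⟨B, s, hB, hU⟩ := h.frame y hy
  obtain ⟨s0, s1, s2, s3⟩ := sgn_values
  obtain ⟨x0, x1, z2, z3⟩ := fr1_meanForm_values hu hB hU hy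
  obtain ⟨a0, a1, a2, a3⟩ := h.fr1_codiff_form hu hB hU hy
  obtain ⟨b2, b3, b0, b1⟩ := h.fr1_codiff_dual hu hB hU hy
  have f1 : ∀ i j, fr2 B (U y) i j = canonicalForm i j := fun i j => by rw [fr2_eq, hU]
  have f2 : ∀ i j, fr2 B (hodge (K := ℝ) (G y) (η y) (U y)) i j = -(s * dualForm i j) :=
    fun i j => by rw [fr2_eq, hB.conj_hodge hU, leviCivita_eq]
  have hs := hB.sq
  refine congrFun (hB.eq_of_fr1 (θ := fun m => expansionForm G η U m y)
    (θ' := fun m => 2 * (meanForm G (timelikeProj G U) m y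
      + meanForm G (fun z => 1 - timelikeProj G U z) m y)) fun i => ?_) m
  have e1 : fr1 B (fun m => 2 * (meanForm G (timelikeProj G U) m y
      + meanForm G (fun z => 1 - timelikeProj G U z) m y)) i
      = 2 * (fr1 B (fun a => meanForm G (timelikeProj G U) a y) i
        + fr1 B (fun a => meanForm G (fun z => 1 - timelikeProj G U z) a y) i) := by
    simp only [fr1, ct_const_mul, ct_add]
  have e2 : fr1 B (fun m => expansionForm G η U m y) i
      = ∑ j, sgn j * -(s * dualForm i j)
          * fr1 B (fun b => codiff G (fun z => hodge (K := ℝ) (G z) (η z) (U z)) b y) j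
        - ∑ j, sgn j * canonicalForm i j * fr1 B (fun b => codiff G U b y) j := by
    simp only [← f1, ← f2]
    rw [← hB.fr1_applyForm, ← hB.fr1_applyForm]
    simp only [expansionForm, fr1, ct_sub]
  rw [e1, e2]
  simp only [Fin.sum_univ_four, a0, a1, a2, a3, b0, b1, b2, b3, s0, s1, s2, s3]
  match i with
  | 0 => simp +decide [canonicalForm, dualForm, x0]
  | 1 => simp +decide [canonicalForm, dualForm, x1]
  | 2 =>
    simp +decide [canonicalForm, dualForm, z2]
    linear_combination 2 * fr1 B (fun a => meanForm G (timelikeProj G U) a y) 2 * hs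
  | 3 =>
    simp +decide [canonicalForm, dualForm, z3]
    linear_combination 2 * fr1 B (fun a => meanForm G (timelikeProj G U) a y) 3 * hs

/-- Here each form is applied to a codifferential in its own kernel: *U to δU in V, and U to δ*U in
H. -/
theorem rotationForm_eq (hy : y ∈ Ω) (m : Fin 4) : rotationForm G η U m y = 0 := by
  obtain ⟨B, s, hB, hU⟩ := h.frame y hy
  obtain ⟨-, -, a2, a3⟩ := h.fr1_codiff_form hu hB hU hy
  obtain ⟨-, -, b0, b1⟩ := h.fr1_codiff_dual hu hB hU hy
  have f1 : ∀ i j, fr2 B (U y) i j = canonicalForm i j := fun i j => by rw [fr2_eq, hU]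
  have f2 : ∀ i j, fr2 B (hodge (K := ℝ) (G y) (η y) (U y)) i j = -(s * dualForm i j) :=
    fun i j => by rw [fr2_eq, hB.conj_hodge hU, leviCivita_eq]
  refine congrFun (hB.eq_of_fr1 (θ := fun m => rotationForm G η U m y)
    (θ' := fun m => 0) fun i => ?_) m
  have e2 : fr1 B (fun m => rotationForm G η U m y) i
      = ∑ j, sgn j * -(s * dualForm i j) * fr1 B (fun b => codiff G U b y) j
        + ∑ j, sgn j * canonicalForm i j
          * fr1 B (fun b => codiff G (fun z => hodge (K := ℝ) (G z) (η z) (U z)) b y) j := by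
    simp only [← f1, ← f2]
    rw [← hB.fr1_applyForm, ← hB.fr1_applyForm]
    simp only [rotationForm, fr1, ct_add]
  have e0 : fr1 B (fun _ => 0) i = 0 := by simp [fr1, ct]
  rw [e2, e0]
  simp only [Fin.sum_univ_four, a2, a3, b0, b1]
  fin_cases i <;> simp +decide [canonicalForm, dualForm]

omit h hu in
/-- The codifferential of a multiple of a 2-form. -/
theorem codiff_smul {f : E4 → ℝ} {F : E4 → Matrix (Fin 4) (Fin 4) ℝ} {Ω' : Set E4}
    (hΩ' : IsOpen Ω') (hf : ContDiffOn ℝ ∞ f Ω') (hF : SmoothMat Ω' F) (hy : y ∈ Ω')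
    (b : Fin 4) : codiff G (fun z => f z • F z) b y
      = f y * codiff G F b y - ∑ a, ∑ c, (G y)⁻¹ a c * (pd c f y * F y a b) := by
  have e : ∀ a c, pd c (fun z => f z * F z a b) y
      = pd c f y * F y a b + f y * pd c (fun z => F z a b) y :=
    fun a c => pd_mul hΩ' hf (hF a b) hy c
  simp only [codiff, Matrix.smul_apply, smul_eq_mul, mul_neg, Finset.mul_sum, e]
  rw [← neg_add', ← Finset.sum_add_distrib]
  congr 1
  refine Finset.sum_congr rfl fun a _ => ?_
  rw [← Finset.sum_add_distrib]
  refine Finset.sum_congr rfl fun c _ => ?_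
  have : ∑ n, (christoffel G n c a y * (f y * F y n b) + christoffel G n c b y * (f y * F y a n))
      = f y * ∑ n, (christoffel G n c a y * F y n b + christoffel G n c b y * F y a n) := by
    rw [Finset.mul_sum]
    exact Finset.sum_congr rfl fun n _ => by ring
  rw [this]
  ring

/-- The rotated 2-form solves Maxwell's equations. -/
theorem maxwell {φ : E4 → ℝ} {Ω' : Set E4} (hΩ' : IsOpen Ω') (hsub : Ω' ⊆ Ω)
    (hφ : ContDiffOn ℝ ∞ φ Ω') (hd : ∀ z ∈ Ω', ∀ k, pd k φ z = expansionForm G η U k z)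
    (hy : y ∈ Ω') (b : Fin 4) :
    codiff G (fun z => Real.exp (φ z) • U z) b y = 0 ∧
    codiff G (fun z => Real.exp (φ z) • hodge (K := ℝ) (G z) (η z) (U z)) b y = 0 := by
  obtain ⟨B, s, hB, hU⟩ := h.frame y (hsub hy)
  obtain ⟨s0, s1, s2, s3⟩ := sgn_values
  obtain ⟨x0, x1, z2, z3⟩ := fr1_meanForm_values hu hB hU (hsub hy)
  obtain ⟨a0, a1, a2, a3⟩ := h.fr1_codiff_form hu hB hU (hsub hy)
  obtain ⟨b2, b3, b0, b1⟩ := h.fr1_codiff_dual hu hB hU (hsub hy)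
  have f1 : ∀ i j, fr2 B (U y) i j = canonicalForm i j := fun i j => by rw [fr2_eq, hU]
  have f2 : ∀ i j, fr2 B (hodge (K := ℝ) (G y) (η y) (U y)) i j = -(s * dualForm i j) :=
    fun i j => by rw [fr2_eq, hB.conj_hodge hU, leviCivita_eq]
  have hexp : ∀ c, pd c (fun z => Real.exp (φ z)) y = Real.exp (φ y) * pd c φ y := fun c => by
    have := (hφ.differentiableAt_of_isOpen hΩ' hy).hasFDerivAt.exp.fderiv
    simp only [pd, this]
    rfl
  have hgrad : ∀ i, fr1 B (fun c => pd c (fun z => Real.exp (φ z)) y) i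
      = Real.exp (φ y) * (2 * (fr1 B (fun a => meanForm G (timelikeProj G U) a y) i
        + fr1 B (fun a => meanForm G (fun z => 1 - timelikeProj G U z) a y) i)) := fun i => by
    simp only [hexp, hd y hy, h.expansionForm_eq hu (hsub hy), fr1, ct_const_mul, ct_add]
  have hsm : ∀ {F : E4 → Matrix (Fin 4) (Fin 4) ℝ}, SmoothMat Ω F → SmoothMat Ω' F :=
    fun hF a b => (hF a b).mono hsub
  -- The Leibniz rule for δ(e^φ F) in the frame. The gradient term contains 2(ξ + ζ), of which U
  -- retains ζ and *U retains ξ, exactly cancelling the codifferentials.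
  have key : ∀ {F : E4 → Matrix (Fin 4) (Fin 4) ℝ}, SmoothMat Ω F →
      ∀ i, fr1 B (fun b => codiff G (fun z => Real.exp (φ z) • F z) b y) i
        = Real.exp (φ y) * fr1 B (fun b => codiff G F b y) i
          - ∑ j, sgn j * fr1 B (fun c => pd c (fun z => Real.exp (φ z)) y) j * fr2 B (F y) j i :=
    fun {F} hF i => by
      have e : ∀ b, ∑ a, ∑ c, (G y)⁻¹ a c * (pd c (fun z => Real.exp (φ z)) y * F y a b)
          = ∑ j, sgn j * (fr1 B (fun c => pd c (fun z => Real.exp (φ z)) y) j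
            * fr1 B (fun a => F y a b) j) := fun b => by
        rw [hB.sum_inv_mul fun c a => pd c (fun z => Real.exp (φ z)) y * F y a b]
        simp only [fr2, fr1, ct_const_mul, ct_mul_const]
      have e' : (fun b => codiff G (fun z => Real.exp (φ z) • F z) b y) = fun b =>
          Real.exp (φ y) * codiff G F b y - ∑ j, sgn j *
            (fr1 B (fun c => pd c (fun z => Real.exp (φ z)) y) j * fr1 B (fun a => F y a b) j) := by
        ext b
        rw [codiff_smul hΩ' hφ.exp (hsm hF) hy, e]
      rw [e']
      simp only [fr1, ct_sub, ct_const_mul, ct_sum]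
      congr 1
      refine Finset.sum_congr rfl fun j _ => ?_
      rw [mul_assoc]
      congr 2
      simp only [fr2, fr1]
      rw [ct_comm]
  constructor
  · refine congrFun (hB.eq_of_fr1 (θ := fun b => codiff G (fun z => Real.exp (φ z) • U z) b y)
      (θ' := fun _ => 0) fun i => ?_) b
    rw [key h.smooth_form]
    have e0 : fr1 B (fun _ => 0) i = 0 := by simp [fr1, ct]
    simp only [e0, hgrad, f1, Fin.sum_univ_four, s0, s1, s2, s3]
    match i with
    | 0 => simp +decide [canonicalForm, a0, x1]
    | 1 => simp +decide [canonicalForm, a1, x0]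
    | 2 => simp +decide [canonicalForm, a2]
    | 3 => simp +decide [canonicalForm, a3]
  · refine congrFun (hB.eq_of_fr1 (θ := fun b => codiff G (fun z => Real.exp (φ z) •
      hodge (K := ℝ) (G z) (η z) (U z)) b y) (θ' := fun _ => 0) fun i => ?_) b
    rw [key (h.smooth_hodge h.smooth_form)]
    have e0 : fr1 B (fun _ => 0) i = 0 := by simp [fr1, ct]
    simp only [e0, hgrad, f2, Fin.sum_univ_four, s0, s1, s2, s3]
    match i with
    | 0 => simp +decide [dualForm, b0]
    | 1 => simp +decide [dualForm, b1]
    | 2 =>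
      simp +decide [dualForm, b2, z3]
      ring
    | 3 =>
      simp +decide [dualForm, b3, z2]
      ring

end IsStructureOn

/-! ### From the manifold to charts -/

/-- The Poincaré lemma: the components are assembled into a map to the dual space, and closedness is
the symmetry of its derivative. Smoothness of the primitive follows from that of its derivative. -/
theorem exists_potential {s : Set E4} (hs : Convex ℝ s) (hso : IsOpen s) {Θ : Fin 4 → E4 → ℝ}
    (hΘ : ∀ k, ContDiffOn ℝ ∞ (Θ k) s)
    (hd : ∀ z ∈ s, ∀ a b, pd a (Θ b) z = pd b (Θ a) z) :
    ∃ f : E4 → ℝ, ContDiffOn ℝ ∞ f s ∧ ∀ z ∈ s, ∀ k, pd k f z = Θ k z := by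
  let α : E4 → E4 →L[ℝ] ℝ := fun z => ∑ k, Θ k z • (EuclideanSpace.proj k : E4 →L[ℝ] ℝ)
  have hα : ContDiffOn ℝ ∞ α s := ContDiffOn.sum fun k _ => (hΘ k).smul contDiffOn_const
  have hdα : ∀ z ∈ s, ∀ x y, fderiv ℝ α z x y = ∑ k, ∑ l, x l * pd l (Θ k) z * y k := by
    intro z hz x y
    have h1 : HasFDerivAt α (∑ k, (fderiv ℝ (Θ k) z).smulRight
        (EuclideanSpace.proj k : E4 →L[ℝ] ℝ)) z :=
      HasFDerivAt.fun_sum fun k _ =>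
        (((hΘ k).differentiableAt_of_isOpen hso hz).hasFDerivAt).smul_const
          (EuclideanSpace.proj k : E4 →L[ℝ] ℝ)
    rw [h1.fderiv]
    simp only [_root_.sum_apply, ContinuousLinearMap.smulRight_apply,
      _root_.smul_apply, smul_eq_mul, fderiv_apply_eq_sum_pd, Finset.sum_mul]
    rfl
  obtain ⟨f, hf⟩ := hs.exists_forall_hasFDerivAt_of_fderiv_symmetric hso
    (hα.differentiableOn (by simp)) fun z hz x y => by
      rw [hdα z hz, hdα z hz, Finset.sum_comm]
      exact Finset.sum_congr rfl fun k _ => Finset.sum_congr rfl fun l _ => by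
        rw [hd z hz k l]; ring
  refine ⟨f, ?_, fun z hz k => ?_⟩
  · rw [contDiffOn_infty_iff_fderiv_of_isOpen hso]
    exact ⟨fun z hz => (hf z hz).differentiableAt.differentiableWithinAt,
      hα.congr fun z hz => (hf z hz).fderiv⟩
  · rw [pd, (hf z hz).fderiv]
    simp [α]

/-! ### Alternating 4-forms on a frame and the Levi-Civita symbol. -/

section Alternating

variable {N : Type*} [AddCommGroup N] [Module ℝ N]

/-- Reindexing multiplies every alternating form by the same sign, or gives zero if an index is
repeated. So any form with a known value can be used to compute the factor. -/
theorem alternating_mul_det (f : N [⋀^Fin 4]→ₗ[ℝ] ℝ) (b : Fin 4 → N) (σ : Fin 4 → Fin 4)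
    (f' : (Fin 4 → ℝ) [⋀^Fin 4]→ₗ[ℝ] ℝ) (b' : Fin 4 → Fin 4 → ℝ) :
    f (b ∘ σ) * f' b' = f b * f' (b' ∘ σ) := by
  by_cases hσ : Function.Injective σ
  · have h : ∃ τ : Equiv.Perm (Fin 4), σ = τ :=
      ⟨Equiv.ofBijective σ (Finite.injective_iff_bijective.1 hσ), rfl⟩
    obtain ⟨τ, rfl⟩ := h
    rw [f.map_perm, f'.map_perm, smul_mul_assoc, mul_smul_comm]
  · rw [f.map_eq_zero_of_not_injective (b ∘ σ) fun h => hσ h.of_comp,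
      f'.map_eq_zero_of_not_injective (b' ∘ σ) fun h => hσ h.of_comp, zero_mul, mul_zero]

theorem alternating_eq_leviCivita (f : N [⋀^Fin 4]→ₗ[ℝ] ℝ) (b : Fin 4 → N) (i j k l : Fin 4) :
    f ![b i, b j, b k, b l] = f b * leviCivita i j k l := by
  -- The Vandermonde determinant with nodes 0, 1, 2, 3 is the comparison form: its reindexed value
  -- is the product of differences in `leviCivita`, and its own value is 12, the normalizing
  -- constant there.
  have h := alternating_mul_det f b ![i, j, k, l] Matrix.detRowAlternating
    (Matrix.vandermonde fun a : Fin 4 => ((a : ℕ) : ℝ))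
  have e1 : b ∘ ![i, j, k, l] = ![b i, b j, b k, b l] := by
    ext m
    fin_cases m <;> rfl
  have e2 : ∀ σ : Fin 4 → Fin 4, Matrix.detRowAlternating
      ((Matrix.vandermonde fun a : Fin 4 => ((a : ℕ) : ℝ)) ∘ σ)
      = 12 * leviCivita (σ 0) (σ 1) (σ 2) (σ 3) := fun σ => by
    change (Matrix.vandermonde fun a : Fin 4 => ((σ a : ℕ) : ℝ)).det = _
    rw [Matrix.det_vandermonde]
    have h0 : Finset.Ioi (0 : Fin 4) = {1, 2, 3} := by decide
    have h1 : Finset.Ioi (1 : Fin 4) = {2, 3} := by decide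
    have h2 : Finset.Ioi (2 : Fin 4) = {3} := by decide
    have h3 : Finset.Ioi (3 : Fin 4) = ∅ := by decide
    rw [Fin.prod_univ_four, h0, h1, h2, h3, Finset.prod_insert (by decide),
      Finset.prod_insert (by decide), Finset.prod_insert (by decide), Finset.prod_singleton,
      Finset.prod_singleton, Finset.prod_singleton, Finset.prod_empty, leviCivita]
    ring
  have e3 := e2 ![i, j, k, l]
  have e4 : Matrix.detRowAlternating (Matrix.vandermonde fun a : Fin 4 => ((a : ℕ) : ℝ))
      = 12 * leviCivita 0 1 2 3 := e2 id
  have e5 : leviCivita 0 1 2 3 = 1 := by norm_num [leviCivita]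
  rw [e1, e3, e4, e5] at h
  have e6 : leviCivita (![i, j, k, l] 0) (![i, j, k, l] 1) (![i, j, k, l] 2) (![i, j, k, l] 3)
    = leviCivita i j k l := rfl
  rw [e6] at h
  linarith

theorem alternating_sum (f : N [⋀^Fin 4]→ₗ[ℝ] ℝ) (c : Fin 4 → N)
    (B : Matrix (Fin 4) (Fin 4) ℝ) (i j k l : Fin 4) :
    fr4 B (fun a b m n => f ![c a, c b, c m, c n]) i j k l
      = f ![∑ a, B a i • c a, ∑ a, B a j • c a, ∑ a, B a k • c a, ∑ a, B a l • c a] := by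
  have key : ∀ (v : Fin 4 → N) (m : Fin 4) (β : Fin 4 → ℝ),
      ct β (fun a => f (Function.update v m (c a)))
        = f (Function.update v m (∑ a, β a • c a)) := fun v m β => by
    have h := map_sum (f.toMultilinearMap.toLinearMap v m) (fun a => β a • c a) Finset.univ
    simp only [map_smul, smul_eq_mul] at h
    exact h.symm
  have k0 : ∀ (x y z : N) (β : Fin 4 → ℝ), ct β (fun a => f ![c a, x, y, z])
      = f ![∑ a, β a • c a, x, y, z] := fun x y z β => by
    have e : ∀ w, ![w, x, y, z] = Function.update ![0, x, y, z] 0 w := fun w => by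
      ext m; fin_cases m <;> rfl
    exact (congrArg (ct β) (funext fun a => congrArg f (e (c a)))).trans
      ((key _ _ β).trans (congrArg f (e _).symm))
  have k1 : ∀ (x y z : N) (β : Fin 4 → ℝ), ct β (fun a => f ![x, c a, y, z])
      = f ![x, ∑ a, β a • c a, y, z] := fun x y z β => by
    have e : ∀ w, ![x, w, y, z] = Function.update ![x, 0, y, z] 1 w := fun w => by
      ext m; fin_cases m <;> rfl
    exact (congrArg (ct β) (funext fun a => congrArg f (e (c a)))).trans
      ((key _ _ β).trans (congrArg f (e _).symm))
  have k2 : ∀ (x y z : N) (β : Fin 4 → ℝ), ct β (fun a => f ![x, y, c a, z])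
      = f ![x, y, ∑ a, β a • c a, z] := fun x y z β => by
    have e : ∀ w, ![x, y, w, z] = Function.update ![x, y, 0, z] 2 w := fun w => by
      ext m; fin_cases m <;> rfl
    exact (congrArg (ct β) (funext fun a => congrArg f (e (c a)))).trans
      ((key _ _ β).trans (congrArg f (e _).symm))
  have k3 : ∀ (x y z : N) (β : Fin 4 → ℝ), ct β (fun a => f ![x, y, z, c a])
      = f ![x, y, z, ∑ a, β a • c a] := fun x y z β => by
    have e : ∀ w, ![x, y, z, w] = Function.update ![x, y, z, 0] 3 w := fun w => by
      ext m; fin_cases m <;> rfl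
    exact (congrArg (ct β) (funext fun a => congrArg f (e (c a)))).trans
      ((key _ _ β).trans (congrArg f (e _).symm))
  simp only [fr4, fr3, fr2, fr1, k0, k1, k2, k3]

theorem bilinear_sum (f : N →ₗ[ℝ] N →ₗ[ℝ] ℝ) (c : Fin 4 → N) (B : Matrix (Fin 4) (Fin 4) ℝ)
    (i j : Fin 4) : fr2 B (fun a b => f (c a) (c b)) i j
      = f (∑ a, B a i • c a) (∑ a, B a j • c a) := by
  simp only [fr2, fr1, ct, map_sum, map_smul, LinearMap.sum_apply, LinearMap.smul_apply,
    smul_eq_mul, Finset.mul_sum]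
  rw [Finset.sum_comm]
  exact Finset.sum_congr rfl fun a _ => Finset.sum_congr rfl fun b _ => by ring

end Alternating

section Manifold

variable {M : Type*} [TopologicalSpace M] [ChartedSpace E4 M]

theorem mdifferentiable_of_mem_maximalAtlas {e : OpenPartialHomeomorph M E4}
    (he : e ∈ IsManifold.maximalAtlas (𝓡 4) ∞ M) : e.MDifferentiable (𝓡 4) (𝓡 4) :=
  ⟨(contMDiffOn_of_mem_maximalAtlas he).mdifferentiableOn (by simp),
    (contMDiffOn_symm_of_mem_maximalAtlas he).mdifferentiableOn (by simp)⟩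

/-- The derivative of a chart is surjective, so pointwise orthonormal frames can be written in
coordinates. No smooth dependence of the frame on the point is needed. -/
theorem exists_eq_sum_coordVec {e : OpenPartialHomeomorph M E4}
    (he : e ∈ IsManifold.maximalAtlas (𝓡 4) ∞ M) {y : E4} (hy : y ∈ e.target)
    (b : Fin 4 → TangentSpace (𝓡 4) (e.symm y)) :
    ∃ B : Matrix (Fin 4) (Fin 4) ℝ, ∀ i, b i = ∑ a, B a i • coordVec e y a := by
  have hs : ∀ i, ∃ w : E4, mfderiv (𝓡 4) (𝓡 4) e.symm y w = b i := fun i =>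
    (mdifferentiable_of_mem_maximalAtlas he).symm.mfderiv_surjective (x := y) hy (b i)
  choose w hw using hs
  refine ⟨fun a i => w i a, fun i => ?_⟩
  have e1 : w i = ∑ a, w i a • (EuclideanSpace.single a (1 : ℝ) : E4) := by
    ext m
    simp [Finset.sum_apply, Pi.single_apply]
  calc b i = mfderiv (𝓡 4) (𝓡 4) e.symm y (w i) := (hw i).symm
    _ = mfderiv (𝓡 4) (𝓡 4) e.symm y (∑ a, w i a • (EuclideanSpace.single a (1 : ℝ) : E4)) :=
      congrArg _ e1
    _ = _ := by
      refine (map_sum (mfderiv (𝓡 4) (𝓡 4) e.symm y) _ _).trans ?_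
      exact Finset.sum_congr rfl fun a _ => map_smul (mfderiv (𝓡 4) (𝓡 4) e.symm y) _ _

variable {S : SpaceTime M} (T : TwoPlusTwo S)

/-- The frame from `unitary` need not be positively oriented; the sign `s` is the value of the
volume element on it. -/
theorem TwoPlusTwo.isStructureOn {e : OpenPartialHomeomorph M E4}
    (he : e ∈ IsManifold.maximalAtlas (𝓡 4) ∞ M) :
    IsStructureOn e.target (S.gc e) (T.Uc e) (S.ηc e) where
  isOpen := e.open_target
  smooth_metric := S.smooth_g e he
  smooth_form := T.smooth_U e he
  smooth_volume := S.smooth_η e he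
  frame y hy := by
    obtain ⟨b, hb, hUb⟩ := T.unitary (e.symm y)
    obtain ⟨B, hB⟩ := exists_eq_sum_coordVec he hy b
    refine ⟨B, S.η (e.symm y) b, ⟨?_, fun i j k l => ?_, ?_⟩, ?_⟩
    · ext i j
      rw [← fr2_eq, ← hb, hB i, hB j]
      exact bilinear_sum (S.g (e.symm y)) (coordVec e y) B i j
    · rw [← alternating_eq_leviCivita, hB i, hB j, hB k, hB l]
      exact alternating_sum (S.η (e.symm y)) (coordVec e y) B i j k l
    · rcases S.volume (e.symm y) b hb with h | h <;> rw [h] <;> norm_num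
    · ext i j
      rw [← fr2_eq]
      refine (bilinear_sum (T.U (e.symm y)) (coordVec e y) B i j).trans ?_
      rw [← hB i, ← hB j, hUb]
      rfl

variable {T}

theorem TwoPlusTwo.isUmbilicalSplitting (hUmb : T.IsUmbilical) (hInt : T.IsIntegrable)
    {e : OpenPartialHomeomorph M E4} (he : e ∈ IsManifold.maximalAtlas (𝓡 4) ∞ M) :
    IsUmbilicalSplitting e.target (S.gc e) (timelikeProj (S.gc e) (T.Uc e)) where
  toIsSplitting := (T.isStructureOn he).isSplitting
  antisymm z hz a b c := (hInt e he z hz a b c).1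
  antisymm' z hz a b c := (hInt e he z hz a b c).2
  traceless z hz a b c := (hUmb e he z hz a b c).1
  traceless' z hz a b c := (hUmb e he z hz a b c).2

end Manifold

/-! ### The principal and Maxwellian properties -/

/-- U - i*U is self-dual because ** = -1 on 2-forms. In the adapted frame U has only the component
01 and *U only 23, so the coordinates 02 and 03 vanish, which is the form in which `typeD`
recognizes the principal bivector. -/
theorem IsOrientedFrame.sdBivector_mem {g B : Matrix (Fin 4) (Fin 4) ℝ} {η : FourForm} {s : ℝ}
    (hB : IsOrientedFrame g B η s) {U : Matrix (Fin 4) (Fin 4) ℝ}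
    (hU : B.transpose * U * B = canonicalForm) :
    sdBivector g η U ∈ sdBivectors g η ∧ frC B (sdBivector g η U) 0 2 = 0 ∧
      frC B (sdBivector g η U) 0 3 = 0 := by
  have e : sdBivector g η U
      = ((1 / √2 : ℝ) : ℂ) • (cx U - Complex.I • cx (hodge (K := ℝ) g η U)) := rfl
  have hUa : (cx U).transpose = -cx U := by
    rw [← cx_transpose, hB.form_antisymm hU]
    ext i j
    simp [cx]
  have hmem : cx U - Complex.I • cx (hodge (K := ℝ) g η U) ∈ sdBivectors g η := by
    rw [cx_hodge]
    refine ⟨?_, ?_⟩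
    · rw [Matrix.transpose_sub, Matrix.transpose_smul, hUa, hB.hodge_antisymm]
      simp only [smul_neg, neg_sub, sub_neg_eq_add]
      abel
    · have hsub : ∀ A C : Matrix (Fin 4) (Fin 4) ℂ,
          hodge g η (A - Complex.I • C) = hodge g η A - Complex.I • hodge g η C := fun A C => by
        simp only [hodge_complex, ← act_ofReal, map_sub, map_smul]
      rw [hsub, hB.hodge_hodge hUa, smul_sub, smul_smul, Complex.I_mul_I, neg_one_smul, smul_neg]
      abel
  have hfr : ∀ i j, frC B (sdBivector g η U) i j = ((1 / √2 : ℝ) : ℂ)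
      * ((canonicalForm i j : ℝ) - Complex.I * ((-(s * leviCivita i j 0 1) : ℝ) : ℂ)) :=
    fun i j => by
      rw [e, frC_smul, sub_eq_add_neg, frC_add, ← neg_smul, frC_smul]
      simp only [Matrix.smul_apply, Matrix.add_apply, smul_eq_mul]
      rw [frC_cx, frC_cx, hU, hB.conj_hodge hU]
      ring
  rw [hfr, hfr, leviCivita_eq, leviCivita_eq, e]
  refine ⟨Submodule.smul_mem _ _ hmem, ?_, ?_⟩ <;> simp +decide [canonicalForm, dualForm]

theorem IsUmbilicalSplitting.smooth_expansionForm {Ω : Set E4}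
    {G U : E4 → Matrix (Fin 4) (Fin 4) ℝ} {η : E4 → FourForm} (h : IsStructureOn Ω G U η)
    (hu : IsUmbilicalSplitting Ω G (timelikeProj G U)) (m : Fin 4) :
    ContDiffOn ℝ ∞ (expansionForm G η U m) Ω :=
  (contDiffOn_const.mul ((hu.smooth_meanForm m).add (hu.compl.smooth_meanForm m))).congr
    fun _ hz => h.expansionForm_eq hu hz m

section Manifold

variable {M : Type*} [TopologicalSpace M] [ChartedSpace E4 M] {S : SpaceTime M}
  {T : TwoPlusTwo S} (hUmb : T.IsUmbilical) (hInt : T.IsIntegrable)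
include hUmb hInt

namespace TwoPlusTwo

theorem typeD_pointwise {e : OpenPartialHomeomorph M E4}
    (he : e ∈ IsManifold.maximalAtlas (𝓡 4) ∞ M) {y : E4} (hy : y ∈ e.target) {ρ : ℂ} (hρ : ρ ≠ 0)
    (h2 : Module.finrank ℂ (S.weylEigenspace e y ρ) = 2)
    (h1 : Module.finrank ℂ (S.weylEigenspace e y (-2 * ρ)) = 1) :
    (∀ σ, S.weylEigenspace e y σ ≠ ⊥ → σ.im = 0) ∧
    sdBivector (S.gc e y) (S.ηc e y) (T.Uc e y) ∈ S.weylEigenspace e y (-2 * ρ) ∧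
    ∀ a b, pd a (T.Φ e b) y = pd b (T.Φ e a) y := by
  have h := T.isStructureOn he
  have hu := isUmbilicalSplitting hUmb hInt he
  obtain ⟨B, s, hB, hU⟩ := h.frame y hy
  obtain ⟨c1, c2, c3⟩ := hu.typeD (hB.adapted hU) hy hB hρ h2 h1
  obtain ⟨m1, m2, m3⟩ := hB.sdBivector_mem hU
  refine ⟨c1, c2 _ m1 m2 m3, fun a b => ?_⟩
  have key : ∀ a b, pd a (T.Φ e b) y = 2 * pd a (fun z =>
      meanForm (S.gc e) (timelikeProj (S.gc e) (T.Uc e)) b z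
        + meanForm (S.gc e) (fun z => 1 - timelikeProj (S.gc e) (T.Uc e) z) b z) y := fun a b => by
    have e1 := pd_congr h.isOpen (f := T.Φ e b) (fun z hz => h.expansionForm_eq hu hz b) hy a
    have e2 := pd_mul h.isOpen (f := fun _ => (2 : ℝ)) contDiffOn_const
      ((hu.smooth_meanForm b).add (hu.compl.smooth_meanForm b)) hy a
    rw [e1]
    refine e2.trans ?_
    rw [pd_const, zero_mul, zero_add]
  rw [key, key, c3]

theorem hasRealWeylEigenvalues (hD : S.IsTypeD) : S.HasRealWeylEigenvalues :=
  fun e he y hy σ hσ => by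
    obtain ⟨ρ, hρ, h2, h1⟩ := hD e he y hy
    exact (typeD_pointwise hUmb hInt he hy hρ h2 h1).1 σ hσ

theorem isPrincipal (hD : S.IsTypeD) : T.IsPrincipal := fun e he y hy => by
  obtain ⟨ρ, hρ, h2, h1⟩ := hD e he y hy
  exact ⟨ρ, hρ, h2, h1, (typeD_pointwise hUmb hInt he hy hρ h2 h1).2.1⟩

theorem hasClosedForms (hD : S.IsTypeD) : T.HasClosedForms := fun e he y hy a b => by
  obtain ⟨ρ, hρ, h2, h1⟩ := hD e he y hy
  refine ⟨(typeD_pointwise hUmb hInt he hy hρ h2 h1).2.2 a b, ?_⟩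
  have h := T.isStructureOn he
  have hu := isUmbilicalSplitting hUmb hInt he
  have key : ∀ a b, pd a (T.Ψ e b) y = 0 := fun a b =>
    (pd_congr h.isOpen (fun z hz => h.rotationForm_eq hu hz b) hy a).trans (pd_const 0 a)
  rw [key, key]

theorem exists_isPotential (hD : S.IsTypeD) {e : OpenPartialHomeomorph M E4}
    (he : e ∈ IsManifold.maximalAtlas (𝓡 4) ∞ M) {p : M} (hp : p ∈ e.source) :
    ∃ (O : Set M) (φ : M → ℝ), p ∈ O ∧ T.IsPotential e O φ := by
  have h := T.isStructureOn he
  have hu := isUmbilicalSplitting hUmb hInt he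
  obtain ⟨r, hr, hball⟩ := Metric.isOpen_iff.1 e.open_target (e p) (e.map_source hp)
  obtain ⟨f, hf, hfd⟩ := exists_potential (convex_ball (e p) r) Metric.isOpen_ball
    (Θ := T.Φ e) (fun k => (hu.smooth_expansionForm h k).mono hball)
    (fun z hz a b => (hasClosedForms hUmb hInt hD e he z (hball hz) a b).1)
  refine ⟨e.source ∩ e ⁻¹' Metric.ball (e p) r, fun x => f (e x),
    ⟨hp, Metric.mem_ball_self hr⟩, e.isOpen_inter_preimage Metric.isOpen_ball,
    Set.inter_subset_left, ?_, fun y hy hyO k => ?_⟩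
  · have h1 : ContMDiffOn (𝓡 4) 𝓘(ℝ) ∞ f (Metric.ball (e p) r) := hf.contMDiffOn
    exact h1.comp ((contMDiffOn_of_mem_maximalAtlas he).mono Set.inter_subset_left)
      fun x hx => hx.2
  · have hyb : y ∈ Metric.ball (e p) r := by
      have := hyO.2
      rwa [Set.mem_preimage, e.right_inv hy] at this
    rw [← hfd y hyb k]
    exact pd_congr Metric.isOpen_ball
      (fun z hz => congrArg f (e.right_inv (hball hz))) hyb k

omit hUmb hInt in
theorem IsPotential.contDiffOn {e : OpenPartialHomeomorph M E4}
    (he : e ∈ IsManifold.maximalAtlas (𝓡 4) ∞ M) {O : Set M} {φ : M → ℝ}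
    (h : T.IsPotential e O φ) :
    ContDiffOn ℝ ∞ (fun z => φ (e.symm z)) (e.target ∩ e.symm ⁻¹' O) := by
  have h1 : ContMDiffOn (𝓡 4) 𝓘(ℝ) ∞ (φ ∘ e.symm) (e.target ∩ e.symm ⁻¹' O) :=
    h.2.2.1.comp ((contMDiffOn_symm_of_mem_maximalAtlas he).mono Set.inter_subset_left)
      fun x hx => hx.2
  exact h1.contDiffOn

theorem isMaxwellian (hD : S.IsTypeD) : T.IsMaxwellian := fun e he p hp => by
  have h := T.isStructureOn he
  have hu := isUmbilicalSplitting hUmb hInt he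
  obtain ⟨O, φ, hpO, hφ⟩ := exists_isPotential hUmb hInt hD he hp
  -- The rotation form vanishes, so no duality rotation is needed.
  refine ⟨O, φ, fun _ => 0, hφ.1, hpO, hφ.2.1, hφ.2.2.1, contMDiffOn_const, fun y hy hyO b => ?_⟩
  have h0 := h.maxwell hu (e.symm.isOpen_inter_preimage hφ.1) Set.inter_subset_left
    (hφ.contDiffOn he) (fun z hz k => hφ.2.2.2 z hz.1 hz.2 k) ⟨hy, hyO⟩ b
  have e1 : T.rotated e φ (fun _ => 0) = fun z => Real.exp (φ (e.symm z)) • T.Uc e z := by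
    ext1 z
    simp [rotated]
  have e2 : (fun z => hodge (S.gc e z) (S.ηc e z) (T.rotated e φ (fun _ => 0) z))
      = fun z => Real.exp (φ (e.symm z)) • hodge (K := ℝ) (S.gc e z) (S.ηc e z) (T.Uc e z) := by
    ext z a b
    rw [e1]
    simp only [hodge, Matrix.smul_apply, smul_eq_mul, Finset.mul_sum]
    exact Finset.sum_congr rfl fun m _ => Finset.sum_congr rfl fun n _ =>
      Finset.sum_congr rfl fun p _ => Finset.sum_congr rfl fun q _ => by ring
  rw [e2, e1]
  exact h0

end TwoPlusTwo

end Manifold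

/-! ### The metric in adapted coordinates -/

/-- The Jacobian matrix of a map. -/
def jac (F : E4 → E4) (y : E4) : Matrix (Fin 4) (Fin 4) ℝ := fun a i => pd i (fun z => F z a) y

theorem fr2_symm (B : Matrix (Fin 4) (Fin 4) ℝ) {A : Matrix (Fin 4) (Fin 4) ℝ}
    (hA : A.transpose = A) (i j : Fin 4) : fr2 B A i j = fr2 B A j i := by
  rw [fr2_eq, fr2_eq, ← Matrix.transpose_apply (_ * B)]
  simp only [Matrix.transpose_mul, Matrix.transpose_transpose, hA, mul_assoc]

section Jacobian

variable {D Ω : Set E4} {F : E4 → E4} (hD : IsOpen D) (hF : ContDiffOn ℝ ∞ F D) {y : E4}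

theorem contDiffOn_coord (hF : ContDiffOn ℝ ∞ F D) (a : Fin 4) :
    ContDiffOn ℝ ∞ (fun z => F z a) D :=
  contDiffOn_euclidean.1 hF a

include hD hF

theorem fderiv_single_eq_jac (hy : y ∈ D) (a i : Fin 4) :
    fderiv ℝ F y (EuclideanSpace.single i 1) a = jac F y a i := by
  have h1 : DifferentiableAt ℝ F y := (hF.contDiffAt (hD.mem_nhds hy)).differentiableAt (by simp)
  have h2 := ((EuclideanSpace.proj a : E4 →L[ℝ] ℝ).hasFDerivAt (x := F y)).comp y h1.hasFDerivAt
  have h3 : fderiv ℝ (fun z => F z a) y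
      = (EuclideanSpace.proj a : E4 →L[ℝ] ℝ).comp (fderiv ℝ F y) := h2.fderiv
  rw [jac, pd, h3]
  rfl

theorem smooth_jac : SmoothMat D (jac F) :=
  fun a i => contDiffOn_pd hD (contDiffOn_coord hF a) i

theorem pd_comp (hΩ : IsOpen Ω) (hm : Set.MapsTo F D Ω) {f : E4 → ℝ} (hf : ContDiffOn ℝ ∞ f Ω)
    (hy : y ∈ D) (k : Fin 4) :
    pd k (fun z => f (F z)) y = ∑ c, jac F y c k * pd c f (F y) := by
  have h1 : DifferentiableAt ℝ F y := (hF.contDiffAt (hD.mem_nhds hy)).differentiableAt (by simp)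
  have h2 : DifferentiableAt ℝ f (F y) := hf.differentiableAt_of_isOpen hΩ (hm hy)
  have h3 : fderiv ℝ (fun z => f (F z)) y = (fderiv ℝ f (F y)).comp (fderiv ℝ F y) :=
    (h2.hasFDerivAt.comp y h1.hasFDerivAt).fderiv
  rw [pd, h3, ContinuousLinearMap.comp_apply, fderiv_apply_eq_sum_pd]
  simp only [fderiv_single_eq_jac hD hF hy]

omit hD in
theorem SmoothMat.comp_map {A : E4 → Matrix (Fin 4) (Fin 4) ℝ} (hA : SmoothMat Ω A)
    (hm : Set.MapsTo F D Ω) : SmoothMat D (fun z => A (F z)) :=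
  fun a b => (hA a b).comp hF hm

theorem pdm_jac (hy : y ∈ D) (k a i : Fin 4) : pdm k (jac F) y a i = pdm i (jac F) y a k :=
  pd_comm hD (contDiffOn_coord hF a) hy k i

end Jacobian

/-! ### The induced metrics on the leaves in adapted coordinates. -/

namespace IsUmbilicalSplitting

variable {Ω : Set E4} {G p : E4 → Matrix (Fin 4) (Fin 4) ℝ} (h : IsUmbilicalSplitting Ω G p)
  {D : Set E4} {F : E4 → E4} (hD : IsOpen D) (hF : ContDiffOn ℝ ∞ F D) (hm : Set.MapsTo F D Ω)
include h hD hF hm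

/-- The derivative of the induced metric along the complementary coordinates. -/
theorem pd_induced {i j k : Fin 4} (hi : ∀ y ∈ D, ∀ a, (p (F y) * jac F y) a i = jac F y a i)
    (hj : ∀ y ∈ D, ∀ a, (p (F y) * jac F y) a j = jac F y a j)
    (hk : ∀ y ∈ D, ∀ a, (p (F y) * jac F y) a k = 0) {y : E4} (hy : y ∈ D) :
    pd k (fun z => fr2 (jac F z) (G (F z)) i j) y
      = -2 * fr1 (jac F y) (fun a => meanForm G p a (F y)) k
        * fr2 (jac F y) (G (F y)) i j := by
  -- On tangential indices the metric may be replaced by g p, whose covariant derivative is known.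
  -- The derivative of Jᵀ N J then contains second derivatives of `F`, connection terms and ∇v. The
  -- second derivatives are traded for derivatives of N, the connection terms cancel, and two equal
  -- terms ξ_k v_ij with a minus sign remain.
  set N : E4 → Matrix (Fin 4) (Fin 4) ℝ := fun z => G z * p z with hN
  have hsN : SmoothMat Ω N := h.smooth.mul h.smooth_proj
  have hsJ := smooth_jac hD hF
  have hsNF : SmoothMat D (fun z => N (F z)) := hsN.comp_map hF hm
  have hNs : ∀ z ∈ D, (N (F z)).transpose = N (F z) := fun z hz => h.self_adjoint _ (hm hz)
  have hNk : ∀ z ∈ D, ∀ a, (N (F z) * jac F z) a k = 0 := fun z hz a => by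
    rw [hN, mul_assoc, Matrix.mul_apply]
    simp only [hk z hz, mul_zero, Finset.sum_const_zero]
  have hGN : ∀ l, (∀ y ∈ D, ∀ a, (p (F y) * jac F y) a l = jac F y a l) → ∀ z ∈ D, ∀ m,
      fr2 (jac F z) (G (F z)) m l = fr2 (jac F z) (N (F z)) m l := fun l hl z hz m => by
    rw [fr2_eq, fr2_eq, mul_assoc, mul_assoc, Matrix.mul_apply, Matrix.mul_apply, hN]
    refine Finset.sum_congr rfl fun a _ => ?_
    rw [mul_assoc (G (F z)), Matrix.mul_apply, Matrix.mul_apply]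
    simp only [hl z hz]
  have hJ1 : pd k (fun z => fr2 (jac F z) (G (F z)) i j) y
      = pdm k (fun z => (jac F z).transpose * N (F z) * jac F z) y i j := by
    rw [pdm_apply]
    refine pd_congr hD (fun z hz => ?_) hy k
    rw [hGN j hj z hz, fr2_eq]
  -- Second partial derivatives of `F` commute, which moves the differentiation from `k` to a
  -- tangential index.
  have hPs : ∀ l a b, ((jac F y).transpose * N (F y) * pdm l (jac F) y) a b
      = ((jac F y).transpose * N (F y) * pdm b (jac F) y) a l := fun l a b => by
    rw [Matrix.mul_apply, Matrix.mul_apply]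
    exact Finset.sum_congr rfl fun n _ => by rw [pdm_jac hD hF hy]
  -- Differentiation of N J e_k = 0, valid because the `k`-th coordinate vector lies in the
  -- complementary plane. It expresses the second derivatives of `F` by the derivative of N.
  have hder : ∀ l a, ((jac F y).transpose * pdm l (fun z => N (F z)) y * jac F y) a k
      + ((jac F y).transpose * N (F y) * pdm l (jac F) y) a k = 0 := fun l a => by
    have h1 : ∀ b, pdm l (fun z => N (F z) * jac F z) y b k = 0 := fun b => by
      rw [pdm_apply, pd_congr hD (fun z hz => hNk z hz b) hy, pd_const]
    rw [pdm_mul hD hsNF hsJ hy] at h1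
    rw [mul_assoc, mul_assoc, ← Matrix.add_apply, ← mul_add, Matrix.mul_apply]
    simp only [h1, mul_zero, Finset.sum_const_zero]
  set Γ : Fin 4 → Matrix (Fin 4) (Fin 4) ℝ := fun l => ∑ c, jac F y c l • conn G c (F y) with hΓ
  have hΓs : ∀ l n m, (Γ l * jac F y) n m = (Γ m * jac F y) n l := fun l n m => by
    simp only [hΓ, Matrix.mul_apply, Matrix.sum_apply, Matrix.smul_apply, smul_eq_mul,
      Finset.sum_mul, conn, Matrix.of_apply]
    rw [Finset.sum_comm]
    refine Finset.sum_congr rfl fun c _ => Finset.sum_congr rfl fun d _ => ?_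
    rw [h.toIsMetricOn.christoffel_symm (hm hy) n c d]
    ring
  have hKs : ∀ l a b, ((jac F y).transpose * N (F y) * (Γ l * jac F y)) a b
      = ((jac F y).transpose * N (F y) * (Γ b * jac F y)) a l := fun l a b => by
    rw [Matrix.mul_apply, Matrix.mul_apply]
    exact Finset.sum_congr rfl fun n _ => by rw [hΓs]
  have hrow : ∀ b, ((jac F y).transpose * N (F y)) k b = 0 := fun b => by
    have := hNk y hy b
    rw [← Matrix.transpose_apply (N (F y) * jac F y), Matrix.transpose_mul, hNs y hy] at this
    exact this
  have hK0 : ∀ l b, ((jac F y).transpose * N (F y) * (Γ l * jac F y)) k b = 0 := fun l b => by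
    rw [Matrix.mul_apply]
    simp only [hrow, zero_mul, Finset.sum_const_zero]
  have hD3 : ∀ l a b, ((jac F y).transpose * pdm l (fun z => N (F z)) y * jac F y) a b
      = fr3 (jac F y) (fun k => covd G N k (F y)) l a b
        + ((jac F y).transpose * N (F y) * (Γ l * jac F y)) b a
        + ((jac F y).transpose * N (F y) * (Γ l * jac F y)) a b := fun l a b => by
    have h1 : pdm l (fun z => N (F z)) y = ∑ c, jac F y c l • pdm c N (F y) := by
      ext m n
      simp only [Matrix.sum_apply, Matrix.smul_apply, smul_eq_mul]
      exact pd_comp hD hF h.isOpen hm (hsN m n) hy l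
    have h2 : ∑ c, jac F y c l • pdm c N (F y) = ∑ c, jac F y c l • covd G N c (F y)
        + ((Γ l).transpose * N (F y) + N (F y) * Γ l) := by
      simp only [hΓ, Matrix.transpose_sum, Matrix.transpose_smul, Finset.sum_mul, Finset.mul_sum,
        Matrix.smul_mul, Matrix.mul_smul, ← Finset.sum_add_distrib, ← smul_add]
      refine Finset.sum_congr rfl fun c _ => ?_
      rw [IsMetricOn.pdm_eq_covd (G := G) c]
      abel_nf
    have h3 : ((jac F y).transpose * (∑ c, jac F y c l • covd G N c (F y)) * jac F y) a b
        = fr3 (jac F y) (fun k => covd G N k (F y)) l a b := by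
      simp only [Finset.mul_sum, Finset.sum_mul, Matrix.mul_smul, Matrix.smul_mul,
        Matrix.sum_apply, Matrix.smul_apply, smul_eq_mul, ← fr2_eq]
      rfl
    have h4 : ((jac F y).transpose * ((Γ l).transpose * N (F y)) * jac F y) a b
        = ((jac F y).transpose * N (F y) * (Γ l * jac F y)) b a := by
      rw [← Matrix.transpose_apply (_ * (Γ l * jac F y))]
      simp only [Matrix.transpose_mul, Matrix.transpose_transpose, hNs y hy, mul_assoc]
    rw [h1, h2, mul_add, add_mul, Matrix.add_apply, h3, mul_add, add_mul, Matrix.add_apply, h4,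
      ← add_assoc]
    simp only [mul_assoc]
  have hPk : ∀ a b, ((jac F y).transpose * N (F y) * pdm k (jac F) y) a b
      = -((jac F y).transpose * pdm b (fun z => N (F z)) y * jac F y) a k := fun a b => by
    rw [hPs]
    linarith [hder b a]
  have hPt : ((pdm k (jac F) y).transpose * N (F y) * jac F y) i j
      = ((jac F y).transpose * N (F y) * pdm k (jac F) y) j i := by
    rw [← Matrix.transpose_apply (_ * pdm k (jac F) y)]
    simp only [Matrix.transpose_mul, Matrix.transpose_transpose, hNs y hy, mul_assoc]
  have hv : ∀ m, fr2 (jac F y) (N (F y)) k m = 0 := fun m => by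
    rw [fr2_eq, Matrix.mul_apply]
    simp only [hrow, zero_mul, Finset.sum_const_zero]
  have hvk : ∀ m, fr2 (jac F y) (N (F y)) m k = 0 := fun m => by
    rw [fr2_eq, mul_assoc, Matrix.mul_apply]
    simp only [hNk y hy, mul_zero, Finset.sum_const_zero]
  have hc : ∀ l, (∀ a, (p (F y) * jac F y) a l = jac F y a l) → ∀ m,
      fr2 (jac F y) (G (F y) * (1 - p (F y)) : Matrix (Fin 4) (Fin 4) ℝ) m l = 0 := fun l hl m => by
    have h1 : ∀ a, ((1 - p (F y)) * jac F y) a l = 0 := fun a => by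
      rw [sub_mul, one_mul, Matrix.sub_apply, hl, sub_self]
    rw [fr2_eq, mul_assoc, mul_assoc, ← mul_assoc, Matrix.mul_apply]
    simp only [h1, mul_zero, Finset.sum_const_zero]
  have hc' : ∀ l, (∀ a, (p (F y) * jac F y) a l = jac F y a l) → ∀ m,
      fr2 (jac F y) (G (F y) * (1 - p (F y)) : Matrix (Fin 4) (Fin 4) ℝ) l m = 0 := fun l hl m => by
    rw [← hc l hl m]
    exact fr2_symm _ (h.compl.self_adjoint _ (hm hy)) l m
  have hC := fun a b c => h.fr3_covd (B := jac F y) (hm hy) a b c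
  rw [hJ1, pdm_mul hD (hsJ.transpose.mul hsNF) hsJ hy, pdm_mul hD hsJ.transpose hsNF hy,
    pdm_transpose, add_mul, Matrix.add_apply, Matrix.add_apply, hPt, hPk, hPk, hD3, hD3, hD3,
    hKs i j k, hKs j i k, hK0, hK0, hC, hC, hC, hGN j hj y hy]
  simp only [hc i (hi y hy), hc j (hj y hy), hc' i (hi y hy), hc' j (hj y hy)]
  have hv' := hv i
  have hv'' := hv j
  have hv3 := hvk i
  have hv4 := hvk j
  have hs : fr2 (jac F y) (N (F y)) j i = fr2 (jac F y) (N (F y)) i j :=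
    fr2_symm _ (hNs y hy) j i
  simp only [hN] at hv' hv'' hv3 hv4 hs ⊢
  rw [hv', hv'', hv3, hv4, hs]
  ring

/-- The conformally rescaled induced metric does not depend on the complementary coordinates. -/
theorem pd_conformal {φ : E4 → ℝ} (hφ : ContDiffOn ℝ ∞ φ Ω)
    (hdφ : ∀ z ∈ Ω, ∀ c, pd c φ z
      = 2 * (meanForm G p c z + meanForm G (fun z => 1 - p z) c z))
    {i j k : Fin 4} (hi : ∀ y ∈ D, ∀ a, (p (F y) * jac F y) a i = jac F y a i)
    (hj : ∀ y ∈ D, ∀ a, (p (F y) * jac F y) a j = jac F y a j)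
    (hk : ∀ y ∈ D, ∀ a, (p (F y) * jac F y) a k = 0) {y : E4} (hy : y ∈ D) :
    pd k (fun z => Real.exp (φ (F z)) * fr2 (jac F z) (G (F z)) i j) y = 0 := by
  -- The coordinate vector `k` lies in the complementary plane, which its own mean curvature form
  -- annihilates; so only ξ contributes to dφ in this direction.
  have hζ : ∑ c, jac F y c k * meanForm G (fun z => 1 - p z) c (F y) = 0 := by
    have h1 : ∀ c, jac F y c k = ∑ b, (1 - p (F y)) c b * jac F y b k := fun c => by
      rw [← Matrix.mul_apply, sub_mul, one_mul, Matrix.sub_apply, hk y hy, sub_zero]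
    calc _ = ∑ b, (∑ c, meanForm G (fun z => 1 - p z) c (F y) * (1 - p (F y)) c b)
          * jac F y b k := by
          simp only [Finset.sum_mul]
          rw [Finset.sum_comm]
          refine Finset.sum_congr rfl fun c _ => ?_
          rw [h1, Finset.sum_mul]
          exact Finset.sum_congr rfl fun b _ => by ring
      _ = 0 := by simp only [h.compl.meanForm_mul_proj (hm hy), zero_mul, Finset.sum_const_zero]
  have hsφ : ContDiffOn ℝ ∞ (fun z => φ (F z)) D := hφ.comp hF hm
  have hsM : ContDiffOn ℝ ∞ (fun z => fr2 (jac F z) (G (F z)) i j) D := by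
    have h1 := smooth_jac hD hF
    refine ((h1.transpose.mul (h.smooth.comp_map hF hm)).mul h1 i j).congr fun z _ => ?_
    rw [fr2_eq]
  have h2 : pd k (fun z => Real.exp (φ (F z))) y
      = Real.exp (φ (F y)) * (2 * fr1 (jac F y) (fun a => meanForm G p a (F y)) k) := by
    have h3 := (hsφ.differentiableAt_of_isOpen hD hy).hasFDerivAt.exp.fderiv
    have h4 : pd k (fun z => φ (F z)) y
        = 2 * fr1 (jac F y) (fun a => meanForm G p a (F y)) k := by
      rw [pd_comp hD hF h.isOpen hm hφ hy]
      simp only [hdφ _ (hm hy), mul_left_comm _ (2 : ℝ), ← Finset.mul_sum, mul_add,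
        Finset.sum_add_distrib, hζ, mul_zero, add_zero]
      rfl
    rw [← h4, pd, h3]
    rfl
  rw [pd_mul hD hsφ.exp hsM hy, h2, h.pd_induced hD hF hm hi hj hk hy]
  ring

end IsUmbilicalSplitting

/-! ### Integration of the plane fields -/

/-- The endomorphism of `ℝ⁴` with a given matrix. -/
def matClm (A : Matrix (Fin 4) (Fin 4) ℝ) : E4 →L[ℝ] E4 :=
  ∑ a, ∑ b, A a b • (EuclideanSpace.proj b : E4 →L[ℝ] ℝ).smulRight
    (EuclideanSpace.single a (1 : ℝ) : E4)

theorem matClm_apply (A : Matrix (Fin 4) (Fin 4) ℝ) (x : E4) (a : Fin 4) :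
    matClm A x a = ∑ b, A a b * x b := by
  simp [matClm, Finset.sum_apply, Pi.single_apply]

theorem matClm_mul (A A' : Matrix (Fin 4) (Fin 4) ℝ) (x : E4) :
    matClm A (matClm A' x) = matClm (A * A') x := by
  ext a
  simp only [matClm_apply, Matrix.mul_apply, Finset.mul_sum, Finset.sum_mul]
  rw [Finset.sum_comm]
  exact Finset.sum_congr rfl fun _ _ => Finset.sum_congr rfl fun _ _ => by ring

theorem matClm_sub (A A' : Matrix (Fin 4) (Fin 4) ℝ) (x : E4) :
    matClm (A - A') x = matClm A x - matClm A' x := by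
  ext a
  simp only [matClm_apply, PiLp.sub_apply, Matrix.sub_apply, sub_mul, Finset.sum_sub_distrib]

theorem matClm_one (x : E4) : matClm 1 x = x := by
  ext a
  simp [matClm_apply, Matrix.one_apply]

section Smooth

variable {Ω : Set E4} {A : E4 → Matrix (Fin 4) (Fin 4) ℝ}

theorem SmoothMat.contDiffOn_matClm (hA : SmoothMat Ω A) :
    ContDiffOn ℝ ∞ (fun z => matClm (A z)) Ω :=
  ContDiffOn.sum fun a _ => ContDiffOn.sum fun b _ => (hA a b).smul contDiffOn_const

theorem SmoothMat.fderiv_matClm (hΩ : IsOpen Ω) (hA : SmoothMat Ω A) {z : E4} (hz : z ∈ Ω)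
    (u x : E4) (a : Fin 4) :
    fderiv ℝ (fun z => matClm (A z)) z u x a = ∑ k, u k * ∑ b, _root_.pdm k A z a b * x b := by
  have h1 : DifferentiableAt ℝ (fun z => matClm (A z)) z :=
    (hA.contDiffOn_matClm.contDiffAt (hΩ.mem_nhds hz)).differentiableAt (by simp)
  let L : (E4 →L[ℝ] E4) →L[ℝ] ℝ :=
    (EuclideanSpace.proj a : E4 →L[ℝ] ℝ).comp (ContinuousLinearMap.apply ℝ E4 x)
  have h2 : fderiv ℝ (fun z => L (matClm (A z))) z = L.comp (fderiv ℝ (fun z => matClm (A z)) z) :=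
    (L.hasFDerivAt.comp z h1.hasFDerivAt).fderiv
  have h3 : fderiv ℝ (fun z => matClm (A z)) z u x a = fderiv ℝ (fun z => L (matClm (A z))) z u := by
    rw [h2]
    rfl
  have h4 : (fun z => L (matClm (A z))) = fun z => ∑ b, A z a b * x b :=
    funext fun z => matClm_apply _ _ _
  rw [h3, h4, fderiv_apply_eq_sum_pd]
  refine Finset.sum_congr rfl fun k _ => ?_
  rw [pd_sum _ hΩ (fun b _ => (hA a b).mul contDiffOn_const) hz]
  congr 1
  refine Finset.sum_congr rfl fun b _ => ?_
  rw [pd_mul hΩ (hA a b) contDiffOn_const hz, pd_const, mul_zero, add_zero]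
  rfl

end Smooth

/-- First integrals of an integrable plane field. -/
theorem IsSplitting.exists_first_integrals {Ω : Set E4} {G p : E4 → Matrix (Fin 4) (Fin 4) ℝ}
    (h : IsSplitting Ω G p) (hA : ∀ z ∈ Ω, ∀ a b c, antisymSecondForm G p a b c z = 0)
    {z₀ : E4} (hz₀ : z₀ ∈ Ω) :
    ∃ (O : Set E4) (w : E4 → E4), IsOpen O ∧ z₀ ∈ O ∧ O ⊆ Ω ∧ ContDiffOn ℝ ∞ w O ∧
      (∀ u, fderiv ℝ w z₀ u = u - matClm (p z₀) u) ∧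
      (∀ z ∈ O, ∀ u, fderiv ℝ w z (matClm (p z) u) = 0) ∧
      ∀ z, matClm (p z₀) (w z) = 0 := by
  refine _root_.exists_first_integrals h.isOpen h.smooth_proj.contDiffOn_matClm
    (fun z hz x => by rw [matClm_mul, h.idem z hz]) (fun z hz => ?_) hz₀
  -- The second fundamental form without its connection part. That part is symmetric for lack of
  -- torsion, so vanishing antisymmetric part is the same as symmetry of `R`, the coordinate form of
  -- involutivity.
  let R : Fin 4 → Fin 4 → Fin 4 → ℝ := fun a b c => ∑ k, p z k b * ((1 - p z) * pdm k p z) a c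
  have hR : ∀ a b c, R a b c = R a c b := fun a b c => by
    have h1 := hA z hz a b c
    have h2 : ∀ b c, secondForm G p a b c z
        = R a b c + ∑ k, p z k b * ((1 - p z) * (conn G k z * p z)) a c := fun b c => by
      rw [secondForm_eq, ← Finset.sum_add_distrib]
      exact Finset.sum_congr rfl fun k _ => by rw [mul_add, Matrix.add_apply, mul_add]
    have h3 : ∀ m, ∑ k, p z k b * (conn G k z * p z) m c
        = ∑ k, p z k c * (conn G k z * p z) m b := fun m => by
      simp only [Matrix.mul_apply, Finset.mul_sum, conn, Matrix.of_apply]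
      rw [Finset.sum_comm]
      refine Finset.sum_congr rfl fun k _ => Finset.sum_congr rfl fun n _ => ?_
      rw [h.toIsMetricOn.christoffel_symm hz m n k]
      ring
    have h4 : ∀ b c, ∑ k, p z k b * ((1 - p z) * (conn G k z * p z)) a c
        = ∑ m, (1 - p z) a m * ∑ k, p z k b * (conn G k z * p z) m c := fun b c => by
      simp only [Matrix.mul_apply (M := 1 - p z), Finset.mul_sum]
      rw [Finset.sum_comm]
      exact Finset.sum_congr rfl fun _ _ => Finset.sum_congr rfl fun _ _ => by ring
    have h5 : ∑ k, p z k b * ((1 - p z) * (conn G k z * p z)) a c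
        = ∑ k, p z k c * ((1 - p z) * (conn G k z * p z)) a b := by
      rw [h4, h4]
      simp only [h3]
    simp only [antisymSecondForm] at h1
    rw [h2, h2] at h1
    linarith
  have key : ∀ x y a, (fderiv ℝ (fun z => matClm (p z)) z (matClm (p z) x) y
      - matClm (p z) (fderiv ℝ (fun z => matClm (p z)) z (matClm (p z) x) y)) a
      = ∑ b, ∑ c, x b * y c * R a b c := fun x y a => by
    rw [← matClm_one (fderiv ℝ (fun z => matClm (p z)) z (matClm (p z) x) y), matClm_mul,
      mul_one, ← matClm_sub, matClm_apply]
    simp only [h.smooth_proj.fderiv_matClm h.isOpen hz, matClm_apply]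
    simp only [R, Matrix.mul_apply, Finset.mul_sum, Finset.sum_mul]
    calc _ = ∑ k, ∑ b, ∑ c, ∑ m, (1 - p z) a m * (p z k b * x b * (pdm k p z m c * y c)) := by
          rw [Finset.sum_comm]
          refine Finset.sum_congr rfl fun k _ => ?_
          rw [Finset.sum_comm, Finset.sum_comm (s := Finset.univ (α := Fin 4)) (t := Finset.univ (α := Fin 4)) (f := fun b c => ∑ m, (1 - p z) a m * (p z k b * x b * (pdm k p z m c * y c)))]
          refine Finset.sum_congr rfl fun c _ => ?_
          rw [Finset.sum_comm]
      _ = _ := by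
          rw [Finset.sum_comm]
          refine Finset.sum_congr rfl fun b _ => ?_
          rw [Finset.sum_comm]
          refine Finset.sum_congr rfl fun c _ => Finset.sum_congr rfl fun k _ =>
            Finset.sum_congr rfl fun m _ => by ring
  intro x y
  ext a
  rw [key, key, Finset.sum_comm]
  refine Finset.sum_congr rfl fun b _ => Finset.sum_congr rfl fun c _ => ?_
  rw [hR]
  ring

/-! ### Adapted coordinates -/

/-- Near every point there is a map with invertible derivative adapted to an umbilical and
integrable splitting. -/
theorem IsUmbilicalSplitting.exists_adapted_map {Ω : Set E4}
    {G p : E4 → Matrix (Fin 4) (Fin 4) ℝ} (h : IsUmbilicalSplitting Ω G p) {z₀ : E4}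
    (hz₀ : z₀ ∈ Ω) {B : Matrix (Fin 4) (Fin 4) ℝ} {t : Fin 4 → ℝ}
    (hB : IsAdaptedFrame (G z₀) (p z₀) B t) :
    ∃ (O : Set E4) (f : E4 → E4) (f' : E4 ≃L[ℝ] E4), IsOpen O ∧ z₀ ∈ O ∧ O ⊆ Ω ∧
      ContDiffOn ℝ ∞ f O ∧ HasFDerivAt f (f' : E4 →L[ℝ] E4) z₀ ∧
      ∀ z ∈ O, ∀ u, (∀ k, t k = 0 → fderiv ℝ f z (matClm (p z) u) k = 0) ∧
        ∀ i, t i = 1 → fderiv ℝ f z (matClm (1 - p z) u) i = 0 := by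
  obtain ⟨O₁, w₁, hO₁, hz₁, -, hw₁, hd₁, hk₁, hv₁⟩ :=
    h.toIsSplitting.exists_first_integrals h.antisymm hz₀
  obtain ⟨O₂, w₂, hO₂, hz₂, hs₂, hw₂, hd₂, hk₂, hv₂⟩ :=
    h.compl.exists_first_integrals h.antisymm' hz₀
  obtain ⟨C, hCB, hBC⟩ : ∃ C : Matrix (Fin 4) (Fin 4) ℝ, C * B = 1 ∧ B * C = 1 :=
    ⟨_, hB.left_inv, hB.right_inv⟩
  have hC : C * p z₀ = Matrix.diagonal t * C := by
    calc C * p z₀ = C * (p z₀ * B) * C := by rw [mul_assoc, mul_assoc, hBC, mul_one]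
      _ = _ := by rw [hB.adapted, ← mul_assoc, hCB, one_mul]
  have hCt : ∀ x i, matClm C (matClm (p z₀) x) i = t i * matClm C x i := fun x i => by
    rw [matClm_mul, hC, ← matClm_mul, matClm_apply]
    simp [Matrix.diagonal_apply]
  have hO : IsOpen (O₁ ∩ O₂) := hO₁.inter hO₂
  have hw₁' : ContDiffOn ℝ ∞ w₁ (O₁ ∩ O₂) := hw₁.mono Set.inter_subset_left
  have hw₂' : ContDiffOn ℝ ∞ w₂ (O₁ ∩ O₂) := hw₂.mono Set.inter_subset_right
  have hdw₁ : ∀ z ∈ O₁ ∩ O₂, DifferentiableAt ℝ w₁ z := fun z hz =>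
    (hw₁'.contDiffAt (hO.mem_nhds hz)).differentiableAt (by simp)
  have hdw₂ : ∀ z ∈ O₁ ∩ O₂, DifferentiableAt ℝ w₂ z := fun z hz =>
    (hw₂'.contDiffAt (hO.mem_nhds hz)).differentiableAt (by simp)
  have hfd : ∀ z ∈ O₁ ∩ O₂, HasFDerivAt (fun z => matClm C (w₁ z + w₂ z))
      ((matClm C).comp (fderiv ℝ w₁ z + fderiv ℝ w₂ z)) z :=
    fun z hz => (matClm C).hasFDerivAt.comp z
      ((hdw₁ z hz).hasFDerivAt.add (hdw₂ z hz).hasFDerivAt)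
  have hconst : ∀ (A : Matrix (Fin 4) (Fin 4) ℝ) (w : E4 → E4), (∀ z, matClm A (w z) = 0) →
      ∀ z, DifferentiableAt ℝ w z → ∀ u, matClm A (fderiv ℝ w z u) = 0 := fun A w hw z hz u => by
    have h1 := ((matClm A).hasFDerivAt.comp z hz.hasFDerivAt).fderiv
    have h2 : (matClm A ∘ w) = fun _ => 0 := funext hw
    rw [h2, fderiv_fun_const] at h1
    exact (congrArg (fun L : E4 →L[ℝ] E4 => L u) h1).symm
  -- `w₁` is constant along the plane of p with values in the kernel of p at `z₀`, and `w₂` is the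
  -- opposite. Reading their sum in the frame at `z₀` through `C = B⁻¹` separates them: coordinates
  -- with t = 0 come from `w₁`, those with t = 1 from `w₂`. At `z₀` the two derivatives add up to
  -- the identity.
  refine ⟨O₁ ∩ O₂, fun z => matClm C (w₁ z + w₂ z),
    ContinuousLinearEquiv.equivOfInverse (matClm C) (matClm B)
      (fun x => by rw [matClm_mul, hBC, matClm_one])
      (fun x => by rw [matClm_mul, hCB, matClm_one]), hO, ⟨hz₁, hz₂⟩, fun z hz => hs₂ hz.2,
    (matClm C).contDiff.comp_contDiffOn (hw₁'.add hw₂'), ?_, fun z hz u =>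
      ⟨fun k hk => ?_, fun i hi => ?_⟩⟩
  · have h1 : (matClm C).comp (fderiv ℝ w₁ z₀ + fderiv ℝ w₂ z₀) = matClm C := by
      ext1 u
      simp only [ContinuousLinearMap.comp_apply, _root_.add_apply, hd₁, hd₂, matClm_sub,
        matClm_one]
      congr 1
      abel
    have h2 := hfd z₀ ⟨hz₁, hz₂⟩
    rw [h1] at h2
    exact h2
  · rw [(hfd z hz).fderiv, ContinuousLinearMap.comp_apply, _root_.add_apply, hk₁ z hz.1, zero_add]
    have h1 := hconst _ _ hv₂ z (hdw₂ z hz) (matClm (p z) u)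
    rw [matClm_sub, matClm_one, sub_eq_zero] at h1
    rw [h1, hCt, hk, zero_mul]
  · rw [(hfd z hz).fderiv, ContinuousLinearMap.comp_apply, _root_.add_apply, hk₂ z hz.2, add_zero]
    have h2 := hCt (fderiv ℝ w₁ z (matClm (1 - p z) u)) i
    rw [hconst _ _ hv₁ z (hdw₁ z hz), map_zero, hi, one_mul] at h2
    exact h2.symm

theorem OpenPartialHomeomorph.exists_convex_target {X : Type*} [TopologicalSpace X]
    (Φ : OpenPartialHomeomorph X E4) {x : X} (hx : x ∈ Φ.source) :
    ∃ Ψ : OpenPartialHomeomorph X E4, (Ψ : X → E4) = Φ ∧ (Ψ.symm : E4 → X) = Φ.symm ∧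
      Ψ.source ⊆ Φ.source ∧ Ψ.target ⊆ Φ.target ∧ x ∈ Ψ.source ∧ Convex ℝ Ψ.target := by
  obtain ⟨ε, hε, hball⟩ := Metric.isOpen_iff.1 Φ.open_target _ (Φ.map_source hx)
  refine ⟨(Φ.symm.restrOpen (Metric.ball (Φ x) ε) Metric.isOpen_ball).symm, rfl, rfl,
    fun z hz => hz.1, fun z hz => hz.1, ⟨hx, Metric.mem_ball_self hε⟩, ?_⟩
  have h1 : Convex ℝ (Φ.target ∩ Metric.ball (Φ x) ε) := by
    rw [Set.inter_eq_right.2 hball]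
    exact convex_ball _ _
  exact h1

/-- Near every point there are coordinates adapted to an umbilical and integrable splitting. -/
theorem IsUmbilicalSplitting.exists_adapted_chart {Ω : Set E4}
    {G p : E4 → Matrix (Fin 4) (Fin 4) ℝ} (h : IsUmbilicalSplitting Ω G p) {z₀ : E4}
    (hz₀ : z₀ ∈ Ω) {B : Matrix (Fin 4) (Fin 4) ℝ} {t : Fin 4 → ℝ} (ht : ∀ i, t i = 1 ∨ t i = 0)
    (hB : IsAdaptedFrame (G z₀) (p z₀) B t) :
    ∃ Φ : OpenPartialHomeomorph E4 E4, z₀ ∈ Φ.source ∧ Φ.source ⊆ Ω ∧ Convex ℝ Φ.target ∧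
      ContDiffOn ℝ ∞ Φ Φ.source ∧ ContDiffOn ℝ ∞ Φ.symm Φ.target ∧
      (∀ k, t k = 0 → ∀ y ∈ Φ.target, ∀ a, (p (Φ.symm y) * jac Φ.symm y) a k = 0) ∧
      ∀ i, t i = 1 → ∀ y ∈ Φ.target, ∀ a,
        (p (Φ.symm y) * jac Φ.symm y) a i = jac Φ.symm y a i := by
  obtain ⟨O, f, f', hO, hz₀O, hOΩ, hf, hf', hker⟩ := h.exists_adapted_map hz₀ hB
  obtain ⟨Φ₀, hΦf, hz₀', hsub, hsymm, hder⟩ := hf.exists_smooth_localInverse hO hz₀O hf'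
  obtain ⟨Φ, hΦ₀, hΦy, hΦs, hΦt', hz₀Φ, hΦt⟩ := Φ₀.exists_convex_target hz₀'
  have hΦe : (Φ : E4 → E4) = f := hΦ₀.trans hΦf
  have hcs : ContDiffOn ℝ ∞ Φ.symm Φ.target := hΦy ▸ hsymm.mono hΦt'
  have key : ∀ y ∈ Φ.target, Function.Injective (fderiv ℝ f (Φ.symm y)) ∧
      ∀ i, fderiv ℝ f (Φ.symm y) (fderiv ℝ Φ.symm y (EuclideanSpace.single i 1))
        = EuclideanSpace.single i 1 := by
    intro y hy
    obtain ⟨e, he⟩ := hder _ (hΦs (Φ.map_target hy))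
    rw [he.fderiv]
    refine ⟨e.injective, fun i => ?_⟩
    have hd : HasFDerivAt Φ.symm (fderiv ℝ Φ.symm y) y :=
      ((hcs.contDiffAt (Φ.open_target.mem_nhds hy)).differentiableAt (by simp)).hasFDerivAt
    have h1 := he.comp y hd
    have h2 : f ∘ Φ.symm =ᶠ[nhds y] id := by
      filter_upwards [Φ.open_target.mem_nhds hy] with y' hy'
      rw [← hΦe]
      exact Φ.right_inv hy'
    have h3 := (h1.congr_of_eventuallyEq h2.symm).unique (hasFDerivAt_id y)
    exact congrArg (fun L : E4 →L[ℝ] E4 => L (EuclideanSpace.single i 1)) h3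
  have hsum : ∀ y ∈ Φ.target, ∀ (A : Matrix (Fin 4) (Fin 4) ℝ) a i,
      (A * jac Φ.symm y) a i
        = matClm A (fderiv ℝ Φ.symm y (EuclideanSpace.single i 1)) a := fun y hy A a i => by
    rw [matClm_apply, Matrix.mul_apply]
    simp only [fderiv_single_eq_jac Φ.open_target hcs hy]
  have hne : ∀ i k, t i ≠ t k → (EuclideanSpace.single k (1 : ℝ) : E4) i = 0 :=
    fun i k hik => by
      have : i ≠ k := fun hik' => hik (by rw [hik'])
      simp [this]
  refine ⟨Φ, hz₀Φ, fun z hz => hOΩ (hsub (hΦs hz)), hΦt,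
    hΦe ▸ hf.mono fun z hz => hsub (hΦs hz), hcs, fun k hk y hy a => ?_, fun i hi y hy a => ?_⟩
  · obtain ⟨hinj, hL⟩ := key y hy
    have hL₀ := hker _ (hsub (hΦs (Φ.map_target hy)))
      (fderiv ℝ Φ.symm y (EuclideanSpace.single k 1))
    rw [hsum y hy]
    -- It suffices to check the coordinates of the image under the injective derivative of `f`.
    -- Those with t = 0 vanish on the plane of p. For t = 1 the complementary part contributes
    -- nothing, and the `k`-th coordinate vector has no such component.
    have : matClm (p (Φ.symm y)) (fderiv ℝ Φ.symm y (EuclideanSpace.single k 1)) = 0 := by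
      refine hinj ?_
      rw [map_zero]
      ext i
      rcases ht i with hi | hi
      · have h1 := hL₀.2 i hi
        rw [matClm_sub, matClm_one, map_sub, hL, PiLp.sub_apply,
          hne i k (by rw [hi, hk]; exact one_ne_zero), zero_sub, neg_eq_zero] at h1
        exact h1
      · exact hL₀.1 i hi
    rw [this]
    rfl
  · obtain ⟨hinj, hL⟩ := key y hy
    have hL₀ := hker _ (hsub (hΦs (Φ.map_target hy)))
      (fderiv ℝ Φ.symm y (EuclideanSpace.single i 1))
    have : matClm (1 - p (Φ.symm y)) (fderiv ℝ Φ.symm y (EuclideanSpace.single i 1)) = 0 := by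
      refine hinj ?_
      rw [map_zero]
      ext k
      rcases ht k with hk | hk
      · exact hL₀.2 k hk
      · have h1 := hL₀.1 k hk
        rw [matClm_sub, matClm_one, map_sub, hL, PiLp.sub_apply, h1,
          hne k i (by rw [hi, hk]; exact zero_ne_one), sub_zero]
        rfl
    have h1 := hsum y hy (1 - p (Φ.symm y)) a i
    rw [this, sub_mul, one_mul, Matrix.sub_apply] at h1
    exact (sub_eq_zero.1 h1).symm

/-- A function on a convex set that does not depend on some of the coordinates. -/
theorem eq_of_pd_eq_zero {D : Set E4} (hD : IsOpen D) (hc : Convex ℝ D) {f : E4 → ℝ}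
    (hf : ContDiffOn ℝ ∞ f D) {s : Fin 4 → Prop} (hs : ∀ k, s k → ∀ y ∈ D, pd k f y = 0)
    {y y' : E4} (hy : y ∈ D) (hy' : y' ∈ D) (hyy : ∀ k, ¬ s k → y k = y' k) : f y = f y' := by
  let γ : ℝ → E4 := fun r => y + r • (y' - y)
  have hγD : ∀ r ∈ Set.Icc (0 : ℝ) 1, γ r ∈ D := fun r hr => hc.add_smul_sub_mem hy hy' hr
  have hγ : ∀ r, HasDerivAt γ (y' - y) r := fun r => by
    have h1 := ((hasDerivAt_id r).smul_const (y' - y)).const_add y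
    rw [one_smul] at h1
    exact h1
  have hd : ∀ r ∈ Set.Icc (0 : ℝ) 1, HasDerivAt (fun r => f (γ r)) 0 r := fun r hr => by
    have h1 := (hf.differentiableAt_of_isOpen hD (hγD r hr)).hasFDerivAt.comp_hasDerivAt r (hγ r)
    have h2 : fderiv ℝ f (γ r) (y' - y) = 0 := by
      rw [fderiv_apply_eq_sum_pd]
      refine Finset.sum_eq_zero fun k _ => ?_
      by_cases hk : s k
      · rw [hs k hk _ (hγD r hr), mul_zero]
      · rw [PiLp.sub_apply, hyy k hk, sub_self, zero_mul]
    rwa [h2] at h1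
  have h1 := constant_of_has_deriv_right_zero (f := fun r => f (γ r)) (a := 0) (b := 1)
    (fun r hr => (hd r hr).continuousAt.continuousWithinAt)
    (fun r hr => (hd r ⟨hr.1, hr.2.le⟩).hasDerivWithinAt) 1 ⟨zero_le_one, le_rfl⟩
  simp only [γ, one_smul, zero_smul, add_zero, add_sub_cancel] at h1
  exact h1.symm

theorem blockMetric_apply (v h : Matrix (Fin 2) (Fin 2) ℝ) : blockMetric v h =
    !![v 0 0, v 0 1, 0, 0; v 1 0, v 1 1, 0, 0; 0, 0, h 0 0, h 0 1; 0, 0, h 1 0, h 1 1] := by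
  ext i j
  fin_cases i <;> fin_cases j <;> rfl

/-- A block diagonal matrix function whose blocks depend on complementary coordinates. -/
theorem exists_blockMetric {D : Set E4} (hD : IsOpen D) (hc : Convex ℝ D)
    {A : E4 → Matrix (Fin 4) (Fin 4) ℝ} (hA : SmoothMat D A)
    (h₀ : ∀ i k, tl i = 1 → tl k = 0 → ∀ y ∈ D, A y i k = 0 ∧ A y k i = 0)
    (h₁ : ∀ i j k, tl i = 1 → tl j = 1 → tl k = 0 → ∀ y ∈ D, pd k (fun z => A z i j) y = 0)
    (h₂ : ∀ i j k, tl i = 0 → tl j = 0 → tl k = 1 → ∀ y ∈ D, pd k (fun z => A z i j) y = 0) :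
    ∃ v h : ℝ → ℝ → Matrix (Fin 2) (Fin 2) ℝ, ∀ y ∈ D,
      A y = blockMetric (v (y 0) (y 1)) (h (y 2) (y 3)) := by
  classical
  have t0 : tl 0 = 1 := rfl
  have t1 : tl 1 = 1 := rfl
  have t2 : tl 2 = 0 := rfl
  have t3 : tl 3 = 0 := rfl
  -- A representative point of `D` for each pair of coordinate values, used to define the blocks as
  -- functions of two variables. The default 0 is never evaluated at coordinates of points of `D`.
  have hex : ∀ r s : Fin 4, ∃ P : ℝ → ℝ → E4, ∀ y ∈ D,
      P (y r) (y s) ∈ D ∧ P (y r) (y s) r = y r ∧ P (y r) (y s) s = y s := fun r s => by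
    refine ⟨fun a b => if hab : ∃ y ∈ D, y r = a ∧ y s = b then hab.choose else 0,
      fun y hy => ?_⟩
    have hab : ∃ y' ∈ D, y' r = y r ∧ y' s = y s := ⟨y, hy, rfl, rfl⟩
    simp only [dif_pos hab]
    exact hab.choose_spec
  obtain ⟨P, hP⟩ := hex 0 1
  obtain ⟨Q, hQ⟩ := hex 2 3
  refine ⟨fun a b => !![A (P a b) 0 0, A (P a b) 0 1; A (P a b) 1 0, A (P a b) 1 1],
    fun a b => !![A (Q a b) 2 2, A (Q a b) 2 3; A (Q a b) 3 2, A (Q a b) 3 3], fun y hy => ?_⟩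
  obtain ⟨hPD, hP0, hP1⟩ := hP y hy
  obtain ⟨hQD, hQ2, hQ3⟩ := hQ y hy
  have e₁ : ∀ i j, tl i = 1 → tl j = 1 → A y i j = A (P (y 0) (y 1)) i j := fun i j hi hj =>
    eq_of_pd_eq_zero hD hc (hA i j) (s := fun k => tl k = 0)
      (fun k hk => h₁ i j k hi hj hk) hy hPD fun k hk => by
        fin_cases k
        · exact hP0.symm
        · exact hP1.symm
        · exact absurd t2 hk
        · exact absurd t3 hk
  have e₂ : ∀ i j, tl i = 0 → tl j = 0 → A y i j = A (Q (y 2) (y 3)) i j := fun i j hi hj =>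
    eq_of_pd_eq_zero hD hc (hA i j) (s := fun k => tl k = 1)
      (fun k hk => h₂ i j k hi hj hk) hy hQD fun k hk => by
        fin_cases k
        · exact absurd t0 hk
        · exact absurd t1 hk
        · exact hQ2.symm
        · exact hQ3.symm
  rw [blockMetric_apply]
  ext i j
  fin_cases i <;> fin_cases j
  · exact e₁ 0 0 t0 t0
  · exact e₁ 0 1 t0 t1
  · exact (h₀ 0 2 t0 t2 y hy).1
  · exact (h₀ 0 3 t0 t3 y hy).1
  · exact e₁ 1 0 t1 t0
  · exact e₁ 1 1 t1 t1
  · exact (h₀ 1 2 t1 t2 y hy).1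
  · exact (h₀ 1 3 t1 t3 y hy).1
  · exact (h₀ 0 2 t0 t2 y hy).2
  · exact (h₀ 1 2 t1 t2 y hy).2
  · exact e₂ 2 2 t2 t2
  · exact e₂ 2 3 t2 t3
  · exact (h₀ 0 3 t0 t3 y hy).2
  · exact (h₀ 1 3 t1 t3 y hy).2
  · exact e₂ 3 2 t3 t2
  · exact e₂ 3 3 t3 t3

/-! ### Conformal product coordinates -/

theorem IsUmbilicalSplitting.mono {Ω Ω' : Set E4} {G p : E4 → Matrix (Fin 4) (Fin 4) ℝ}
    (h : IsUmbilicalSplitting Ω G p) (hΩ' : IsOpen Ω') (hs : Ω' ⊆ Ω) :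
    IsUmbilicalSplitting Ω' G p where
  isOpen := hΩ'
  smooth a b := (h.smooth a b).mono hs
  symm z hz := h.symm z (hs hz)
  det_ne z hz := h.det_ne z (hs hz)
  smooth_proj a b := (h.smooth_proj a b).mono hs
  idem z hz := h.idem z (hs hz)
  self_adjoint z hz := h.self_adjoint z (hs hz)
  antisymm z hz := h.antisymm z (hs hz)
  antisymm' z hz := h.antisymm' z (hs hz)
  traceless z hz := h.traceless z (hs hz)
  traceless' z hz := h.traceless' z (hs hz)

/-- An umbilical and integrable splitting is conformal to a product. -/
theorem IsUmbilicalSplitting.exists_conformal_product {Ω : Set E4}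
    {G p : E4 → Matrix (Fin 4) (Fin 4) ℝ} (h : IsUmbilicalSplitting Ω G p) {φ : E4 → ℝ}
    (hφ : ContDiffOn ℝ ∞ φ Ω) (hdφ : ∀ z ∈ Ω, ∀ c, pd c φ z
      = 2 * (meanForm G p c z + meanForm G (fun z => 1 - p z) c z)) {z₀ : E4} (hz₀ : z₀ ∈ Ω)
    {B : Matrix (Fin 4) (Fin 4) ℝ} (hB : IsAdaptedFrame (G z₀) (p z₀) B tl) :
    ∃ Φ : OpenPartialHomeomorph E4 E4, z₀ ∈ Φ.source ∧ Φ.source ⊆ Ω ∧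
      ContDiffOn ℝ ∞ Φ Φ.source ∧ ContDiffOn ℝ ∞ Φ.symm Φ.target ∧
      (∀ k, tl k = 0 → ∀ y ∈ Φ.target, ∀ a, (p (Φ.symm y) * jac Φ.symm y) a k = 0) ∧
      ∃ v h : ℝ → ℝ → Matrix (Fin 2) (Fin 2) ℝ, ∀ y ∈ Φ.target, ∀ i j,
        fr2 (jac Φ.symm y) (G (Φ.symm y)) i j
          = Real.exp (-φ (Φ.symm y)) * blockMetric (v (y 0) (y 1)) (h (y 2) (y 3)) i j := by
  have ht : ∀ i, tl i = 1 ∨ tl i = 0 := fun i => by fin_cases i <;> simp [tl]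
  obtain ⟨Φ, h1, h2, hc, h3, h4, hk, hi⟩ := h.exists_adapted_chart hz₀ ht hB
  have hD := Φ.open_target
  have hm : Set.MapsTo Φ.symm Φ.target Ω := fun y hy => h2 (Φ.map_target hy)
  have hk' : ∀ k, tl k = 0 → ∀ y ∈ Φ.target, ∀ a,
      ((1 - p (Φ.symm y)) * jac Φ.symm y) a k = jac Φ.symm y a k := fun k h0 y hy a => by
    rw [sub_mul, one_mul, Matrix.sub_apply, hk k h0 y hy, sub_zero]
  have hi' : ∀ i, tl i = 1 → ∀ y ∈ Φ.target, ∀ a,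
      ((1 - p (Φ.symm y)) * jac Φ.symm y) a i = 0 := fun i h0 y hy a => by
    rw [sub_mul, one_mul, Matrix.sub_apply, hi i h0 y hy, sub_self]
  -- The differential of φ is symmetric in the two planes, so the same potential serves for both
  -- blocks.
  have hcφ : ∀ z ∈ Ω, ∀ c, pd c φ z = 2 * (meanForm G (fun z => 1 - p z) c z
      + meanForm G (fun z => 1 - (1 - p z)) c z) := fun z hz c => by
    simp only [sub_sub_cancel]
    rw [hdφ z hz, add_comm]
  have hcu : IsUmbilicalSplitting Ω G (fun z => 1 - p z) := h.compl
  have hJ := smooth_jac hD h4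
  have hGJ : SmoothMat Φ.target (fun y => Matrix.of fun i j =>
      Real.exp (φ (Φ.symm y)) * fr2 (jac Φ.symm y) (G (Φ.symm y)) i j) := fun i j => by
    have hs : ContDiffOn ℝ ∞ (fun y => φ (Φ.symm y)) Φ.target := hφ.comp h4 hm
    refine (hs.exp.mul ((hJ.transpose.mul (h.smooth.comp_map h4 hm)).mul hJ i j)).congr
      fun y _ => ?_
    exact congrArg (Real.exp (φ (Φ.symm y)) * ·) (fr2_eq _ _ _ _)
  have hsym : ∀ y ∈ Φ.target, ∀ i j, fr2 (jac Φ.symm y) (G (Φ.symm y)) i j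
      = fr2 (jac Φ.symm y) (G (Φ.symm y)) j i := fun y hy => fr2_symm _ (h.symm _ (hm hy))
  -- g(∂_k, ∂_i) = g(∂_k, p ∂_i) = g(p ∂_k, ∂_i) = 0, by self-adjointness of the projector.
  have horth : ∀ y ∈ Φ.target, ∀ i k, tl i = 1 → tl k = 0 →
      fr2 (jac Φ.symm y) (G (Φ.symm y)) k i = 0 := fun y hy i k h0 h0' => by
    have e1 : fr2 (jac Φ.symm y) (G (Φ.symm y)) k i
        = fr2 (jac Φ.symm y) (G (Φ.symm y) * p (Φ.symm y)) k i := by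
      rw [fr2_eq, fr2_eq, mul_assoc, mul_assoc, mul_assoc, Matrix.mul_apply, Matrix.mul_apply]
      refine Finset.sum_congr rfl fun a _ => ?_
      rw [Matrix.mul_apply, Matrix.mul_apply]
      simp only [hi i h0 y hy]
    rw [e1, fr2_symm _ (h.self_adjoint _ (hm hy)), fr2_eq, mul_assoc, mul_assoc, ← mul_assoc,
      Matrix.mul_apply]
    simp only [hk k h0' y hy, mul_zero, Finset.sum_const_zero]
  obtain ⟨v, w, hvw⟩ := exists_blockMetric hD hc hGJ
    (fun i k h0 h0' y hy => by
      simp only [Matrix.of_apply]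
      rw [hsym y hy i k, horth y hy i k h0 h0', mul_zero]
      exact ⟨rfl, rfl⟩)
    (fun i j k h0 h0' h0'' y hy =>
      h.pd_conformal hD h4 hm hφ hdφ (hi i h0) (hi j h0') (hk k h0'') hy)
    (fun i j k h0 h0' h0'' y hy =>
      hcu.pd_conformal hD h4 hm hφ hcφ (hk' i h0) (hk' j h0') (hi' k h0'') hy)
  refine ⟨Φ, h1, h2, h3, h4, hk, v, w, fun y hy i j => ?_⟩
  rw [← hvw y hy, Matrix.of_apply, ← mul_assoc, ← Real.exp_add, neg_add_cancel, Real.exp_zero,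
    one_mul]

/-- The canonical 2-form annihilates the space-like plane. -/
theorem IsStructureOn.form_mul_proj {Ω : Set E4} {G U : E4 → Matrix (Fin 4) (Fin 4) ℝ}
    {η : E4 → FourForm} (h : IsStructureOn Ω G U η) {z : E4} (hz : z ∈ Ω) :
    U z * timelikeProj G U z = U z := by
  obtain ⟨B, s, hB, hU⟩ := h.frame z hz
  refine hB.conj_injective ?_
  have h1 : timelikeProj G U z * B = B * Matrix.diagonal tl := (hB.adapted hU).adapted
  calc B.transpose * (U z * timelikeProj G U z) * B
      = B.transpose * U z * (timelikeProj G U z * B) := by simp only [mul_assoc]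
    _ = canonicalForm * Matrix.diagonal tl := by rw [h1, ← mul_assoc, hU]
    _ = canonicalForm := by
      ext i j
      rw [Matrix.mul_diagonal]
      fin_cases i <;> fin_cases j <;> simp [canonicalForm, tl]
    _ = _ := hU.symm

/-! ### Transfer of adapted coordinates to charts of the manifold. -/

section Manifold

variable {M : Type*} [TopologicalSpace M] [ChartedSpace E4 M]

theorem trans_mem_maximalAtlas {e : OpenPartialHomeomorph M E4}
    (he : e ∈ IsManifold.maximalAtlas (𝓡 4) ∞ M) {Φ : OpenPartialHomeomorph E4 E4}
    (h₁ : ContDiffOn ℝ ∞ Φ Φ.source) (h₂ : ContDiffOn ℝ ∞ Φ.symm Φ.target) :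
    e.trans Φ ∈ IsManifold.maximalAtlas (𝓡 4) ∞ M := by
  have hΦ : Φ ∈ contDiffGroupoid ∞ (𝓡 4) := by
    refine ⟨?_, ?_⟩
    · exact h₁.mono fun z hz => hz.1
    · exact h₂.mono fun z hz => hz.1
  intro c hc
  obtain ⟨a, b⟩ := he c hc
  refine ⟨?_, ?_⟩
  · rw [OpenPartialHomeomorph.trans_symm_eq_symm_trans_symm, OpenPartialHomeomorph.trans_assoc]
    exact (contDiffGroupoid ∞ (𝓡 4)).trans ((contDiffGroupoid ∞ (𝓡 4)).symm hΦ) a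
  · rw [← OpenPartialHomeomorph.trans_assoc]
    exact (contDiffGroupoid ∞ (𝓡 4)).trans b hΦ

variable {e : OpenPartialHomeomorph M E4} (he : e ∈ IsManifold.maximalAtlas (𝓡 4) ∞ M)
  {Φ : OpenPartialHomeomorph E4 E4} (hΦ : ContDiffOn ℝ ∞ Φ.symm Φ.target)
include he hΦ

theorem coordVec_trans {y : E4} (hy : y ∈ Φ.target) (hy' : Φ.symm y ∈ e.target) (i : Fin 4) :
    coordVec (e.trans Φ) y i = ∑ a, jac Φ.symm y a i • coordVec e (Φ.symm y) a := by
  have h1 : DifferentiableAt ℝ Φ.symm y :=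
    (hΦ.contDiffAt (Φ.open_target.mem_nhds hy)).differentiableAt (by simp)
  have h2 := (mdifferentiable_of_mem_maximalAtlas he).mdifferentiableAt_symm hy'
  have h3 : mfderiv (𝓡 4) (𝓡 4) (e.trans Φ).symm y (EuclideanSpace.single i 1 : E4)
      = mfderiv (𝓡 4) (𝓡 4) e.symm (Φ.symm y)
        (fderiv ℝ Φ.symm y (EuclideanSpace.single i 1)) := by
    have h4 := mfderiv_comp (I := 𝓡 4) (I' := 𝓡 4) (I'' := 𝓡 4) y h2 h1.mdifferentiableAt
    rw [mfderiv_eq_fderiv] at h4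
    exact congrArg (fun L : E4 →L[ℝ] E4 => L (EuclideanSpace.single i 1)) h4
  have h5 : fderiv ℝ Φ.symm y (EuclideanSpace.single i 1)
      = ∑ a, jac Φ.symm y a i • (EuclideanSpace.single a (1 : ℝ) : E4) := by
    ext m
    rw [fderiv_single_eq_jac Φ.open_target hΦ hy]
    simp [Finset.sum_apply, Pi.single_apply]
  refine h3.trans ((congrArg _ h5).trans ?_)
  refine (map_sum (mfderiv (𝓡 4) (𝓡 4) e.symm (Φ.symm y)) _ _).trans ?_
  exact Finset.sum_congr rfl fun a _ => map_smul (mfderiv (𝓡 4) (𝓡 4) e.symm (Φ.symm y)) _ _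

theorem comp2_trans (β : (x : M) → TangentSpace (𝓡 4) x →ₗ[ℝ] TangentSpace (𝓡 4) x →ₗ[ℝ] ℝ)
    {y : E4} (hy : y ∈ Φ.target) (hy' : Φ.symm y ∈ e.target) (i j : Fin 4) :
    comp2 β (e.trans Φ) y i j = fr2 (jac Φ.symm y) (comp2 β e (Φ.symm y)) i j := by
  refine Eq.trans ?_ (bilinear_sum (β (e.symm (Φ.symm y))) (coordVec e (Φ.symm y))
    (jac Φ.symm y) i j).symm
  rw [← coordVec_trans he hΦ hy hy', ← coordVec_trans he hΦ hy hy']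
  rfl

end Manifold

/-- The adapted coordinates are built in the image of the given chart, inside the part corresponding
to `O`, and composed with that chart. Curvature enters only through the existence of the potential,
which is given here. -/
theorem TwoPlusTwo.isConformallyProductAt {M : Type*} [TopologicalSpace M] [ChartedSpace E4 M]
    [IsManifold (𝓡 4) ∞ M] {S : SpaceTime M} {T : TwoPlusTwo S}
    (hUmb : T.IsUmbilical) (hInt : T.IsIntegrable) {e : OpenPartialHomeomorph M E4}
    (he : e ∈ IsManifold.maximalAtlas (𝓡 4) ∞ M) {O : Set M} {φ : M → ℝ}
    (hφ : T.IsPotential e O φ) {p : M} (hp : p ∈ O) : T.IsConformallyProductAt O φ p := by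
  have h := T.isStructureOn he
  have hu := TwoPlusTwo.isUmbilicalSplitting hUmb hInt he
  have hO : IsOpen (e.target ∩ e.symm ⁻¹' O) := e.symm.isOpen_inter_preimage hφ.1
  have hpe : p ∈ e.source := hφ.2.1 hp
  have hz₀ : e p ∈ e.target ∩ e.symm ⁻¹' O := ⟨e.map_source hpe, by
    rwa [Set.mem_preimage, e.left_inv hpe]⟩
  obtain ⟨B, s, hB, hU⟩ := h.frame (e p) hz₀.1
  obtain ⟨Φ, h1, h2, h3, h4, hk, v, w, hvw⟩ :=
    (hu.mono hO Set.inter_subset_left).exists_conformal_product (hφ.contDiffOn he)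
      (fun z hz c => (hφ.2.2.2 z hz.1 hz.2 c).trans (h.expansionForm_eq hu hz.1 c)) hz₀
      (hB.adapted hU)
  refine ⟨e.trans Φ, trans_mem_maximalAtlas he h3 h4, ⟨hpe, h1⟩, fun x hx => ?_,
    fun y hy j => ?_, v, w, fun y hy => ?_⟩
  · have h5 : e.symm (e x) ∈ O := (h2 hx.2).2
    rwa [e.left_inv hx.1] at h5
  -- U v = U, so U annihilates the coordinate vectors of H in its second argument; antisymmetry
  -- moves this to the first.
  · have h5 : ∀ k, tl k = 0 → T.Uc (e.trans Φ) y k j = 0 := fun k h0 => by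
      have h6 : fr2 (jac Φ.symm y) (T.Uc e (Φ.symm y)) j k = 0 := by
        rw [fr2_eq, ← h.form_mul_proj hy.2, mul_assoc, mul_assoc, ← mul_assoc, Matrix.mul_apply]
        simp only [hk k h0 y hy.1, mul_zero, Finset.sum_const_zero]
      have h7 : fr2 (jac Φ.symm y) (T.Uc e (Φ.symm y)) k j
          = -fr2 (jac Φ.symm y) (T.Uc e (Φ.symm y)) j k := by
        rw [fr2_eq, fr2_eq, ← Matrix.transpose_apply (_ * jac Φ.symm y) j k]
        simp only [Matrix.transpose_mul, Matrix.transpose_transpose, h.form_antisymm hy.2,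
          mul_assoc, Matrix.neg_mul, Matrix.mul_neg, Matrix.neg_apply]
      refine (comp2_trans he h4 T.U hy.1 hy.2 k j).trans (h7.trans ?_)
      rw [h6, neg_zero]
    exact ⟨h5 2 rfl, h5 3 rfl⟩
  · ext i j
    exact (comp2_trans he h4 S.g hy.1 hy.2 i j).trans (hvw y hy.1 i j)

theorem mainTheorem9 {M : Type*} [TopologicalSpace M]
    [ChartedSpace (EuclideanSpace ℝ (Fin 4)) M] [IsManifold (𝓡 4) ∞ M]
    (S : SpaceTime M) (T : TwoPlusTwo S)
    (hD : S.IsTypeD) (hUmb : T.IsUmbilical) (hInt : T.IsIntegrable) :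
    S.HasRealWeylEigenvalues ∧ T.IsPrincipal ∧ T.IsMaxwellian ∧ T.HasClosedForms ∧
    (∀ e ∈ IsManifold.maximalAtlas (𝓡 4) ∞ M, ∀ p ∈ e.source,
      ∃ (O : Set M) (φ : M → ℝ), p ∈ O ∧ T.IsPotential e O φ) ∧
    (∀ e ∈ IsManifold.maximalAtlas (𝓡 4) ∞ M, ∀ (O : Set M) (φ : M → ℝ),
      T.IsPotential e O φ → ∀ p ∈ O, T.IsConformallyProductAt O φ p) :=
  ⟨TwoPlusTwo.hasRealWeylEigenvalues hUmb hInt hD, TwoPlusTwo.isPrincipal hUmb hInt hD,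
    TwoPlusTwo.isMaxwellian hUmb hInt hD, TwoPlusTwo.hasClosedForms hUmb hInt hD,
    fun _ he _ hp => TwoPlusTwo.exists_isPotential hUmb hInt hD he hp,
    fun _ he _ _ hφ _ hp => TwoPlusTwo.isConformallyProductAt hUmb hInt he hφ hp⟩

end
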